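/- **Setting.** Let $N\in\mathbb{N}_0$, and let $V\in W^{N+3,2}_{\mathrm{loc}}([0,\infty))$ be complex-valued (identified with its continuous representative). In $L^2(\mathbb{R}^+)$, $\mathbb{R}^+=(0,\infty)$, let $H_V=\frac{d^4}{dx^4}+V$ be the maximal operator, with domain $\mathrm{Dom}(H_V)=\{u\in L^2(\mathbb{R}^+): u''''+Vu\in L^2(\mathbb{R}^+)\}$ (in the sense of distributions on $\mathbb{R}^+$). **Assumption.** There are a continuous $\tau:[0,\infty)\to(0,\infty)$, differentiable for all large $x$, and numbers $\nu\ge-1$, $\varepsilon_1>0$, $t_1,t_2\in\left[0,\frac{\varepsilon_1}{20(3+\varepsilon_1)}\right]$ with $t_1-\frac{t_2}{4+\varepsilon_1}<\frac{\varepsilon_1}{20(4+\varepsilon_1)}$ such that, as $x\to+\infty$: 1. $|V^{(n)}(x)|=\mathcal{O}(\tau(x)^n|V(x)|)$ for all $1\le n\le N+3$ (almost everywhere); 2. $x^\nu=\mathcal{O}(\tau(x))$, $\ \tau'(x)=\mathcal{O}(x^\nu\tau(x))$, $\ |\Im V'(x)|=\mathcal{O}(\tau(x)|\Im V(x)|)$;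 3. $\tau(x)^4\left(\tau(x)^{12+4\varepsilon_1}+|\Re V(x)|^{3+\varepsilon_1}\right)=\mathcal{O}(|\Im V(x)|^4)$; 4. $\Im V(x)\to+\infty$; 5. there is a constant $C'>0$ such that for all large $x$: $\ \Im V(x)^{1-t_1}\tau(x)^{1+t_2}\le C'\,\Im V'(x)$ and $|\Im V''(x)|\le C'\,\Im V'(x)\tau(x)$. Let $\eta>0$ be such that $\frac{\eta}{\tau(x)}\le\frac{x^{-\nu}}{4}$ for all large $x$. For large $\beta$ let $x_\beta>0$ denote the turning point, i.e. the solution of $\Im V(x_\beta)=\beta$, and put $\Delta_\beta=\eta/\tau(x_\beta)$ and $J_\beta=(x_\beta-2\Delta_\beta,\,x_\beta+2\Delta_\beta)$. **Theorem.** Under this assumption, for every $K>0$ there exist $c,\beta_0,C>0$ and a family $(\Psi_{\lambda,N})_\lambda$ of functions such that the following holds. For every $\beta\ge\beta_0$ the equation $\Im V(x)=\beta$ has exactly one solution $x=x_\beta>0$. Moreover, for every $\lambda=\alpha+i\beta$ with $\beta\ge\beta_0$ and $\alpha\in\mathbb{R}$ satisfying $$K^{-1}|\alpha|\le\alpha-\Re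 V(x)\le K|\alpha|\quad(x\in J_\beta),\qquad K^{-1}\left[\beta\tau(x_\beta)\right]^{\frac45}\le|\alpha|\le K\left[\beta\tau(x_\beta)^{-1}\right]^{\frac{4+\varepsilon_1}{3+\varepsilon_1}},$$ one has $\Psi_{\lambda,N}\in\mathrm{Dom}(H_V)$, $\Psi_{\lambda,N}\neq0$, $\Psi_{\lambda,N}=0$ outside $J_\beta$, the support of $\Psi_{\lambda,N}$ is contained in $\mathbb{R}^+$, and $$\frac{\|(H_V-\lambda)\Psi_{\lambda,N}\|_{L^2(\mathbb{R}^+)}}{\|\Psi_{\lambda,N}\|_{L^2(\mathbb{R}^+)}}\le C\left(\kappa(\beta)+\sigma^{(N)}(\beta)\right),$$ where $$\kappa(\beta)=\exp\left(-c\,\frac{\Im V'(x_\beta)\,\tau(x_\beta)^{-2}}{|\alpha|^{3/4}+\beta^{3/4}}\right),\qquad \sigma^{(0)}(\beta)=\sum_{k=0}^{2}\sum_{j=1}^{k+1}\frac{\tau(x_\beta)^{k+1}\left(|\Re V(x_\beta)|^j+\beta^j\right)}{|\alpha|^{\frac{k-3}{4}+j}},$$ $$\sigma^{(N)}(\beta)=\sum_{k=0}^{3N-1}\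 \sum_{j=1}^{k+N+1}\frac{\tau(x_\beta)^{k+N+1}\left(|\Re V(x_\beta)|^j+\beta^j\right)}{|\alpha|^{\frac{k+N-3}{4}+j}}\qquad(N\ge1).$$ -/

import Mathlib

open MeasureTheory Set Filter Topology Asymptotics
open scoped ContDiff

noncomputable section

/-- Smooth complex test functions with compact support in the open half-line `(0, ∞)`. -/
def IsTestFunction (φ : ℝ → ℂ) : Prop :=
  ContDiff ℝ ∞ φ ∧ HasCompactSupport φ ∧ tsupport φ ⊆ Ioi 0

/-- Membership in `L²((0, R))` for every `R`, that is, `f ∈ L²_loc([0, ∞))`. -/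
def MemL2Loc (f : ℝ → ℂ) : Prop :=
  ∀ R : ℝ, MemLp f 2 (volume.restrict (Ioo 0 R))

/-- `g` is the `n`-th distributional derivative of `f` on `(0, ∞)`
(used for locally integrable `f` and `g`). -/
def IsWeakDeriv (n : ℕ) (f g : ℝ → ℂ) : Prop :=
  ∀ φ : ℝ → ℂ, IsTestFunction φ →
    ∫ x in Ioi (0 : ℝ), f x * iteratedDeriv n φ x
      = (-1) ^ n * ∫ x in Ioi (0 : ℝ), g x * φ x

/-- `f ∈ W^{m,2}_loc([0, ∞))`: `f` and its weak derivatives up to order `m` on `(0, ∞)` are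
square integrable on every interval `(0, R)`. -/
def MemSobolevLoc (m : ℕ) (f : ℝ → ℂ) : Prop :=
  MemL2Loc f ∧ ∀ n ∈ Finset.Icc 1 m, ∃ g : ℝ → ℂ, MemL2Loc g ∧ IsWeakDeriv n f g

/-- The norm of `L²(ℝ⁺)`. -/
def l2Norm (u : ℝ → ℂ) : ℝ :=
  (eLpNorm u 2 (volume.restrict (Ioi (0 : ℝ)))).toReal

/-- The graph of the maximal operator `H_V = d⁴/dx⁴ + V` in `L²(ℝ⁺)`:
`u ∈ L²(ℝ⁺)`, the distribution `u'''' + V u` on `(0, ∞)` is the function `w`,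
and `w ∈ L²(ℝ⁺)`. In other words `u ∈ Dom(H_V)` and `H_V u = w`. -/
def IsMaximalBiharmonic (V u w : ℝ → ℂ) : Prop :=
  MemLp u 2 (volume.restrict (Ioi (0 : ℝ))) ∧
  MemLp w 2 (volume.restrict (Ioi (0 : ℝ))) ∧
  ∀ φ : ℝ → ℂ, IsTestFunction φ →
    ∫ x in Ioi (0 : ℝ), (u x * iteratedDeriv 4 φ x + V x * u x * φ x)
      = ∫ x in Ioi (0 : ℝ), w x * φ x

/-- The assumptions on the potential `V` on `[0, ∞)`, with the control function `τ` and the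
parameters `ν`, `ε₁`, `t₁`, `t₂`. Only the values of `V` and `τ` on `[0, ∞)` matter.
A function in `W^{N+3,2}_loc` is identified with its continuous representative; the latter is of
class `C^{N+2}`, and `iteratedDeriv (N + 3) V` is its weak derivative of order `N + 3`
almost everywhere. -/
structure PotentialAssumption (N : ℕ) (V : ℝ → ℂ) (τ : ℝ → ℝ) (ν ε₁ t₁ t₂ : ℝ) : Prop where
  sobolev : MemSobolevLoc (N + 3) V
  continuousOn : ContinuousOn V (Ici 0)
  tau_continuousOn : ContinuousOn τ (Ici 0)
  tau_pos : ∀ x, 0 ≤ x → 0 < τ x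
  /-- `|V^{(n)}| = O(τⁿ |V|)` at `+∞` for `1 ≤ n ≤ N + 3` -/
  deriv_bound : ∀ n ∈ Finset.Icc 1 (N + 3), ∃ C R : ℝ, ∀ᵐ x : ℝ, R ≤ x →
    ‖iteratedDeriv n V x‖ ≤ C * (τ x ^ n * ‖V x‖)
  nu_ge : -1 ≤ ν
  tau_differentiable : ∀ᶠ x in atTop, DifferentiableAt ℝ τ x
  tau_lower : (fun x : ℝ => x ^ ν) =O[atTop] τ
  tau_deriv : deriv τ =O[atTop] (fun x : ℝ => x ^ ν * τ x)
  im_deriv_upper :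
    (fun x => (iteratedDeriv 1 V x).im) =O[atTop] (fun x => τ x * (V x).im)
  eps_pos : 0 < ε₁
  re_im_bound :
    (fun x => τ x ^ (4 : ℕ) * (τ x ^ (12 + 4 * ε₁) + |(V x).re| ^ (3 + ε₁)))
      =O[atTop] (fun x => |(V x).im| ^ (4 : ℕ))
  im_tendsto : Tendsto (fun x => (V x).im) atTop atTop
  t1_mem : t₁ ∈ Icc 0 (ε₁ / (20 * (3 + ε₁)))
  t2_mem : t₂ ∈ Icc 0 (ε₁ / (20 * (3 + ε₁)))
  t_lt : t₁ - 1 / (4 + ε₁) * t₂ < ε₁ / (20 * (4 + ε₁))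
  im_deriv_lower : ∃ C > 0, ∀ᶠ x in atTop,
    (V x).im ^ (1 - t₁) * τ x ^ (1 + t₂) ≤ C * (iteratedDeriv 1 V x).im
  im_deriv_two : ∃ C > 0, ∀ᶠ x in atTop,
    |(iteratedDeriv 2 V x).im| ≤ C * ((iteratedDeriv 1 V x).im * τ x)

/-- The turning point `x_β > 0`, the solution of `Im V(x_β) = β`
(the solution is unique for all large `β` under the assumptions on `V`). -/
def turningPoint (V : ℝ → ℂ) (β : ℝ) : ℝ :=
  sSup {x : ℝ | 0 < x ∧ (V x).im = β}

/-- The half-width parameter `Δ_β = η / τ(x_β)`. -/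
def halfWidth (V : ℝ → ℂ) (τ : ℝ → ℝ) (η β : ℝ) : ℝ :=
  η / τ (turningPoint V β)

/-- The interval `J_β = (x_β - 2 Δ_β, x_β + 2 Δ_β)`. -/
def modeInterval (V : ℝ → ℂ) (τ : ℝ → ℝ) (η β : ℝ) : Set ℝ :=
  Ioo (turningPoint V β - 2 * halfWidth V τ η β) (turningPoint V β + 2 * halfWidth V τ η β)

/-- The conditions on `α` at a given `β`, with implied constant `K`. -/
structure AdmissibleReal (V : ℝ → ℂ) (τ : ℝ → ℝ) (ε₁ η K β α : ℝ) : Prop where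
  sub_re_lower : ∀ x ∈ modeInterval V τ η β, K⁻¹ * |α| ≤ α - (V x).re
  sub_re_upper : ∀ x ∈ modeInterval V τ η β, α - (V x).re ≤ K * |α|
  lower : K⁻¹ * (β * τ (turningPoint V β)) ^ ((4 : ℝ) / 5) ≤ |α|
  upper : |α| ≤ K * (β / τ (turningPoint V β)) ^ ((4 + ε₁) / (3 + ε₁))

/-- The exponentially small term `κ(β)`. -/
def kappa (V : ℝ → ℂ) (τ : ℝ → ℝ) (c α β : ℝ) : ℝ :=
  Real.exp (-c * (((iteratedDeriv 1 V (turningPoint V β)).im * (τ (turningPoint V β) ^ 2)⁻¹)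
    / (|α| ^ ((3 : ℝ) / 4) + β ^ ((3 : ℝ) / 4))))

/-- A single term of the sum `σ^{(N)}(β)`. -/
def sigmaTerm (N : ℕ) (V : ℝ → ℂ) (τ : ℝ → ℝ) (α β : ℝ) (k j : ℕ) : ℝ :=
  τ (turningPoint V β) ^ (k + N + 1) * (|(V (turningPoint V β)).re| ^ j + β ^ j)
    / |α| ^ (((k : ℝ) + (N : ℝ) - 3) / 4 + (j : ℝ))

/-- The sum of powers `σ^{(N)}(β)`; the range of `k` is `0, …, 2` for `N = 0` and
`0, …, 3 N - 1` for `N ≥ 1`. -/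
def sigma (N : ℕ) (V : ℝ → ℂ) (τ : ℝ → ℝ) (α β : ℝ) : ℝ :=
  ∑ k ∈ Finset.range (if N = 0 then 3 else 3 * N),
    ∑ j ∈ Finset.Icc 1 (k + N + 1), sigmaTerm N V τ α β k j

end

/-! Put `z = λ - V` and let `μ` be its principal fourth root. Look for `u = exp S` with `S' = μ p`,
where `p` is a polynomial in the normalized derivatives `X i = V⁽ⁱ⁺¹⁾ / (z μⁱ⁺¹)`, with `X i` of
weight `i + 1`. Since `z' = -z μ X₀` and `μ' = -μ² X₀ / 4`, the derivative of `μᵏ p` is `μᵏ⁺¹` times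
a polynomial of weight one higher (`derivTwist`). Hence `u'''' + V u - λ u = z (eikonal p - 1) u`,
and the WKB recursion becomes algebra in a graded ring. It starts from `p = -i`, for which `p⁴ = 1`,
and each step cancels the lowest weight of `eikonal p - 1` (`exists_wkb_symbol`).

After `N` steps only weights from `N + 1` to `topWeight N` remain. As `|V⁽ⁱ⁾| ≲ τⁱ |V|`, a term of
weight `d` times `z` is controlled by terms `τᵈ |V|ʲ |z|^(-(d-4)/4 - j)` with `1 ≤ j ≤ d`. Replacing
`|z|` by its lower bound, a multiple of `|α|`, gives `σ^{(N)}` (`exists_ae_remainder_le`).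

Localization comes from the branch `-i`: up to lower order, `Re S' = Im μ`, which has the sign of `β
- Im V`. On `J_β` the function `Im V` crosses `β` upwards with slope comparable to `Im V'(x_β)`, so
`|u|` decays away from `x_β` like a Gaussian. At distance `Δ_β` the Gaussian exponent is that of
`κ`. Cutting off there leaves a commutator of size `κ` times a polynomial in `|α|, β, τ, τ⁻¹` times
`exp (C (1 + β/|α|))`, the last factor coming from the lower order phase. The conditions on `α`,
`t₁`, `t₂` make the exponent at least a positive power of `β (1 + τ⁻¹)` times `1 + β/|α|`, so half
of it absorbs both losses (`exists_absorb`).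

All constants must be uniform in `λ`. On `J_β` the quantities `τ`, `|V|` and `Im V'` are controlled
by their values at `x_β`, because logarithmic derivative times width is bounded. `LocalBounds`
records the outcome, with `T = τ(x_β)`, `ρ = |Re V(x_β)|` and `A = Im V'(x_β)`.

Regularity is just sufficient: `V⁽ᴺ⁺²⁾` is only absolutely continuous, hence so is `u'''`, and
`u''''` exists almost everywhere. Integration by parts for absolutely continuous functions still
identifies it with the distributional derivative. -/

/-! ### Weighted differential polynomials -/

/-- Differential polynomials; the variable of index `i` has weight `i + 1`. -/
abbrev SymbolRing : Type := MvPolynomial ℕ ℂ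

namespace SymbolRing
open MvPolynomial

/-- Polynomials that are weighted homogeneous of weight `d`. -/
inductive IsWeight : ℕ → SymbolRing → Prop
  | const (c : ℂ) : IsWeight 0 (C c)
  | zero (d : ℕ) : IsWeight d 0
  | var (i : ℕ) : IsWeight (i + 1) (X i)
  | add {d : ℕ} {p q : SymbolRing} : IsWeight d p → IsWeight d q → IsWeight d (p + q)
  | mul {d e : ℕ} {p q : SymbolRing} : IsWeight d p → IsWeight e q → IsWeight (d + e) (p * q)

/-- The derivation induced by differentiating the variables `V⁽ⁱ⁾ / (z μⁱ)`, `z = μ⁴ = λ - V`,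
rescaled by `μ⁻¹`. -/
noncomputable def diff : Derivation ℂ SymbolRing SymbolRing :=
  mkDerivation ℂ fun i => X (i + 1) + C (1 + ((i : ℂ) + 1) / 4) * X 0 * X i

/-- The operator describing the derivative of `μ ^ k` times a symbol. -/
noncomputable def derivTwist (k : ℂ) (p : SymbolRing) : SymbolRing :=
  diff p - C (k / 4) * X 0 * p

/-- The symbol of `(u'''' - z u) / (z u)`, shifted by one, when `u' / u = μ p`. -/
noncomputable def eikonal (p : SymbolRing) : SymbolRing :=
  p ^ 4 + 6 * p ^ 2 * derivTwist 1 p + 4 * p * derivTwist 2 (derivTwist 1 p)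
    + 3 * (derivTwist 1 p) ^ 2 + derivTwist 3 (derivTwist 2 (derivTwist 1 p))

theorem IsWeight.smul {d : ℕ} {p : SymbolRing} (c : ℂ) (h : IsWeight d p) :
    IsWeight d (C c * p) := by
  simpa using (IsWeight.const c).mul h

theorem IsWeight.weight_diff {d : ℕ} {p : SymbolRing} (h : IsWeight d p) :
    IsWeight (d + 1) (diff p) := by
  induction h with
  | const c => simpa [diff] using IsWeight.zero 1
  | zero d => simpa using IsWeight.zero (d + 1)
  | var i =>
    rw [diff, mkDerivation_X]
    refine (IsWeight.var (i + 1)).add ?_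
    have := ((IsWeight.var 0).smul (1 + ((i : ℂ) + 1) / 4)).mul (IsWeight.var i)
    convert this using 1
    omega
  | add _ _ hp hq => simpa using hp.add hq
  | @mul d e p q hp hq hp' hq' =>
    rw [Derivation.leibniz, smul_eq_mul, smul_eq_mul]
    refine IsWeight.add ?_ ?_
    · exact (hp.mul hq')
    · have := hq.mul hp'
      convert this using 1
      omega

theorem IsWeight.weight_derivTwist {d : ℕ} {p : SymbolRing} (k : ℂ) (h : IsWeight d p) :
    IsWeight (d + 1) (derivTwist k p) := by
  have h1 := ((IsWeight.var 0).smul (-(k / 4))).mul h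
  have h2 := h.weight_diff.add (q := C (-(k / 4)) * X 0 * p) (by convert h1 using 1; omega)
  convert h2 using 1
  simp [derivTwist, sub_eq_add_neg]

/-- Sums of homogeneous polynomials of weights between `a` and `b`. -/
noncomputable def weightRange (a b : ℕ) : Submodule ℂ SymbolRing :=
  Submodule.span ℂ {p | ∃ d, a ≤ d ∧ d ≤ b ∧ IsWeight d p}

theorem IsWeight.mem {d a b : ℕ} {p : SymbolRing} (h : IsWeight d p) (ha : a ≤ d) (hb : d ≤ b) :
    p ∈ weightRange a b :=
  Submodule.subset_span ⟨d, ha, hb, h⟩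

theorem weightRange_mono {a b a' b' : ℕ} (ha : a' ≤ a) (hb : b ≤ b') {p : SymbolRing}
    (h : p ∈ weightRange a b) : p ∈ weightRange a' b' :=
  Submodule.span_mono (by rintro _ ⟨d, h1, h2, h3⟩; exact ⟨d, ha.trans h1, h2.trans hb, h3⟩) h

theorem C_mul_mem {a b : ℕ} (c : ℂ) {p : SymbolRing} (h : p ∈ weightRange a b) :
    C c * p ∈ weightRange a b := by
  rw [C_mul']
  exact Submodule.smul_mem _ _ h

theorem mul_mem_weightRange {a b a' b' A B : ℕ} {p q : SymbolRing} (hp : p ∈ weightRange a b)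
    (hq : q ∈ weightRange a' b') (hA : A ≤ a + a') (hB : b + b' ≤ B) :
    p * q ∈ weightRange A B := by
  have : p * q ∈ weightRange a b * weightRange a' b' := Submodule.mul_mem_mul hp hq
  rw [weightRange, weightRange, Submodule.span_mul_span] at this
  refine Submodule.span_le.2 ?_ this
  rintro _ ⟨x, ⟨d, h1, h2, h3⟩, y, ⟨e, h4, h5, h6⟩, rfl⟩
  exact (h3.mul h6).mem (by omega) (by omega)

theorem derivTwist_add (k : ℂ) (p q : SymbolRing) :
    derivTwist k (p + q) = derivTwist k p + derivTwist k q := by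
  simp only [derivTwist, map_add]; ring

theorem derivTwist_smul (k c : ℂ) (p : SymbolRing) :
    derivTwist k (c • p) = c • derivTwist k p := by
  simp only [derivTwist, Derivation.map_smul, smul_sub, mul_smul_comm]

theorem derivTwist_mem {a b : ℕ} (k : ℂ) {p : SymbolRing} (h : p ∈ weightRange a b) :
    derivTwist k p ∈ weightRange (a + 1) (b + 1) := by
  induction h using Submodule.span_induction with
  | mem x hx =>
    obtain ⟨d, h1, h2, h3⟩ := hx
    exact (h3.weight_derivTwist k).mem (by omega) (by omega)
  | zero => simp [derivTwist]
  | add x y _ _ hx hy => rw [derivTwist_add]; exact Submodule.add_mem _ hx hy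
  | smul c x _ hx => rw [derivTwist_smul]; exact Submodule.smul_mem _ _ hx

/-- This isolates the homogeneous part that the next WKB correction has to cancel. -/
theorem exists_lowest_part {a b : ℕ} {p : SymbolRing} (h : p ∈ weightRange a b) :
    ∃ q, IsWeight a q ∧ p - q ∈ weightRange (a + 1) b := by
  induction h using Submodule.span_induction with
  | mem x hx =>
    obtain ⟨d, h1, h2, h3⟩ := hx
    rcases h1.eq_or_lt with rfl | h1
    · exact ⟨x, h3, by simp⟩
    · exact ⟨0, .zero _, by simpa using h3.mem h1 h2⟩
  | zero => exact ⟨0, .zero _, by simp⟩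
  | add x y _ _ hx hy =>
    obtain ⟨q, h1, h2⟩ := hx
    obtain ⟨r, h3, h4⟩ := hy
    exact ⟨q + r, h1.add h3, by simpa [add_sub_add_comm] using Submodule.add_mem _ h2 h4⟩
  | smul c x _ hx =>
    obtain ⟨q, h1, h2⟩ := hx
    refine ⟨C c * q, h1.smul c, ?_⟩
    rw [C_mul', ← smul_sub]
    exact Submodule.smul_mem _ _ h2

theorem eikonal_add (p q : SymbolRing) :
    eikonal (p + q) = eikonal p + 4 * p ^ 3 * q +
      (6 * (p * p) * (q * q) + 4 * p * (q * q * q) + q * q * (q * q)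
        + 6 * ((2 * p + q) * q) * derivTwist 1 p
        + 6 * ((p + q) * (p + q)) * derivTwist 1 q
        + 4 * q * derivTwist 2 (derivTwist 1 p)
        + 4 * (p + q) * derivTwist 2 (derivTwist 1 q)
        + 6 * derivTwist 1 p * derivTwist 1 q + 3 * (derivTwist 1 q * derivTwist 1 q)
        + derivTwist 3 (derivTwist 2 (derivTwist 1 q))) := by
  simp only [eikonal, derivTwist_add]; ring

theorem ofNat_mul_mem {a b : ℕ} (n : ℕ) [n.AtLeastTwo] {p : SymbolRing}
    (h : p ∈ weightRange a b) :
    (OfNat.ofNat n : SymbolRing) * p ∈ weightRange a b := by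
  have := C_mul_mem (OfNat.ofNat n : ℂ) h
  rwa [map_ofNat C n] at this

/-- The upper bound for the weights in the remainder of the WKB construction of order `N`. -/
def topWeight (N : ℕ) : ℕ := N + if N = 0 then 3 else 3 * N

/-- In the expansion of `eikonal (p + q)` every term involving `q`, other than `4 p³ q`, either
contains `q` at least twice or carries a derivative, so its weight is at least `N + 2`. The upper
bound is the weight of `q⁴`. -/
theorem eikonal_add_mem {N : ℕ} {p q : SymbolRing} (hp : p ∈ weightRange 0 N)
    (hq : IsWeight (N + 1) q) :
    eikonal (p + q) - eikonal p - 4 * p ^ 3 * q ∈ weightRange (N + 2) (4 * (N + 1)) := by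
  have hq0 : q ∈ weightRange (N + 1) (N + 1) := hq.mem le_rfl le_rfl
  have hpq : p + q ∈ weightRange 0 (N + 1) :=
    Submodule.add_mem _ (weightRange_mono le_rfl (by omega) hp)
      (weightRange_mono (by omega) le_rfl hq0)
  have h2pq : 2 * p + q ∈ weightRange 0 (N + 1) :=
    Submodule.add_mem _ (weightRange_mono le_rfl (by omega) (ofNat_mul_mem 2 hp))
      (weightRange_mono (by omega) le_rfl hq0)
  have hdp := derivTwist_mem 1 hp
  have hdq := derivTwist_mem 1 hq0
  have hddp := derivTwist_mem 2 hdp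
  have hddq := derivTwist_mem 2 hdq
  have hdddq := derivTwist_mem 3 hddq
  have hpp := mul_mem_weightRange hp hp le_rfl le_rfl
  have hqq := mul_mem_weightRange hq0 hq0 le_rfl le_rfl
  have hqqq := mul_mem_weightRange hqq hq0 le_rfl le_rfl
  have hpqpq := mul_mem_weightRange hpq hpq le_rfl le_rfl
  have h2pqq := mul_mem_weightRange h2pq hq0 le_rfl le_rfl
  rw [eikonal_add, sub_sub, add_sub_cancel_left]
  refine Submodule.add_mem _ (Submodule.add_mem _ (Submodule.add_mem _ (Submodule.add_mem _
    (Submodule.add_mem _ (Submodule.add_mem _ (Submodule.add_mem _ (Submodule.add_mem _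
    (Submodule.add_mem _ ?_ ?_) ?_) ?_) ?_) ?_) ?_) ?_) ?_) ?_
  · exact mul_mem_weightRange (ofNat_mul_mem 6 hpp) hqq (by omega) (by omega)
  · exact mul_mem_weightRange (ofNat_mul_mem 4 hp) hqqq (by omega) (by omega)
  · exact mul_mem_weightRange hqq hqq (by omega) (by omega)
  · exact mul_mem_weightRange (ofNat_mul_mem 6 h2pqq) hdp (by omega) (by omega)
  · exact mul_mem_weightRange (ofNat_mul_mem 6 hpqpq) hdq (by omega) (by omega)
  · exact mul_mem_weightRange (ofNat_mul_mem 4 hq0) hddp (by omega) (by omega)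
  · exact mul_mem_weightRange (ofNat_mul_mem 4 hpq) hddq (by omega) (by omega)
  · exact mul_mem_weightRange (ofNat_mul_mem 6 hdp) hdq (by omega) (by omega)
  · exact ofNat_mul_mem 3 (mul_mem_weightRange hdq hdq (by omega) (by omega))
  · exact weightRange_mono (by omega) (by omega) hdddq

/-- Transport equations solved weight by weight. For `N = 0` the quartic term is exactly `1`, so the
top weight is that of three derivatives. For `N ≥ 1` it is the weight `4 N` of `p⁴`. -/
theorem exists_wkb_symbol (N : ℕ) :
    ∃ p : SymbolRing, p - C (-Complex.I) ∈ weightRange 1 N ∧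
      eikonal p - 1 ∈ weightRange (N + 1) (topWeight N) := by
  induction N with
  | zero =>
    refine ⟨C (-Complex.I), by simp, ?_⟩
    have h0 : (C (-Complex.I) : SymbolRing) ∈ weightRange 0 0 :=
      (IsWeight.const _).mem le_rfl le_rfl
    have h1 := derivTwist_mem 1 h0
    have h2 := derivTwist_mem 2 h1
    have h3 := derivTwist_mem 3 h2
    have h4 : (C (-Complex.I) : SymbolRing) ^ 4 = 1 := by
      rw [← C_pow, Even.neg_pow (by decide), Complex.I_pow_four, C_1]
    have : eikonal (C (-Complex.I)) - 1 =
        6 * (C (-Complex.I) * C (-Complex.I)) * derivTwist 1 (C (-Complex.I))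
        + 4 * C (-Complex.I) * derivTwist 2 (derivTwist 1 (C (-Complex.I)))
        + 3 * (derivTwist 1 (C (-Complex.I)) * derivTwist 1 (C (-Complex.I)))
        + derivTwist 3 (derivTwist 2 (derivTwist 1 (C (-Complex.I)))) := by
      rw [eikonal, h4]; ring
    rw [this]
    have h00 := mul_mem_weightRange h0 h0 le_rfl le_rfl
    simp only [topWeight, if_true]
    refine Submodule.add_mem _ (Submodule.add_mem _ (Submodule.add_mem _ ?_ ?_) ?_) ?_
    · exact mul_mem_weightRange (ofNat_mul_mem 6 h00) h1 (by omega) (by omega)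
    · exact mul_mem_weightRange (ofNat_mul_mem 4 h0) h2 (by omega) (by omega)
    · exact ofNat_mul_mem 3 (mul_mem_weightRange h1 h1 (by omega) (by omega))
    · exact weightRange_mono (by omega) (by omega) h3
  | succ N ih =>
    obtain ⟨p, hp, hE⟩ := ih
    obtain ⟨r, hr, hr'⟩ := exists_lowest_part hE
    have hc : (C (-Complex.I) : SymbolRing) ∈ weightRange 0 N :=
      (IsWeight.const _).mem le_rfl (Nat.zero_le _)
    have hp0 : p ∈ weightRange 0 N := by
      have := Submodule.add_mem _ (weightRange_mono (Nat.zero_le 1) le_rfl hp) hc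
      simpa using this
    -- The factor solves `4 (-i)³ · c = -1`, so that `q` removes `r` at leading order.
    set q : SymbolRing := C (Complex.I / 4) * r with hq
    have hqw : IsWeight (N + 1) q := hr.smul _
    have hq0 : q ∈ weightRange (N + 1) (N + 1) := hqw.mem le_rfl le_rfl
    refine ⟨p + q, ?_, ?_⟩
    · have : p + q - C (-Complex.I) = (p - C (-Complex.I)) + q := by ring
      rw [this]
      exact Submodule.add_mem _ (weightRange_mono le_rfl (by omega) hp)
        (weightRange_mono (by omega) le_rfl hq0)
    · have htop : topWeight (N + 1) = 4 * (N + 1) := by simp [topWeight]; ring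
      have htop' : topWeight N ≤ 4 * (N + 1) := by unfold topWeight; split_ifs <;> omega
      rw [htop]
      have h4 : 4 * C (-Complex.I) ^ 3 * q = -r := by
        have e : (4 : SymbolRing) = C 4 := (map_ofNat C 4).symm
        rw [hq, e, ← C_pow, ← mul_assoc, ← C_mul, ← C_mul]
        have : 4 * (-Complex.I) ^ 3 * (Complex.I / 4) = -1 := by
          have := Complex.I_pow_four
          linear_combination -this
        rw [this]; simp
      -- The linear term is `4 p³ q`, not `4 (-i)³ q`. The difference is harmless because `p³ -
      -- (-i)³` contains the factor `p + i`, of weight at least one.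
      have key : eikonal (p + q) - 1 = (eikonal p - 1 - r)
          + 4 * ((p - C (-Complex.I)) * (p * p + p * C (-Complex.I)
              + C (-Complex.I) * C (-Complex.I)) * q)
          + (eikonal (p + q) - eikonal p - 4 * p ^ 3 * q) := by
        linear_combination h4
      rw [key]
      refine Submodule.add_mem _ (Submodule.add_mem _ ?_ ?_) (eikonal_add_mem hp0 hqw)
      · exact weightRange_mono le_rfl htop' hr'
      · refine ofNat_mul_mem 4 (mul_mem_weightRange (mul_mem_weightRange (B := 3 * N) hp
          (Submodule.add_mem _ (Submodule.add_mem _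
          (mul_mem_weightRange hp0 hp0 le_rfl le_rfl) (mul_mem_weightRange hp0 hc le_rfl le_rfl))
          (mul_mem_weightRange hc hc le_rfl le_rfl)) le_rfl (by omega)) hq0 (by omega) (by omega))

end SymbolRing

/-! ### Evaluation of the polynomials at the normalized derivatives of `V` -/

namespace SymbolRing
open MvPolynomial

/-- Weight `d` only admits variables of index below `d`, so the differentiation rule is needed for
finitely many variables. This is what matches weights with the limited smoothness of `V`. -/
theorem IsWeight.hasDerivAt_eval {Y : ℕ → ℝ → ℂ} {m : ℂ} {x : ℝ} {M d : ℕ} {p : SymbolRing}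
    (hY : ∀ i < M, HasDerivAt (Y i)
      (m * (Y (i + 1) x + (1 + ((i : ℂ) + 1) / 4) * Y 0 x * Y i x)) x)
    (hp : IsWeight d p) (hd : d ≤ M) :
    HasDerivAt (fun y => eval (fun i => Y i y) p) (m * eval (fun i => Y i x) (diff p)) x := by
  induction hp with
  | const c => simpa [diff] using hasDerivAt_const x c
  | zero d => simpa using hasDerivAt_const x (0 : ℂ)
  | var i =>
    have := hY i (by omega)
    simpa [diff, mkDerivation_X] using this
  | add _ _ hp hq =>
    simp only [map_add, mul_add]
    exact (hp hd).add (hq hd)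
  | mul _ _ hp hq =>
    simp only [map_mul, Derivation.leibniz, smul_eq_mul, map_add]
    exact ((hp (by omega)).mul (hq (by omega))).congr_deriv (by ring)

theorem hasDerivAt_eval {Y : ℕ → ℝ → ℂ} {m : ℂ} {x : ℝ} {M a b : ℕ} {p : SymbolRing}
    (hY : ∀ i < M, HasDerivAt (Y i)
      (m * (Y (i + 1) x + (1 + ((i : ℂ) + 1) / 4) * Y 0 x * Y i x)) x)
    (hp : p ∈ weightRange a b) (hb : b ≤ M) :
    HasDerivAt (fun y => eval (fun i => Y i y) p) (m * eval (fun i => Y i x) (diff p)) x := by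
  induction hp using Submodule.span_induction with
  | mem p hp =>
    obtain ⟨d, -, h2, h3⟩ := hp
    exact h3.hasDerivAt_eval hY (h2.trans hb)
  | zero => simpa using hasDerivAt_const x (0 : ℂ)
  | add p q _ _ hp hq =>
    simp only [map_add, mul_add]
    exact hp.add hq
  | smul c p _ hp =>
    simp only [smul_eval, Derivation.map_smul]
    exact (hp.const_mul c).congr_deriv (by ring)

theorem absolutelyContinuousOnInterval_const (c : ℂ) (a b : ℝ) :
    AbsolutelyContinuousOnInterval (fun _ : ℝ => c) a b :=
  contDiffOn_const.absolutelyContinuousOnInterval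

theorem absolutelyContinuousOnInterval_eval {Y : ℕ → ℝ → ℂ} {α β : ℝ} {M a b : ℕ}
    {p : SymbolRing} (hY : ∀ i < M, AbsolutelyContinuousOnInterval (Y i) α β)
    (hp : p ∈ weightRange a b) (hb : b ≤ M) :
    AbsolutelyContinuousOnInterval (fun y => eval (fun i => Y i y) p) α β := by
  induction hp using Submodule.span_induction with
  | mem p hp =>
    obtain ⟨d, -, h2, h3⟩ := hp
    replace h2 := h2.trans hb
    clear hb
    induction h3 with
    | const c => simpa using absolutelyContinuousOnInterval_const c α β
    | zero d => simpa using absolutelyContinuousOnInterval_const 0 α β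
    | var i => simpa using hY i (by omega)
    | add _ _ hp hq =>
      simp only [map_add]
      exact (hp h2).add (hq h2)
    | mul _ _ hp hq =>
      simp only [map_mul]
      exact (hp (by omega)).smul (hq (by omega))
  | zero => simpa using absolutelyContinuousOnInterval_const 0 α β
  | add p q _ _ hp hq =>
    simp only [map_add]
    exact hp.add hq
  | smul c p _ hp =>
    simp only [smul_eval]
    exact hp.const_smul c

/-- The size of a polynomial of weight `d` when the `i`-th variable is bounded by
`θ ^ (i + 1) * b`. -/
noncomputable def weightBound (θ b : ℝ) : ℕ → ℝ
  | 0 => 1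
  | d + 1 => θ ^ (d + 1) * (b * (1 + b) ^ d)

theorem weightBound_nonneg {θ b : ℝ} (hθ : 0 ≤ θ) (hb : 0 ≤ b) (d : ℕ) :
    0 ≤ weightBound θ b d := by
  cases d <;> simp only [weightBound] <;> positivity

theorem weightBound_mul_le {θ b : ℝ} (hθ : 0 ≤ θ) (hb : 0 ≤ b) (d e : ℕ) :
    weightBound θ b d * weightBound θ b e ≤ weightBound θ b (d + e) := by
  rcases d with _ | d
  · simp [weightBound]
  rcases e with _ | e
  · simp [weightBound]
  have : d + 1 + (e + 1) = (d + e + 1) + 1 := by omega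
  rw [this]
  simp only [weightBound]
  have h : b * b ≤ b * (1 + b) := by nlinarith
  calc θ ^ (d + 1) * (b * (1 + b) ^ d) * (θ ^ (e + 1) * (b * (1 + b) ^ e))
      = θ ^ (d + e + 1 + 1) * (1 + b) ^ (d + e) * (b * b) := by ring
    _ ≤ θ ^ (d + e + 1 + 1) * (1 + b) ^ (d + e) * (b * (1 + b)) := by gcongr
    _ = _ := by ring

/-- A nonconstant monomial of weight `d` has between one and `d` factors, each contributing one `b`,
while the powers of `θ` always add up to `d`. Keeping at least one factor `b` is essential for the
final error, in which `j ≥ 1`. -/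
theorem IsWeight.exists_norm_eval_le {d : ℕ} {p : SymbolRing} (hp : IsWeight d p) {A : ℝ}
    (hA : 0 ≤ A) :
    ∃ C, 0 ≤ C ∧ ∀ (y : ℕ → ℂ) (θ b : ℝ), 0 ≤ θ → 0 ≤ b →
      (∀ i < d, ‖y i‖ ≤ A * (θ ^ (i + 1) * b)) → ‖eval y p‖ ≤ C * weightBound θ b d := by
  induction hp with
  | const c => exact ⟨‖c‖, norm_nonneg _, fun y θ b _ _ _ => by simp [weightBound]⟩
  | zero d => exact ⟨0, le_rfl, fun y θ b _ _ _ => by simp⟩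
  | var i =>
    refine ⟨A, hA, fun y θ b hθ hb h => ?_⟩
    simp only [eval_X, weightBound]
    refine (h i (by omega)).trans ?_
    have : b ≤ b * (1 + b) ^ i := le_mul_of_one_le_right hb (one_le_pow₀ (by linarith))
    gcongr
  | add _ _ hp hq =>
    obtain ⟨C, hC, hp⟩ := hp
    obtain ⟨D, hD, hq⟩ := hq
    refine ⟨C + D, by positivity, fun y θ b hθ hb h => ?_⟩
    rw [map_add, add_mul]
    exact (norm_add_le _ _).trans (add_le_add (hp y θ b hθ hb h) (hq y θ b hθ hb h))
  | @mul d e _ _ _ _ hp hq =>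
    obtain ⟨C, hC, hp⟩ := hp
    obtain ⟨D, hD, hq⟩ := hq
    refine ⟨C * D, by positivity, fun y θ b hθ hb h => ?_⟩
    rw [map_mul, norm_mul]
    calc _ ≤ (C * weightBound θ b d) * (D * weightBound θ b e) :=
          mul_le_mul (hp y θ b hθ hb fun i hi => h i (by omega))
            (hq y θ b hθ hb fun i hi => h i (by omega)) (norm_nonneg _)
            (mul_nonneg hC (weightBound_nonneg hθ hb _))
      _ = C * D * (weightBound θ b d * weightBound θ b e) := by ring
      _ ≤ _ := by gcongr; exact weightBound_mul_le hθ hb d e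

theorem exists_norm_eval_le {m n : ℕ} {p : SymbolRing} (hp : p ∈ weightRange m n) {A : ℝ}
    (hA : 0 ≤ A) :
    ∃ C, 0 ≤ C ∧ ∀ (y : ℕ → ℂ) (θ b : ℝ), 0 ≤ θ → 0 ≤ b →
      (∀ i < n, ‖y i‖ ≤ A * (θ ^ (i + 1) * b)) →
        ‖eval y p‖ ≤ C * ∑ d ∈ Finset.Icc m n, weightBound θ b d := by
  induction hp using Submodule.span_induction with
  | mem p hp =>
    obtain ⟨d, h1, h2, h3⟩ := hp
    obtain ⟨C, hC, h⟩ := h3.exists_norm_eval_le hA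
    refine ⟨C, hC, fun y θ b hθ hb hy => (h y θ b hθ hb fun i hi => hy i (by omega)).trans ?_⟩
    gcongr
    exact Finset.single_le_sum (fun i _ => weightBound_nonneg hθ hb i)
      (Finset.mem_Icc.2 ⟨h1, h2⟩)
  | zero => exact ⟨0, le_rfl, fun y θ b _ _ _ => by simp⟩
  | add p q _ _ hp hq =>
    obtain ⟨C, hC, hp⟩ := hp
    obtain ⟨D, hD, hq⟩ := hq
    refine ⟨C + D, by positivity, fun y θ b hθ hb h => ?_⟩
    rw [map_add, add_mul]
    exact (norm_add_le _ _).trans (add_le_add (hp y θ b hθ hb h) (hq y θ b hθ hb h))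
  | smul c p _ hp =>
    obtain ⟨C, hC, hp⟩ := hp
    refine ⟨‖c‖ * C, by positivity, fun y θ b hθ hb h => ?_⟩
    rw [smul_eval, norm_mul, mul_assoc]
    gcongr
    exact hp y θ b hθ hb h

/-- The principal fourth root `μ = (λ - V)^{1/4}`. -/
noncomputable def root (V : ℝ → ℂ) (l : ℂ) (x : ℝ) : ℂ := (l - V x) ^ (1 / 4 : ℂ)

/-- The values of the variables: `V⁽ⁱ⁺¹⁾ / ((λ - V) μⁱ⁺¹)` for `i < M`. -/
noncomputable def coord (M : ℕ) (V : ℝ → ℂ) (l : ℂ) (i : ℕ) (x : ℝ) : ℂ :=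
  if i < M then iteratedDeriv (i + 1) V x / ((l - V x) * root V l x ^ (i + 1)) else 0

theorem root_pow_four (V : ℝ → ℂ) (l : ℂ) (x : ℝ) : root V l x ^ 4 = l - V x := by
  rw [root, ← Complex.cpow_nat_mul]; simp

theorem root_ne_zero {V : ℝ → ℂ} {l : ℂ} {x : ℝ} (h : l - V x ≠ 0) : root V l x ≠ 0 := by
  rintro h0
  rw [← root_pow_four, h0] at h
  simp at h

theorem hasDerivAt_root {V : ℝ → ℂ} {l : ℂ} {x : ℝ} {M : ℕ} (hM : 0 < M)
    (hz : l - V x ∈ Complex.slitPlane) (hV : HasDerivAt V (iteratedDeriv 1 V x) x) :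
    HasDerivAt (root V l) (-(1 / 4) * root V l x ^ 2 * coord M V l 0 x) x := by
  have hz0 : l - V x ≠ 0 := Complex.slitPlane_ne_zero hz
  have hr := root_ne_zero hz0
  have h1 : HasDerivAt (fun y => l - V y) (-iteratedDeriv 1 V x) x := hV.const_sub l
  have h2 := (hasDerivAt_id (l - V x)).cpow_const (c := (1 / 4 : ℂ)) hz
  have h3 := h2.comp_of_eq x h1 rfl
  refine h3.congr_deriv ?_
  simp only [coord, if_pos hM, zero_add, pow_one, id]
  rw [Complex.cpow_sub _ _ hz0, Complex.cpow_one]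
  rw [show (l - V x) ^ (1 / 4 : ℂ) = root V l x from rfl]
  field_simp

theorem hasDerivAt_coord {V : ℝ → ℂ} {l : ℂ} {x : ℝ} {M i : ℕ} (hi : i + 1 < M)
    (hz : l - V x ∈ Complex.slitPlane) (hV : HasDerivAt V (iteratedDeriv 1 V x) x)
    (hVi : HasDerivAt (iteratedDeriv (i + 1) V) (iteratedDeriv (i + 2) V x) x) :
    HasDerivAt (coord M V l i) (root V l x *
      (coord M V l (i + 1) x + (1 + ((i : ℂ) + 1) / 4) * coord M V l 0 x * coord M V l i x)) x := by
  have hz0 : l - V x ≠ 0 := Complex.slitPlane_ne_zero hz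
  have hr := root_ne_zero hz0
  have hroot := hasDerivAt_root (M := M) (by omega) hz hV
  have h1 : HasDerivAt (fun y => l - V y) (-iteratedDeriv 1 V x) x := hV.const_sub l
  have h2 := hVi.div (h1.mul (hroot.pow (i + 1))) (mul_ne_zero hz0 (pow_ne_zero _ hr))
  have e : coord M V l i =
      fun y => iteratedDeriv (i + 1) V y / ((l - V y) * root V l y ^ (i + 1)) := by
    funext y; simp [coord, show i < M by omega]
  rw [e]
  refine h2.congr_deriv ?_
  simp only [coord, if_pos (show 0 < M by omega), if_pos hi, Pi.mul_apply, Pi.pow_apply, zero_add,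
    pow_one, Nat.add_sub_cancel]
  push_cast
  field_simp
  ring

/-- This realizes `derivTwist k` as `d/dx` acting on `μᵏ` times a symbol. Differentiating weight up
to `m` brings in the variable of index `m`, which must survive the truncation in `coord`, hence `m <
M`. -/
theorem hasDerivAt_root_pow_mul_eval {V : ℝ → ℂ} {l : ℂ} {x : ℝ} {M m a b k : ℕ}
    {p : SymbolRing} (hm : m < M) (hM : 0 < m)
    (hz : l - V x ∈ Complex.slitPlane)
    (hV : ∀ i ≤ m, HasDerivAt (iteratedDeriv i V) (iteratedDeriv (i + 1) V x) x)
    (hp : p ∈ weightRange a b) (hb : b ≤ m) :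
    HasDerivAt (fun y => root V l y ^ k * eval (fun i => coord M V l i y) p)
      (root V l x ^ (k + 1) * eval (fun i => coord M V l i x) (derivTwist k p)) x := by
  have hV0 : HasDerivAt V (iteratedDeriv 1 V x) x := by
    simpa [iteratedDeriv_zero] using hV 0 (Nat.zero_le _)
  have h1 := (hasDerivAt_root (M := M) (by omega) hz hV0).pow k
  have hY : ∀ i < m, HasDerivAt (coord M V l i) (root V l x *
      (coord M V l (i + 1) x + (1 + ((i : ℂ) + 1) / 4) * coord M V l 0 x * coord M V l i x)) x :=
    fun i hi => hasDerivAt_coord (by omega) hz hV0 (hV (i + 1) (by omega))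
  have h2 := hasDerivAt_eval hY hp hb
  refine (h1.mul h2).congr_deriv ?_
  simp only [derivTwist, map_sub, map_mul, eval_C, eval_X, Pi.pow_apply]
  rcases k with _ | k
  · simp
  · simp only [Nat.add_sub_cancel]; push_cast; ring

end SymbolRing

/-! ### Absolutely continuous complex-valued functions -/

theorem AbsolutelyContinuousOnInterval.ofReal {f : ℝ → ℝ} {a b : ℝ}
    (hf : AbsolutelyContinuousOnInterval f a b) :
    AbsolutelyContinuousOnInterval (fun x => (f x : ℂ)) a b := by
  unfold AbsolutelyContinuousOnInterval at hf ⊢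
  simpa [Complex.dist_eq, ← Complex.ofReal_sub, Real.dist_eq] using hf

theorem AbsolutelyContinuousOnInterval.congr {f g : ℝ → ℂ} {a b : ℝ}
    (hf : AbsolutelyContinuousOnInterval f a b) (h : EqOn g f (uIcc a b)) :
    AbsolutelyContinuousOnInterval g a b := by
  rw [absolutelyContinuousOnInterval_iff] at hf ⊢
  intro ε hε
  obtain ⟨δ, hδ, hf⟩ := hf ε hε
  refine ⟨δ, hδ, fun E hE hlt => (Finset.sum_congr rfl fun i hi => ?_).trans_lt (hf E hE hlt)⟩
  have := hE.1 i hi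
  rw [h this.1, h this.2]

theorem absolutelyContinuousOnInterval_intervalIntegral_complex {g : ℝ → ℂ} {a b : ℝ}
    (hg : IntervalIntegrable g volume a b) :
    AbsolutelyContinuousOnInterval (fun x => ∫ t in a..x, g t) a b := by
  have hre : IntervalIntegrable (fun x => (g x).re) volume a b := ⟨hg.1.re, hg.2.re⟩
  have him : IntervalIntegrable (fun x => (g x).im) volume a b := ⟨hg.1.im, hg.2.im⟩
  have h1 := (hre.absolutelyContinuousOnInterval_intervalIntegral left_mem_uIcc).ofReal
  have h2 := (him.absolutelyContinuousOnInterval_intervalIntegral left_mem_uIcc).ofReal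
  have h3 := h1.add (h2.const_smul Complex.I)
  have key : EqOn (fun x => ∫ t in a..x, g t)
      ((fun x => ((∫ t in a..x, (g t).re : ℝ) : ℂ))
        + fun x => Complex.I • ((∫ t in a..x, (g t).im : ℝ) : ℂ)) (uIcc a b) := by
    intro x hx
    have hsub : IntervalIntegrable g volume a x :=
      hg.mono_set (uIcc_subset_uIcc left_mem_uIcc hx)
    have hre' : IntervalIntegrable (fun x => (g x).re) volume a x := ⟨hsub.1.re, hsub.2.re⟩
    have him' : IntervalIntegrable (fun x => (g x).im) volume a x := ⟨hsub.1.im, hsub.2.im⟩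
    simp only [Pi.add_apply, smul_eq_mul]
    rw [← intervalIntegral.integral_ofReal, ← intervalIntegral.integral_ofReal,
      ← intervalIntegral.integral_const_mul, ← intervalIntegral.integral_add]
    · refine intervalIntegral.integral_congr fun t _ => ?_
      rw [mul_comm, Complex.re_add_im]
    · exact ⟨hre'.1.ofReal, hre'.2.ofReal⟩
    · exact IntervalIntegrable.const_mul ⟨him'.1.ofReal, him'.2.ofReal⟩ _
  exact h3.congr key

/-- Subtracting the primitive of `f'` leaves an absolutely continuous function with derivative zero
almost everywhere, that is, a constant. -/
theorem AbsolutelyContinuousOnInterval.integral_eq_sub_of_ae_hasDerivAt {f f' : ℝ → ℂ} {a b : ℝ}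
    (hf : AbsolutelyContinuousOnInterval f a b)
    (hd : ∀ᵐ x, x ∈ uIcc a b → HasDerivAt f (f' x) x)
    (hi : IntervalIntegrable f' volume a b) :
    ∫ x in a..b, f' x = f b - f a := by
  have hg : AbsolutelyContinuousOnInterval (fun x => f x - ∫ t in a..x, f' t) a b :=
    hf.sub (absolutelyContinuousOnInterval_intervalIntegral_complex hi)
  have h0 : ∀ᵐ x, x ∈ uIcc a b → HasDerivAt (fun x => f x - ∫ t in a..x, f' t) 0 x := by
    filter_upwards [hd, hi.ae_hasDerivAt_integral] with x h1 h2 hx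
    exact ((h1 hx).sub (h2 hx a left_mem_uIcc)).congr_deriv (sub_self _)
  obtain ⟨C, hC⟩ := hg.const_of_ae_hasDerivAt_zero h0
  have h1 := hC a left_mem_uIcc
  have h2 := hC b right_mem_uIcc
  simp only [intervalIntegral.integral_same, sub_zero] at h1
  rw [h1, ← h2]; ring

/-! ### Regularity of functions with square-integrable weak derivatives -/

theorem IsTestFunction.deriv {φ : ℝ → ℂ} (h : IsTestFunction φ) : IsTestFunction (deriv φ) :=
  ⟨(contDiff_infty_iff_deriv.1 h.1).2, h.2.1.deriv, (tsupport_deriv_subset).trans h.2.2⟩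

theorem IsTestFunction.exists_Icc {φ : ℝ → ℂ} (h : IsTestFunction φ) :
    ∃ p q : ℝ, 0 < p ∧ p ≤ q ∧ ∀ x, x ∉ Icc p q → φ x = 0 := by
  obtain ⟨-, hc, hs⟩ := h
  rcases (tsupport φ).eq_empty_or_nonempty with he | hne
  · refine ⟨1, 1, one_pos, le_rfl, fun x _ => ?_⟩
    have : x ∉ tsupport φ := by simp [he]
    exact image_eq_zero_of_notMem_tsupport this
  · obtain ⟨p, hp, hp'⟩ := hc.isCompact.exists_isLeast hne
    obtain ⟨q, hq, hq'⟩ := hc.isCompact.exists_isGreatest hne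
    refine ⟨p, q, hs hp, hp' hq, fun x hx => image_eq_zero_of_notMem_tsupport fun h => hx ?_⟩
    exact ⟨hp' h, hq' h⟩

theorem isTestFunction_of_Icc {φ : ℝ → ℂ} (h : ContDiff ℝ ∞ φ) {p q : ℝ} (hp : 0 < p)
    (hz : ∀ x, x ∉ Icc p q → φ x = 0) : IsTestFunction φ := by
  have hs : tsupport φ ⊆ Icc p q :=
    closure_minimal (fun x hx => by_contra fun hn => hx (hz x hn)) isClosed_Icc
  exact ⟨h, isCompact_Icc.of_isClosed_subset (isClosed_tsupport φ) hs,
    fun x hx => hp.trans_le (hs hx).1⟩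

theorem setIntegral_Ioi_eq_intervalIntegral {f : ℝ → ℂ} {p q : ℝ} (hp : 0 < p) (hpq : p ≤ q)
    (hz : ∀ x, x ∉ Icc p q → f x = 0) : ∫ x in Ioi (0 : ℝ), f x = ∫ x in p..q, f x := by
  rw [intervalIntegral.integral_of_le hpq, ← integral_Icc_eq_integral_Ioc]
  refine setIntegral_eq_of_subset_of_forall_sdiff_eq_zero measurableSet_Ioi
    (fun x hx => hp.trans_le hx.1) fun x hx => hz x hx.2

theorem MemL2Loc.intervalIntegrable {f : ℝ → ℂ} (h : MemL2Loc f) {a b : ℝ} (ha : 0 ≤ a)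
    (hb : 0 ≤ b) : IntervalIntegrable f volume a b := by
  have key : ∀ c : ℝ, 0 ≤ c → IntervalIntegrable f volume 0 c := fun c hc => by
    rw [intervalIntegrable_iff_integrableOn_Ioo_of_le hc]
    exact (h c).integrable (by norm_num)
  exact (key a ha).symm.trans (key b hb)

theorem MemL2Loc.locallyIntegrableOn {f : ℝ → ℂ} (h : MemL2Loc f) :
    LocallyIntegrableOn f (Ioi 0) := by
  intro x hx
  refine ⟨Ioo 0 (x + 1), ?_, (h (x + 1)).integrable (by norm_num)⟩
  exact mem_nhdsWithin_of_mem_nhds (Ioo_mem_nhds hx (by linarith))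

theorem exists_primitive_isTestFunction {χ : ℝ → ℝ} (hχ : ContDiff ℝ ∞ χ) {p q : ℝ} (hp : 0 < p)
    (hz : ∀ x, x ∉ Icc p q → χ x = 0) (hi : ∫ x in p..q, χ x = 0) :
    ∃ φ : ℝ → ℂ, IsTestFunction φ ∧ ∀ x, deriv φ x = χ x := by
  have hd : ∀ x, HasDerivAt (fun y => ∫ t in p..y, χ t) (χ x) x := fun x =>
    intervalIntegral.integral_hasDerivAt_right (hχ.continuous.intervalIntegrable _ _)
      hχ.continuous.stronglyMeasurable.stronglyMeasurableAtFilter hχ.continuous.continuousAt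
  have hs : ContDiff ℝ ∞ (fun y => ∫ t in p..y, χ t) := by
    rw [contDiff_infty_iff_deriv]
    refine ⟨fun x => (hd x).differentiableAt, ?_⟩
    rwa [show _root_.deriv (fun y => ∫ t in p..y, χ t) = χ from funext fun x => (hd x).deriv]
  refine ⟨fun x => ((∫ t in p..x, χ t : ℝ) : ℂ), ?_, fun x => (hd x).ofReal_comp.deriv⟩
  refine isTestFunction_of_Icc (Complex.ofRealCLM.contDiff.comp hs) hp (q := q) fun x hx => ?_
  rw [Complex.ofReal_eq_zero]
  rcases lt_or_ge x p with h | h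
  · rw [intervalIntegral.integral_symm, intervalIntegral.integral_of_le h.le,
      integral_Ioc_eq_integral_Ioo]
    rw [setIntegral_eq_zero_of_forall_eq_zero, neg_zero]
    exact fun t ht => hz t fun h' => by linarith [ht.2, h'.1]
  · have hq : q < x := by
      by_contra hq
      exact hx ⟨h, not_lt.1 hq⟩
    rw [← intervalIntegral.integral_add_adjacent_intervals
      (hχ.continuous.intervalIntegrable p q) (hχ.continuous.intervalIntegrable q x), hi, zero_add,
      intervalIntegral.integral_of_le hq.le]
    exact setIntegral_eq_zero_of_forall_eq_zero fun t ht => hz t fun h' => by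
      linarith [ht.1, h'.2]

/-- Du Bois-Reymond's lemma. After subtracting from a test function its integral times a fixed bump
of integral one, the result is the derivative of a test function. So `G` minus its mean against the
bump annihilates every test function. -/
theorem ae_eq_const_of_forall_integral_mul_deriv_eq_zero {G : ℝ → ℂ}
    (hG : LocallyIntegrableOn G (Ioi 0))
    (h : ∀ φ : ℝ → ℂ, IsTestFunction φ → ∫ x in Ioi (0 : ℝ), G x * deriv φ x = 0) :
    ∃ c : ℂ, ∀ᵐ x : ℝ, 0 < x → G x = c := by
  let ρ : ContDiffBump (2 : ℝ) := ⟨1 / 2, 1, by norm_num, by norm_num⟩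
  set r : ℝ → ℝ := ρ.normed volume with hr
  have hr_smooth : ContDiff ℝ ∞ r := ρ.contDiff_normed
  have hr_int : ∫ x, r x = 1 := ρ.integral_normed
  have hr_zero : ∀ x, x ∉ Icc (1 : ℝ) 3 → r x = 0 := fun x hx => by
    have hts := ρ.support_normed_eq (μ := (volume : Measure ℝ))
    by_contra hne
    have : x ∈ Function.support (ρ.normed volume) := hne
    rw [hts, Real.ball_eq_Ioo] at this
    have h1 : ρ.rOut = 1 := rfl
    rw [h1] at this
    exact hx ⟨by linarith [this.1], by linarith [this.2]⟩
  have hint : ∀ g : ℝ → ℝ, Continuous g → HasCompactSupport g → tsupport g ⊆ Ioi 0 →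
      IntegrableOn (fun x => G x * (g x : ℂ)) (Ioi 0) := by
    intro g hg hgc hgs
    have h1 : IntegrableOn G (tsupport g) :=
      hG.integrableOn_compact_subset hgs hgc.isCompact
    have h2 : IntegrableOn (fun x => G x * (g x : ℂ)) (tsupport g) :=
      h1.mul_continuousOn (Complex.continuous_ofReal.comp hg).continuousOn hgc.isCompact
    refine (integrableOn_iff_integrable_of_support_subset ?_).1 h2 |>.integrableOn
    intro x hx
    refine subset_tsupport g ?_
    intro h0
    exact hx (by simp [h0])
  have hrc : HasCompactSupport r := ρ.hasCompactSupport_normed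
  have hrs : tsupport r ⊆ Ioi 0 := by
    have : tsupport r ⊆ Icc 1 3 :=
      closure_minimal (fun x hx => by_contra fun hn => hx (hr_zero x hn)) isClosed_Icc
    exact fun x hx => lt_of_lt_of_le one_pos (this hx).1
  set c : ℂ := ∫ x in Ioi (0 : ℝ), G x * (r x : ℂ) with hc
  refine ⟨c, ?_⟩
  have hfin : ∀ᵐ x : ℝ, x ∈ Ioi (0 : ℝ) → G x - c = 0 := by
    refine isOpen_Ioi.ae_eq_zero_of_integral_contDiff_smul_eq_zero
      (hG.sub ((locallyIntegrable_const c).locallyIntegrableOn _)) ?_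
    intro g hg hgc hgs
    set m : ℝ := ∫ x, g x with hm
    -- the function `g - m r` is the derivative of a test function
    have hgt : IsTestFunction (fun x => (g x : ℂ)) :=
      ⟨Complex.ofRealCLM.contDiff.comp hg, hgc.comp_left (g := ((↑) : ℝ → ℂ)) (by simp),
        (closure_mono (fun x hx => by simpa using hx)).trans hgs⟩
    obtain ⟨p, q, hp, hpq, hz⟩ := hgt.exists_Icc
    have hz' : ∀ x, x ∉ Icc (min p 1) (max q 3) → g x - m * r x = 0 := by
      intro x hx
      have h1 : x ∉ Icc p q := fun h' => hx
        ⟨(min_le_left _ _).trans h'.1, h'.2.trans (le_max_left _ _)⟩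
      have h2 : x ∉ Icc (1 : ℝ) 3 := fun h' => hx
        ⟨(min_le_right _ _).trans h'.1, h'.2.trans (le_max_right _ _)⟩
      have h3 := hz x h1
      simp only [Complex.ofReal_eq_zero] at h3
      rw [h3, hr_zero x h2]; simp
    have hpq' : min p 1 ≤ max q 3 := (min_le_left _ _).trans (hpq.trans (le_max_left _ _))
    have hgi : Integrable g := hg.continuous.integrable_of_hasCompactSupport hgc
    have hri : Integrable r := hr_smooth.continuous.integrable_of_hasCompactSupport hrc
    have hi0 : ∫ x in (min p 1)..(max q 3), (g x - m * r x) = 0 := by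
      rw [intervalIntegral.integral_of_le hpq', ← integral_Icc_eq_integral_Ioc,
        setIntegral_eq_integral_of_forall_compl_eq_zero hz',
        integral_sub hgi (hri.const_mul m), integral_const_mul, hr_int]
      simp [hm]
    obtain ⟨φ, hφ, hφ'⟩ := exists_primitive_isTestFunction
      (hg.sub (contDiff_const.mul hr_smooth)) (lt_min hp one_pos) hz' hi0
    have h1 := h φ hφ
    have h2 : ∫ x in Ioi (0 : ℝ), G x * deriv φ x
        = (∫ x in Ioi (0 : ℝ), G x * (g x : ℂ)) - m * c := by
      rw [hc, ← integral_const_mul, ← integral_sub (hint g hg.continuous hgc hgs)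
        ((hint r hr_smooth.continuous hrc hrs).const_mul _)]
      refine integral_congr_ae (Eventually.of_forall fun x => ?_)
      simp only [hφ']
      push_cast
      ring
    have h3 : ∫ x, g x • (G x - c) = (∫ x in Ioi (0 : ℝ), G x * (g x : ℂ)) - m * c := by
      have e1 : ∫ x, g x • (G x - c) = ∫ x in Ioi (0 : ℝ), g x • (G x - c) := by
        symm
        refine setIntegral_eq_integral_of_forall_compl_eq_zero fun x hx => ?_
        have : g x = 0 := image_eq_zero_of_notMem_tsupport fun h' => hx (hgs h')
        simp [this]
      have e2 : (m : ℂ) = ∫ x in Ioi (0 : ℝ), (g x : ℂ) := by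
        rw [hm, ← integral_complex_ofReal]
        symm
        refine setIntegral_eq_integral_of_forall_compl_eq_zero fun x hx => ?_
        have : g x = 0 := image_eq_zero_of_notMem_tsupport fun h' => hx (hgs h')
        simp [this]
      have i2 : IntegrableOn (fun x => (g x : ℂ) * c) (Ioi 0) :=
        hgi.ofReal.integrableOn.mul_const c
      rw [e1, e2, ← integral_mul_const, ← integral_sub (hint g hg.continuous hgc hgs) i2]
      refine integral_congr_ae (Eventually.of_forall fun x => ?_)
      simp only [Complex.real_smul]
      ring
    rw [h3, ← h2, h1]
  filter_upwards [hfin] with x hx h0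
  exact sub_eq_zero.1 (hx h0)

theorem integral_primitive_mul_deriv {g : ℝ → ℂ} (hg : MemL2Loc g) {φ : ℝ → ℂ}
    (hφ : IsTestFunction φ) :
    ∫ x in Ioi (0 : ℝ), (∫ t in (0 : ℝ)..x, g t) * deriv φ x
      = - ∫ x in Ioi (0 : ℝ), g x * φ x := by
  obtain ⟨p, q, hp, hpq, hz⟩ := hφ.exists_Icc
  have hp2 : 0 < p / 2 := by linarith
  have hq : 0 ≤ q + 1 := by linarith
  have hle : p / 2 ≤ q + 1 := by linarith
  have hz' : ∀ x, x ∉ Icc (p / 2) (q + 1) → φ x = 0 ∧ deriv φ x = 0 := by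
    intro x hx
    have hx' : x ∉ Icc p q := fun h => hx ⟨by linarith [h.1], by linarith [h.2]⟩
    refine ⟨hz x hx', ?_⟩
    have : φ =ᶠ[𝓝 x] fun _ => 0 := by
      filter_upwards [isClosed_Icc.isOpen_compl.mem_nhds hx'] with y hy using hz y hy
    rw [this.deriv_eq]; simp
  rw [setIntegral_Ioi_eq_intervalIntegral hp2 hle fun x hx => by simp [(hz' x hx).2],
    setIntegral_Ioi_eq_intervalIntegral hp2 hle fun x hx => by simp [(hz' x hx).1]]
  have hi0 := hg.intervalIntegrable le_rfl hq
  have hsub : uIcc (p / 2) (q + 1) ⊆ uIcc 0 (q + 1) := by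
    rw [uIcc_of_le hle, uIcc_of_le hq]; exact Icc_subset_Icc hp2.le le_rfl
  have hH := (absolutelyContinuousOnInterval_intervalIntegral_complex hi0).mono hsub
  have hφ1 : ContDiff ℝ 1 φ := hφ.1.of_le (by exact_mod_cast le_top)
  have hφd : Continuous (deriv φ) := hφ.deriv.1.continuous
  have hφa : AbsolutelyContinuousOnInterval φ (p / 2) (q + 1) :=
    hφ1.contDiffOn.absolutelyContinuousOnInterval
  have hgi := hg.intervalIntegrable hp2.le hq
  have i1 : IntervalIntegrable (fun x => g x * φ x) volume (p / 2) (q + 1) :=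
    hgi.mul_continuousOn hφ1.continuous.continuousOn
  have i2 : IntervalIntegrable (fun x => (∫ t in (0 : ℝ)..x, g t) * deriv φ x) volume
      (p / 2) (q + 1) := (hH.continuousOn.mul hφd.continuousOn).intervalIntegrable
  have key := (hH.smul hφa).integral_eq_sub_of_ae_hasDerivAt
    (f' := fun x => g x * φ x + (∫ t in (0 : ℝ)..x, g t) * deriv φ x) ?_ (i1.add i2)
  · rw [intervalIntegral.integral_add i1 i2] at key
    have e1 : φ (q + 1) = 0 := hz _ fun h => by linarith [h.2]
    have e2 : φ (p / 2) = 0 := hz _ fun h => by linarith [h.1]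
    simp only [Pi.smul_apply', e1, e2, smul_zero, sub_zero] at key
    linear_combination key
  · filter_upwards [hi0.ae_hasDerivAt_integral] with x hx hxm
    exact (hx (hsub hxm) 0 left_mem_uIcc).mul
      ((hφ1.differentiable (by norm_num)) x).hasDerivAt

theorem IsWeakDeriv.exists_ae_eq_primitive {f g : ℝ → ℂ} (hf : MemL2Loc f) (hg : MemL2Loc g)
    (h : IsWeakDeriv 1 f g) :
    ∃ c : ℂ, ∀ᵐ x : ℝ, 0 < x → f x = c + ∫ t in (0 : ℝ)..x, g t := by
  have hH : ContinuousOn (fun x => ∫ t in (0 : ℝ)..x, g t) (Ioi 0) := by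
    intro x hx
    have hx' : (0 : ℝ) < x := hx
    have h1 := (absolutelyContinuousOnInterval_intervalIntegral_complex
      (hg.intervalIntegrable le_rfl (b := x + 1) (by linarith))).continuousOn
    rw [uIcc_of_le (by linarith)] at h1
    exact ((h1 x ⟨hx'.le, by linarith⟩).continuousAt
      (Icc_mem_nhds hx' (by linarith))).continuousWithinAt
  have hHi : LocallyIntegrableOn (fun x => ∫ t in (0 : ℝ)..x, g t) (Ioi 0) :=
    hH.locallyIntegrableOn measurableSet_Ioi
  have key : ∀ φ : ℝ → ℂ, IsTestFunction φ →
      ∫ x in Ioi (0 : ℝ), (f - fun x => ∫ t in (0 : ℝ)..x, g t) x * deriv φ x = 0 := by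
    intro φ hφ
    have h1 := h φ hφ
    have h2 := integral_primitive_mul_deriv hg hφ
    obtain ⟨p, q, hp, hpq, hz⟩ := hφ.deriv.exists_Icc
    have hcont : Continuous (deriv φ) := hφ.deriv.1.continuous
    have hint : ∀ F : ℝ → ℂ, LocallyIntegrableOn F (Ioi 0) →
        IntegrableOn (fun x => F x * deriv φ x) (Ioi 0) := by
      intro F hF
      have h1 : IntegrableOn F (Icc p q) :=
        hF.integrableOn_compact_subset (fun x hx => hp.trans_le hx.1) isCompact_Icc
      have h2 := h1.mul_continuousOn hcont.continuousOn isCompact_Icc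
      refine ((integrableOn_iff_integrable_of_support_subset ?_).1 h2).integrableOn
      exact fun x hx => by_contra fun hn => hx (by simp [hz x hn])
    simp only [iteratedDeriv_one, pow_one] at h1
    have : ∫ x in Ioi (0 : ℝ), (f - fun x => ∫ t in (0 : ℝ)..x, g t) x * deriv φ x
        = (∫ x in Ioi (0 : ℝ), f x * deriv φ x)
          - ∫ x in Ioi (0 : ℝ), (∫ t in (0 : ℝ)..x, g t) * deriv φ x := by
      rw [← integral_sub (hint f hf.locallyIntegrableOn) (hint _ hHi)]
      refine integral_congr_ae (Eventually.of_forall fun x => ?_)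
      simp only [Pi.sub_apply]; ring
    rw [this, h1, h2]; ring
  obtain ⟨c, hc⟩ := ae_eq_const_of_forall_integral_mul_deriv_eq_zero
    (hf.locallyIntegrableOn.sub hHi) key
  refine ⟨c, ?_⟩
  filter_upwards [hc] with x hx h0
  rw [← hx h0]
  simp

/-- The definition of `IsWeakDeriv n` is applied to the test function `φ'`. This reduces the
regularity question to consecutive pairs of weak derivatives. -/
theorem IsWeakDeriv.succ {n : ℕ} {f g g' : ℝ → ℂ} (h : IsWeakDeriv n f g)
    (h' : IsWeakDeriv (n + 1) f g') : IsWeakDeriv 1 g g' := by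
  intro φ hφ
  have h1 := h _ hφ.deriv
  have h2 := h' φ hφ
  rw [iteratedDeriv_succ'] at h2
  rw [h2] at h1
  rw [iteratedDeriv_one]
  have e : ((-1 : ℂ) ^ n) * (-1) ^ n = 1 := by rw [← mul_pow]; simp
  rw [pow_succ] at h1
  linear_combination (-(-1 : ℂ) ^ n) * h1 + (-(∫ x in Ioi (0 : ℝ), g x * deriv φ x)
    - ∫ x in Ioi (0 : ℝ), g' x * φ x) * e

/-- Each weak derivative agrees almost everywhere with a constant plus the primitive `W n` of the
next one. Continuity of `V` upgrades this to equality everywhere for `n = 0`, and classical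
differentiation of the `W n` propagates it to order `M`. The last order is Lebesgue differentiation.
-/
theorem MemSobolevLoc.regularity {M : ℕ} {V : ℝ → ℂ} (hV : MemSobolevLoc (M + 1) V)
    (hc : ContinuousOn V (Ici 0)) :
    (∀ i < M, ∀ x > 0, HasDerivAt (iteratedDeriv i V) (iteratedDeriv (i + 1) V x) x) ∧
    (∀ᵐ x : ℝ, 0 < x → HasDerivAt (iteratedDeriv M V) (iteratedDeriv (M + 1) V x) x) ∧
    (∀ a b : ℝ, 0 < a → a ≤ b → AbsolutelyContinuousOnInterval (iteratedDeriv M V) a b) := by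
  obtain ⟨h0, hn⟩ := hV
  choose! g0 hg0 hw0 using hn
  set g : ℕ → ℝ → ℂ := fun n => if n = 0 then V else g0 n with hgdef
  have hg : ∀ n ≤ M + 1, MemL2Loc (g n) := by
    intro n hn
    rcases Nat.eq_zero_or_pos n with rfl | hpos
    · simpa [hgdef] using h0
    · simpa [hgdef, hpos.ne'] using hg0 n (Finset.mem_Icc.2 ⟨hpos, hn⟩)
  have hw : ∀ n ≤ M + 1, IsWeakDeriv n V (g n) := by
    intro n hn
    rcases Nat.eq_zero_or_pos n with rfl | hpos
    · intro φ hφ; simp [hgdef]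
    · simpa [hgdef, hpos.ne'] using hw0 n (Finset.mem_Icc.2 ⟨hpos, hn⟩)
  have hprim : ∀ n ≤ M, ∃ c : ℂ, ∀ᵐ x : ℝ, 0 < x →
      g n x = c + ∫ t in (0 : ℝ)..x, g (n + 1) t := fun n hn =>
    ((hw n (by omega)).succ (hw (n + 1) (by omega))).exists_ae_eq_primitive
      (hg n (by omega)) (hg (n + 1) (by omega))
  choose! c hcn using hprim
  set W : ℕ → ℝ → ℂ := fun n x => c n + ∫ t in (0 : ℝ)..x, g (n + 1) t with hWdef
  have hWac : ∀ n ≤ M, ∀ b : ℝ, 0 ≤ b → AbsolutelyContinuousOnInterval (W n) 0 b :=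
    fun n hn b hb => (SymbolRing.absolutelyContinuousOnInterval_const (c n) 0 b).add
      (absolutelyContinuousOnInterval_intervalIntegral_complex
        ((hg (n + 1) (by omega)).intervalIntegrable le_rfl hb))
  have hWcont : ∀ n ≤ M, ∀ x > 0, ContinuousAt (W n) x := by
    intro n hn x hx
    have h1 := (hWac n hn (x + 1) (by linarith)).continuousOn
    rw [uIcc_of_le (by linarith)] at h1
    exact (h1 x ⟨hx.le, by linarith⟩).continuousAt (Icc_mem_nhds hx (by linarith))
  have hWderiv : ∀ n < M, ∀ x > 0, HasDerivAt (W n) (W (n + 1) x) x := by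
    intro n hn x hx
    have e : ∀ y > 0, W n y = c n + ∫ t in (0 : ℝ)..y, W (n + 1) t := by
      intro y hy
      simp only [hWdef, add_right_inj]
      refine intervalIntegral.integral_congr_ae ?_
      filter_upwards [hcn (n + 1) (by omega)] with t ht htm
      rw [uIoc_of_le hy.le] at htm
      exact ht htm.1
    have hmeas : ContinuousOn (W (n + 1)) (Ioi 0) :=
      fun y hy => (hWcont (n + 1) (by omega) y hy).continuousWithinAt
    have h1 : HasDerivAt (fun y => c n + ∫ t in (0 : ℝ)..y, W (n + 1) t) (W (n + 1) x) x := by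
      refine HasDerivAt.const_add _ (intervalIntegral.integral_hasDerivAt_right ?_ ?_ ?_)
      · exact (hWac (n + 1) (by omega) x hx.le).continuousOn.intervalIntegrable
      · exact hmeas.stronglyMeasurableAtFilter isOpen_Ioi x hx
      · exact hWcont (n + 1) (by omega) x hx
    refine h1.congr_of_eventuallyEq ?_
    filter_upwards [lt_mem_nhds hx] with y hy using e y hy
  have hVW : ∀ x > 0, V x = W 0 x := by
    have hae : V =ᵐ[volume.restrict (Ioi 0)] W 0 := by
      rw [EventuallyEq, ae_restrict_iff' measurableSet_Ioi]
      filter_upwards [hcn 0 (Nat.zero_le _)] with x hx h0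
      exact hx h0
    exact Measure.eqOn_open_of_ae_eq hae isOpen_Ioi (hc.mono Ioi_subset_Ici_self)
      fun y hy => (hWcont 0 (Nat.zero_le _) y hy).continuousWithinAt
  have hit : ∀ n ≤ M, ∀ x > 0, iteratedDeriv n V x = W n x := by
    intro n
    induction n with
    | zero => intro _ x hx; rw [iteratedDeriv_zero]; exact hVW x hx
    | succ n ih =>
      intro hn x hx
      rw [iteratedDeriv_succ]
      have : iteratedDeriv n V =ᶠ[𝓝 x] W n := by
        filter_upwards [lt_mem_nhds hx] with y hy using ih (by omega) y hy
      rw [this.deriv_eq]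
      exact (hWderiv n (by omega) x hx).deriv
  have hev : ∀ n ≤ M, ∀ x > 0, iteratedDeriv n V =ᶠ[𝓝 x] W n := fun n hn x hx => by
    filter_upwards [lt_mem_nhds hx] with y hy using hit n hn y hy
  refine ⟨fun i hi x hx => ?_, ?_, fun a b ha hab => ?_⟩
  · rw [hit (i + 1) (by omega) x hx]
    exact (hWderiv i hi x hx).congr_of_eventuallyEq (hev i hi.le x hx)
  · have hR : ∀ k : ℕ, ∀ᵐ x : ℝ, x ∈ uIcc (0 : ℝ) k →
        HasDerivAt (fun y => ∫ t in (0 : ℝ)..y, g (M + 1) t) (g (M + 1) x) x := fun k => by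
      filter_upwards [((hg (M + 1) le_rfl).intervalIntegrable le_rfl
        (Nat.cast_nonneg k)).ae_hasDerivAt_integral] with x hx hxm
      exact hx hxm 0 left_mem_uIcc
    filter_upwards [ae_all_iff.2 hR] with x hx h0
    obtain ⟨k, hk⟩ := exists_nat_ge x
    have h1 : HasDerivAt (W M) (g (M + 1) x) x :=
      (hx k (by rw [uIcc_of_le (h0.le.trans hk)]; exact ⟨h0.le, hk⟩)).const_add _
    have h2 := h1.congr_of_eventuallyEq (hev M le_rfl x h0)
    rw [iteratedDeriv_succ, h2.deriv]
    exact h2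
  · have h1 := (hWac M le_rfl b (by linarith)).mono (c := a) (d := b) (by
      rw [uIcc_of_le hab, uIcc_of_le (by linarith)]; exact Icc_subset_Icc ha.le le_rfl)
    exact h1.congr fun x hx => hit M le_rfl x (by rw [uIcc_of_le hab] at hx; exact ha.trans_le hx.1)

/-! ### Weak fourth derivatives of compactly supported functions -/

theorem absolutelyContinuousOnInterval_of_hasDerivAt {f f' : ℝ → ℂ} {a b : ℝ} (hab : a ≤ b)
    (hd : ∀ x ∈ Icc a b, HasDerivAt f (f' x) x) (hc : ContinuousOn f' (Icc a b)) :
    AbsolutelyContinuousOnInterval f a b := by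
  rw [← uIcc_of_le hab] at hd hc
  refine ((SymbolRing.absolutelyContinuousOnInterval_const (f a) a b).add
    (absolutelyContinuousOnInterval_intervalIntegral_complex hc.intervalIntegrable)).congr ?_
  intro x hx
  have hsub : uIcc a x ⊆ uIcc a b := uIcc_subset_uIcc left_mem_uIcc hx
  simp only [Pi.add_apply]
  rw [intervalIntegral.integral_eq_sub_of_hasDerivAt (fun y hy => hd y (hsub hy))
    (hc.mono hsub).intervalIntegrable]
  ring

theorem integral_mul_deriv_eq_neg_of_ae_hasDerivAt {f f' g : ℝ → ℂ} {a b : ℝ}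
    (hf : AbsolutelyContinuousOnInterval f a b)
    (hd : ∀ᵐ x, x ∈ uIcc a b → HasDerivAt f (f' x) x)
    (hi : IntervalIntegrable f' volume a b) (ha : f a = 0) (hb : f b = 0)
    (hg : ContDiff ℝ 1 g) :
    ∫ x in a..b, f x * deriv g x = - ∫ x in a..b, f' x * g x := by
  have i1 : IntervalIntegrable (fun x => f' x * g x) volume a b :=
    hi.mul_continuousOn hg.continuous.continuousOn
  have i2 : IntervalIntegrable (fun x => f x * deriv g x) volume a b :=
    (hf.continuousOn.mul (hg.continuous_deriv le_rfl).continuousOn).intervalIntegrable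
  have key := (hf.smul hg.contDiffOn.absolutelyContinuousOnInterval).integral_eq_sub_of_ae_hasDerivAt
    (f' := fun x => f' x * g x + f x * deriv g x) ?_ (i1.add i2)
  · rw [intervalIntegral.integral_add i1 i2] at key
    simp only [Pi.smul_apply', ha, hb, smul_eq_mul, zero_mul, sub_zero] at key
    linear_combination key
  · filter_upwards [hd] with x hx hxm
    exact (hx hxm).mul ((hg.differentiable (by norm_num)) x).hasDerivAt

theorem contDiff_infty_iteratedDeriv {F : Type*} [NormedAddCommGroup F] [NormedSpace ℝ F]
    {f : ℝ → F} (h : ContDiff ℝ ∞ f) (n : ℕ) : ContDiff ℝ ∞ (iteratedDeriv n f) := by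
  induction n with
  | zero => simpa using h
  | succ n ih => rw [iteratedDeriv_succ]; exact (contDiff_infty_iff_deriv.1 ih).2

/-- Four integrations by parts without boundary terms. The first three are classical; the last moves
a derivative onto a function that is only absolutely continuous. -/
theorem setIntegral_mul_iteratedDeriv_four {f : ℕ → ℝ → ℂ} {p q : ℝ} (hp : 0 < p) (hpq : p ≤ q)
    (hz : ∀ i, ∀ x ∉ Ioo p q, f i x = 0)
    (hd : ∀ i < 3, ∀ x, HasDerivAt (f i) (f (i + 1) x) x)
    (hac : AbsolutelyContinuousOnInterval (f 3) p q)
    (hd3 : ∀ᵐ x, HasDerivAt (f 3) (f 4 x) x)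
    (hi : IntervalIntegrable (f 4) volume p q) {φ : ℝ → ℂ} (hφ : IsTestFunction φ) :
    ∫ x in Ioi (0 : ℝ), f 0 x * iteratedDeriv 4 φ x = ∫ x in Ioi (0 : ℝ), f 4 x * φ x := by
  have hz' : ∀ i, ∀ x ∉ Icc p q, f i x = 0 := fun i x hx =>
    hz i x fun h => hx (Ioo_subset_Icc_self h)
  rw [setIntegral_Ioi_eq_intervalIntegral hp hpq fun x hx => by simp [hz' 0 x hx],
    setIntegral_Ioi_eq_intervalIntegral hp hpq fun x hx => by simp [hz' 4 x hx]]
  have hcont : ∀ i < 4, ContinuousOn (f i) (Icc p q) := by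
    intro i hi4
    rcases Nat.lt_or_ge i 3 with h | h
    · exact fun x _ => (hd i h x).continuousAt.continuousWithinAt
    · obtain rfl : i = 3 := by omega
      simpa [uIcc_of_le hpq] using hac.continuousOn
  have hsm : ∀ n : ℕ, ContDiff ℝ 1 (iteratedDeriv n φ) := fun n =>
    (contDiff_infty_iteratedDeriv hφ.1 n).of_le (by exact_mod_cast le_top)
  have step : ∀ i < 4, ∀ n, ∫ x in p..q, f i x * iteratedDeriv (n + 1) φ x
      = - ∫ x in p..q, f (i + 1) x * iteratedDeriv n φ x := by
    intro i hi4 n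
    rw [iteratedDeriv_succ]
    have hpz : f i p = 0 := hz i p (by simp)
    have hqz : f i q = 0 := hz i q (by simp)
    rcases Nat.lt_or_ge i 3 with h | h
    · refine integral_mul_deriv_eq_neg_of_ae_hasDerivAt
        (absolutelyContinuousOnInterval_of_hasDerivAt hpq (fun x _ => hd i h x)
          (hcont (i + 1) (by omega))) (Eventually.of_forall fun x _ => hd i h x) ?_ hpz hqz (hsm n)
      exact (uIcc_of_le hpq ▸ hcont (i + 1) (by omega)).intervalIntegrable
    · obtain rfl : i = 3 := by omega
      refine integral_mul_deriv_eq_neg_of_ae_hasDerivAt hac ?_ hi hpz hqz (hsm n)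
      filter_upwards [hd3] with x hx _ using hx
  rw [step 0 (by norm_num) 3, step 1 (by norm_num) 2, step 2 (by norm_num) 1,
    step 3 (by norm_num) 0]
  simp

/-! ### Cutting off approximate solutions -/

/-- The cutoff is presented with all its derivatives as a sequence, ready for the Leibniz formula.
Vanishing beyond `3/2`, rather than `2`, leaves room inside the open interval where the WKB function
is defined. -/
theorem exists_cutoff : ∃ (χ : ℕ → ℝ → ℝ) (M : ℝ), 0 < M ∧
    (∀ i y, HasDerivAt (χ i) (χ (i + 1) y) y) ∧ (∀ y, |y| ≤ 1 → χ 0 y = 1) ∧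
    (∀ i y, |y| < 1 → χ (i + 1) y = 0) ∧ (∀ i y, 3 / 2 < |y| → χ i y = 0) ∧
    ∀ i ≤ 4, ∀ y, |χ i y| ≤ M := by
  let ρ : ContDiffBump (0 : ℝ) := ⟨1, 3 / 2, by norm_num, by norm_num⟩
  have hs : ContDiff ℝ ∞ ρ := ρ.contDiff
  have hcd : ∀ i : ℕ, ContDiff ℝ ∞ (iteratedDeriv i ρ) :=
    contDiff_infty_iteratedDeriv hs
  have hout : ∀ i y, 3 / 2 < |y| → iteratedDeriv i ρ y = 0 := by
    intro i
    induction i with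
    | zero =>
      intro y hy
      rw [iteratedDeriv_zero]
      refine ρ.zero_of_le_dist ?_
      simpa [Real.dist_eq] using hy.le
    | succ i ih =>
      intro y hy
      rw [iteratedDeriv_succ]
      have : iteratedDeriv i ρ =ᶠ[𝓝 y] fun _ => 0 := by
        filter_upwards [(isOpen_lt continuous_const continuous_abs).mem_nhds hy] with t ht
          using ih t ht
      rw [this.deriv_eq, deriv_const]
  have hin : ∀ y : ℝ, |y| ≤ 1 → ρ y = 1 := fun y hy =>
    ρ.one_of_mem_closedBall (by simpa [Real.dist_eq] using hy)
  have hbd : ∀ i : ℕ, ∃ M, ∀ y, |iteratedDeriv i ρ y| ≤ M := by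
    intro i
    obtain ⟨M, hM⟩ := (isCompact_Icc (a := (-2 : ℝ)) (b := 2)).exists_bound_of_continuousOn
      (hcd i).continuous.continuousOn
    refine ⟨max M 0, fun y => ?_⟩
    by_cases hy : y ∈ Icc (-2 : ℝ) 2
    · exact (hM y hy).trans (le_max_left _ _)
    · rw [hout i y]
      · simp
      · by_contra h
        have := abs_le.1 (not_lt.1 h)
        exact hy ⟨by linarith [this.1], by linarith [this.2]⟩
  choose M hM using hbd
  have hMn : ∀ i, 0 ≤ M i := fun i => (abs_nonneg _).trans (hM i 0)
  refine ⟨fun i => iteratedDeriv i ρ, 1 + ∑ i ∈ Finset.range 5, M i,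
    add_pos_of_pos_of_nonneg one_pos (Finset.sum_nonneg fun i _ => hMn i), ?_, ?_, ?_, hout, ?_⟩
  · intro i y
    simp only [iteratedDeriv_succ]
    exact ((hcd i).differentiable (by simp) y).hasDerivAt
  · intro y hy
    simpa using hin y hy
  · intro i
    induction i with
    | zero =>
      intro y hy
      have : (ρ : ℝ → ℝ) =ᶠ[𝓝 y] fun _ => 1 := by
        filter_upwards [(isOpen_lt continuous_abs continuous_const).mem_nhds hy] with t ht
          using hin t (le_of_lt ht)
      simp only [zero_add, iteratedDeriv_one]
      rw [this.deriv_eq, deriv_const]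
    | succ i ih =>
      intro y hy
      have : iteratedDeriv (i + 1) ρ =ᶠ[𝓝 y] fun _ => 0 := by
        filter_upwards [(isOpen_lt continuous_abs continuous_const).mem_nhds hy] with t ht
          using ih t ht
      simp only
      rw [iteratedDeriv_succ, this.deriv_eq, deriv_const]
  · intro i hi y
    refine (hM i y).trans ?_
    have := Finset.single_le_sum (f := M) (fun i _ => hMn i)
      (Finset.mem_range.2 (show i < 5 by omega))
    linarith

theorem l2Norm_le_of_ae_le {f g : ℝ → ℂ} {E G p q : ℝ} (hE : 0 ≤ E) (hG : 0 ≤ G) (hpq : p ≤ q)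
    (hg : MemLp g 2 (volume.restrict (Ioi (0 : ℝ))))
    (h : ∀ᵐ x, ‖f x‖ ≤ E * ‖g x‖ + (Ioo p q).indicator (fun _ => G) x) :
    l2Norm f ≤ E * l2Norm g + G * (q - p) ^ (1 / 2 : ℝ) := by
  have h1 : eLpNorm f 2 (volume.restrict (Ioi (0 : ℝ))) ≤
      eLpNorm (fun x => E * ‖g x‖ + (Ioo p q).indicator (fun _ => G) x) 2
        (volume.restrict (Ioi (0 : ℝ))) :=
    eLpNorm_mono_ae_real (ae_restrict_of_ae h)
  have h2 : eLpNorm ((Ioo p q).indicator (fun _ => G)) 2 (volume.restrict (Ioi (0 : ℝ))) ≤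
      ENNReal.ofReal (G * (q - p) ^ (1 / 2 : ℝ)) := by
    refine (eLpNorm_mono_measure _ Measure.restrict_le_self).trans ?_
    rw [eLpNorm_indicator_const measurableSet_Ioo (by norm_num) (by norm_num), Real.volume_Ioo,
      ENNReal.ofReal_mul hG, ENNReal.ofReal_rpow_of_nonneg (by linarith) (by norm_num)]
    simp [Real.enorm_eq_ofReal hG]
  have h3 : eLpNorm (fun x => E * ‖g x‖) 2 (volume.restrict (Ioi (0 : ℝ)))
      = ENNReal.ofReal E * eLpNorm g 2 (volume.restrict (Ioi (0 : ℝ))) := by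
    have := eLpNorm_const_smul E (fun x => ‖g x‖) 2 (volume.restrict (Ioi (0 : ℝ)))
    rw [eLpNorm_norm, Real.enorm_eq_ofReal hE] at this
    exact this
  have h4 : eLpNorm f 2 (volume.restrict (Ioi (0 : ℝ))) ≤
      ENNReal.ofReal E * eLpNorm g 2 (volume.restrict (Ioi (0 : ℝ)))
        + ENNReal.ofReal (G * (q - p) ^ (1 / 2 : ℝ)) := by
    refine h1.trans ((eLpNorm_add_le ?_ ?_ (by norm_num)).trans ?_)
    · exact hg.1.norm.const_mul E
    · exact (measurable_const.indicator measurableSet_Ioo).aestronglyMeasurable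
    · exact add_le_add h3.le h2
  have hfin : ENNReal.ofReal E * eLpNorm g 2 (volume.restrict (Ioi (0 : ℝ))) ≠ ⊤ :=
    ENNReal.mul_ne_top ENNReal.ofReal_ne_top hg.2.ne
  have h5 := ENNReal.toReal_mono (ENNReal.add_ne_top.2 ⟨hfin, ENNReal.ofReal_ne_top⟩) h4
  rw [ENNReal.toReal_add hfin ENNReal.ofReal_ne_top, ENNReal.toReal_mul,
    ENNReal.toReal_ofReal hE, ENNReal.toReal_ofReal
      (mul_nonneg hG (Real.rpow_nonneg (by linarith) _))] at h5
  exact h5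

theorem le_l2Norm_of_le_on_Icc {g : ℝ → ℂ} {e r x₀ : ℝ} (hx₀ : 0 < x₀) (hr : 0 ≤ r) (he : 0 ≤ e)
    (hg : MemLp g 2 (volume.restrict (Ioi (0 : ℝ)))) (h : ∀ x ∈ Icc x₀ (x₀ + r), e ≤ ‖g x‖) :
    e * r ^ (1 / 2 : ℝ) ≤ l2Norm g := by
  have h1 : eLpNorm ((Icc x₀ (x₀ + r)).indicator (fun _ => e)) 2
      (volume.restrict (Ioi (0 : ℝ))) ≤ eLpNorm g 2 (volume.restrict (Ioi (0 : ℝ))) := by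
    refine eLpNorm_mono fun x => ?_
    by_cases hx : x ∈ Icc x₀ (x₀ + r)
    · rw [indicator_of_mem hx, Real.norm_of_nonneg he]
      exact h x hx
    · rw [indicator_of_notMem hx]; simp
  have h2 : eLpNorm ((Icc x₀ (x₀ + r)).indicator (fun _ => e)) 2
      (volume.restrict (Ioi (0 : ℝ))) = ENNReal.ofReal (e * r ^ (1 / 2 : ℝ)) := by
    rw [eLpNorm_indicator_const measurableSet_Icc (by norm_num) (by norm_num),
      Measure.restrict_apply measurableSet_Icc,
      inter_eq_left.2 (show Icc x₀ (x₀ + r) ⊆ Ioi 0 from fun x hx => hx₀.trans_le hx.1), Real.volume_Icc,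
      ENNReal.ofReal_mul he, ← ENNReal.ofReal_rpow_of_nonneg hr (by norm_num)]
    simp [Real.enorm_eq_ofReal he]
  rw [h2] at h1
  exact (ENNReal.ofReal_le_iff_le_toReal hg.2.ne).1 h1

/-- The `j`-th derivative of the product of a cutoff function and `u`, by the Leibniz rule. -/
noncomputable def leibniz (ξ u : ℕ → ℝ → ℂ) : ℕ → ℝ → ℂ
  | 0 => fun x => ξ 0 x * u 0 x
  | 1 => fun x => ξ 1 x * u 0 x + ξ 0 x * u 1 x
  | 2 => fun x => ξ 2 x * u 0 x + 2 * (ξ 1 x * u 1 x) + ξ 0 x * u 2 x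
  | 3 => fun x => ξ 3 x * u 0 x + 3 * (ξ 2 x * u 1 x) + 3 * (ξ 1 x * u 2 x) + ξ 0 x * u 3 x
  | 4 => fun x => ξ 4 x * u 0 x + 4 * (ξ 3 x * u 1 x) + 6 * (ξ 2 x * u 2 x)
      + 4 * (ξ 1 x * u 3 x) + ξ 0 x * u 4 x
  | _ => 0

theorem leibniz_eq_zero {ξ u : ℕ → ℝ → ℂ} {x : ℝ} (h : ∀ i, ξ i x = 0) (j : ℕ) :
    leibniz ξ u j x = 0 := by
  match j with
  | 0 | 1 | 2 | 3 | 4 => simp [leibniz, h]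
  | _ + 5 => simp [leibniz]

theorem hasDerivAt_leibniz {ξ u : ℕ → ℝ → ℂ} {x : ℝ}
    (hξ : ∀ i, HasDerivAt (ξ i) (ξ (i + 1) x) x) {j : ℕ} (hj : j ≤ 3)
    (hu : ∀ i ≤ j, HasDerivAt (u i) (u (i + 1) x) x) :
    HasDerivAt (leibniz ξ u j) (leibniz ξ u (j + 1) x) x := by
  match j with
  | 0 => exact ((hξ 0).mul (hu 0 le_rfl))
  | 1 =>
    refine (((hξ 1).mul (hu 0 (by omega))).add ((hξ 0).mul (hu 1 (by omega)))).congr_deriv ?_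
    simp only [leibniz, Nat.reduceAdd]; ring
  | 2 =>
    refine ((((hξ 2).mul (hu 0 (by omega))).add
      (((hξ 1).mul (hu 1 (by omega))).const_mul 2)).add
      ((hξ 0).mul (hu 2 (by omega)))).congr_deriv ?_
    simp only [leibniz, Nat.reduceAdd]; ring
  | 3 =>
    refine (((((hξ 3).mul (hu 0 (by omega))).add
      (((hξ 2).mul (hu 1 (by omega))).const_mul 3)).add
      (((hξ 1).mul (hu 2 (by omega))).const_mul 3)).add
      ((hξ 0).mul (hu 3 (by omega)))).congr_deriv ?_
    simp only [leibniz, Nat.reduceAdd]; ring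
  | n + 4 => omega

/-- Only terms with a derivative on the cutoff remain, and their binomial coefficients `1, 4, 6, 4`
add up to `15`. -/
theorem norm_leibniz_commutator_le {ξ u : ℕ → ℝ → ℂ} {x A B : ℝ} (hA : 0 ≤ A)
    (hξ : ∀ i ≤ 4, ‖ξ i x‖ ≤ A) (hu : ∀ i ≤ 3, ‖u i x‖ ≤ B) :
    ‖leibniz ξ u 4 x - ξ 0 x * u 4 x‖ ≤ 15 * A * B := by
  have key : ∀ i ≤ 4, ∀ j ≤ 3, ∀ c : ℝ, 0 ≤ c → ‖(c : ℂ) * (ξ i x * u j x)‖ ≤ c * (A * B) := by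
    intro i hi j hj c hc
    rw [norm_mul, norm_mul, Complex.norm_real, Real.norm_of_nonneg hc]
    gcongr
    · exact hξ i hi
    · exact hu j hj
  have e : leibniz ξ u 4 x - ξ 0 x * u 4 x = ((1 : ℝ) : ℂ) * (ξ 4 x * u 0 x)
      + ((4 : ℝ) : ℂ) * (ξ 3 x * u 1 x) + ((6 : ℝ) : ℂ) * (ξ 2 x * u 2 x)
      + ((4 : ℝ) : ℂ) * (ξ 1 x * u 3 x) := by
    simp only [leibniz]; push_cast; ring
  rw [e]
  refine (norm_add_le _ _).trans ?_
  refine (add_le_add_left ((norm_add_le _ _).trans (add_le_add_left (norm_add_le _ _) _)) _).trans ?_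
  have h1 := key 4 le_rfl 0 (by omega) 1 (by norm_num)
  have h2 := key 3 (by omega) 1 (by omega) 4 (by norm_num)
  have h3 := key 2 (by omega) 2 (by omega) 6 (by norm_num)
  have h4 := key 1 (by omega) 3 (by omega) 4 (by norm_num)
  linarith

/-- Cutting off a function which approximately solves `u'''' + V u = l u` on an interval and is
small away from its centre gives a quasimode. -/
theorem exists_cutoff_quasimode : ∃ M : ℝ, 0 < M ∧
    ∀ (V : ℝ → ℂ) (l : ℂ) (x₀ Δ E G e r : ℝ) (u : ℕ → ℝ → ℂ), 0 < Δ → 0 < x₀ - 2 * Δ →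
      0 ≤ E → 0 < e → 0 < r → r ≤ Δ →
      ContinuousOn V (Ioo (x₀ - 2 * Δ) (x₀ + 2 * Δ)) →
      (∀ i < 3, ∀ x ∈ Ioo (x₀ - 2 * Δ) (x₀ + 2 * Δ), HasDerivAt (u i) (u (i + 1) x) x) →
      AbsolutelyContinuousOnInterval (u 3) (x₀ - 7 / 4 * Δ) (x₀ + 7 / 4 * Δ) →
      (∀ᵐ x, x ∈ Ioo (x₀ - 2 * Δ) (x₀ + 2 * Δ) → HasDerivAt (u 3) (u 4 x) x) →
      (∀ᵐ x, x ∈ Ioo (x₀ - 2 * Δ) (x₀ + 2 * Δ) → ‖u 4 x - (l - V x) * u 0 x‖ ≤ E * ‖u 0 x‖) →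
      (∀ i ≤ 3, ∀ x ∈ Ioo (x₀ - 2 * Δ) (x₀ + 2 * Δ), Δ ≤ |x - x₀| → ‖u i x‖ ≤ G) →
      (∀ x ∈ Icc x₀ (x₀ + r), e ≤ ‖u 0 x‖) →
      ∃ Ψ w : ℝ → ℂ, Function.support Ψ ⊆ Ioo (x₀ - 2 * Δ) (x₀ + 2 * Δ) ∧
        tsupport Ψ ⊆ Ioi 0 ∧ 0 < l2Norm Ψ ∧ IsMaximalBiharmonic V Ψ w ∧
        l2Norm (fun x => w x - l * Ψ x) / l2Norm Ψ
          ≤ E + M * ((1 + (Δ ^ 4)⁻¹) * G * (4 * Δ) ^ (1 / 2 : ℝ) / (e * r ^ (1 / 2 : ℝ))) := by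
  obtain ⟨χ, M, hM, hχd, hχ1, hχ0, hχout, hχM⟩ := exists_cutoff
  refine ⟨15 * M, by positivity, ?_⟩
  intro V l x₀ Δ E G e r u hΔ hx₀ hE he hr hrΔ hV hud hac hud3 hres hG hlow
  set J := Ioo (x₀ - 2 * Δ) (x₀ + 2 * Δ) with hJ
  set ξ : ℕ → ℝ → ℂ := fun i x => (((Δ⁻¹) ^ i * χ i ((x - x₀) / Δ) : ℝ) : ℂ) with hξdef
  have hξd : ∀ i x, HasDerivAt (ξ i) (ξ (i + 1) x) x := by
    intro i x
    have h1 : HasDerivAt (fun y : ℝ => (y - x₀) / Δ) (1 / Δ) x :=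
      ((hasDerivAt_id x).sub_const x₀).div_const Δ
    have h2 := ((hχd i ((x - x₀) / Δ)).comp x h1).const_mul ((Δ⁻¹) ^ i)
    refine h2.ofReal_comp.congr_deriv ?_
    simp only [hξdef]
    congr 1
    rw [pow_succ]; ring
  have habs : ∀ x, |(x - x₀) / Δ| = |x - x₀| / Δ := fun x => by rw [abs_div, abs_of_pos hΔ]
  have hξout : ∀ i x, 3 / 2 * Δ < |x - x₀| → ξ i x = 0 := by
    intro i x hx
    simp only [hξdef]
    rw [hχout i _ (by rw [habs, lt_div_iff₀ hΔ]; exact hx)]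
    simp
  have hξ1 : ∀ x, |x - x₀| ≤ Δ → ξ 0 x = 1 := by
    intro x hx
    simp only [hξdef]
    rw [hχ1 _ (by rw [habs, div_le_one hΔ]; exact hx)]
    simp
  have hξ0 : ∀ i x, |x - x₀| < Δ → ξ (i + 1) x = 0 := by
    intro i x hx
    simp only [hξdef]
    rw [hχ0 i _ (by rw [habs, div_lt_one hΔ]; exact hx)]
    simp
  -- Rescaling makes the `i`-th derivative cost `Δ⁻ⁱ`, and `1 + Δ⁻⁴` dominates this for every `i ≤
  -- 4`, whether `Δ` is small or large.
  have hAΔ : 0 ≤ M * (1 + (Δ ^ 4)⁻¹) := by positivity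
  have hξM : ∀ i ≤ 4, ∀ x, ‖ξ i x‖ ≤ M * (1 + (Δ ^ 4)⁻¹) := by
    intro i hi x
    simp only [hξdef]
    rw [Complex.norm_real, Real.norm_eq_abs, abs_mul, abs_of_nonneg (by positivity), mul_comm]
    refine mul_le_mul (hχM i hi _) ?_ (by positivity) hM.le
    rcases le_total 1 (Δ⁻¹) with h | h
    · calc (Δ⁻¹) ^ i ≤ (Δ⁻¹) ^ 4 := pow_le_pow_right₀ h hi
        _ = (Δ ^ 4)⁻¹ := by rw [inv_pow]
        _ ≤ _ := by linarith
    · have h1 : (Δ⁻¹) ^ i ≤ 1 := pow_le_one₀ (by positivity) h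
      have h2 : 0 ≤ (Δ ^ 4)⁻¹ := by positivity
      linarith
  set ψ : ℕ → ℝ → ℂ := leibniz ξ u with hψ
  have hψout : ∀ j x, 3 / 2 * Δ < |x - x₀| → ψ j x = 0 := fun j x hx =>
    leibniz_eq_zero (fun i => hξout i x hx) j
  have hmemJ : ∀ x, |x - x₀| < 2 * Δ ↔ x ∈ J := by
    intro x
    rw [abs_lt, hJ, mem_Ioo]
    constructor <;> rintro ⟨h1, h2⟩ <;> constructor <;> linarith
  have hψoutd : ∀ j x, x ∉ J → HasDerivAt (ψ j) (ψ (j + 1) x) x := by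
    intro j x hx
    have hx' : 3 / 2 * Δ < |x - x₀| := by
      rw [← hmemJ, not_lt] at hx
      linarith
    rw [hψout _ x hx']
    refine (hasDerivAt_const x (0 : ℂ)).congr_of_eventuallyEq ?_
    filter_upwards [(isOpen_lt continuous_const
      (continuous_id.sub continuous_const).abs).mem_nhds hx'] with y hy using hψout j y hy
  have hψd : ∀ j < 3, ∀ x, HasDerivAt (ψ j) (ψ (j + 1) x) x := by
    intro j hj x
    by_cases hx : x ∈ J
    · exact hasDerivAt_leibniz (fun i => hξd i x) (by omega) fun i hi => hud i (by omega) x hx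
    · exact hψoutd j x hx
  have hψd3 : ∀ᵐ x, HasDerivAt (ψ 3) (ψ 4 x) x := by
    filter_upwards [hud3] with x hx3
    by_cases hx : x ∈ J
    · refine hasDerivAt_leibniz (fun i => hξd i x) le_rfl fun i hi => ?_
      rcases Nat.lt_or_ge i 3 with h | h
      · exact hud i h x hx
      · obtain rfl : i = 3 := by omega
        exact hx3 hx
    · exact hψoutd 3 x hx
  -- The ratio `7/4` lies strictly between `3/2`, where the cutoff ends, and `2`, where control of
  -- `u` ends.
  set p := x₀ - 7 / 4 * Δ with hp
  set q := x₀ + 7 / 4 * Δ with hq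
  have hpq : p ≤ q := by linarith
  have hp0 : 0 < p := by linarith
  have hIccJ : Icc p q ⊆ J := fun x hx => ⟨by linarith [hx.1], by linarith [hx.2]⟩
  have hψz : ∀ j, ∀ x ∉ Ioo p q, ψ j x = 0 := by
    intro j x hx
    refine hψout j x ?_
    by_contra h
    have := abs_le.1 (not_lt.1 h)
    exact hx ⟨by linarith [this.1], by linarith [this.2]⟩
  have hξac : ∀ i, AbsolutelyContinuousOnInterval (ξ i) p q := fun i =>
    absolutelyContinuousOnInterval_of_hasDerivAt hpq (fun x _ => hξd i x)
      fun x _ => (hξd (i + 1) x).continuousAt.continuousWithinAt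
  have huc : ∀ i < 3, ContinuousOn (u i) (Icc p q) := fun i hi x hx =>
    (hud i hi x (hIccJ hx)).continuousAt.continuousWithinAt
  have huac : ∀ i ≤ 3, AbsolutelyContinuousOnInterval (u i) p q := by
    intro i hi
    rcases Nat.lt_or_ge i 3 with h | h
    · refine absolutelyContinuousOnInterval_of_hasDerivAt hpq
        (fun x hx => hud i h x (hIccJ hx)) ?_
      rcases Nat.lt_or_ge (i + 1) 3 with h' | h'
      · exact huc _ h'
      · obtain rfl : i = 2 := by omega
        simpa [uIcc_of_le hpq] using hac.continuousOn
    · obtain rfl : i = 3 := by omega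
      exact hac
  have hψac : AbsolutelyContinuousOnInterval (ψ 3) p q := by
    have h1 := (((hξac 3).smul (huac 0 (by omega))).add
      (((hξac 2).smul (huac 1 (by omega))).const_smul (3 : ℂ))).add
      (((hξac 1).smul (huac 2 (by omega))).const_smul (3 : ℂ)) |>.add
      ((hξac 0).smul (huac 3 (by omega)))
    exact h1.congr fun x _ => rfl
  have hψcont : Continuous (ψ 0) := continuous_iff_continuousAt.2 fun x =>
    (hψd 0 (by norm_num) x).continuousAt
  have hVψ : Continuous (fun x => V x * ψ 0 x) := by
    rw [continuous_iff_continuousAt]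
    intro x
    by_cases hx : x ∈ J
    · exact (hV.continuousAt (isOpen_Ioo.mem_nhds hx)).mul hψcont.continuousAt
    · have hx' : 3 / 2 * Δ < |x - x₀| := by
        rw [← hmemJ, not_lt] at hx
        linarith
      refine (continuousAt_const (y := (0 : ℂ))).congr ?_
      filter_upwards [(isOpen_lt continuous_const
        (continuous_id.sub continuous_const).abs).mem_nhds hx'] with y hy
      simp only [hψout 0 y hy, mul_zero]
  have hψ0supp : HasCompactSupport (ψ 0) :=
    HasCompactSupport.intro isCompact_Icc fun x hx => hψz 0 x fun h => hx (Ioo_subset_Icc_self h)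
  have hψL2 : MemLp (ψ 0) 2 (volume.restrict (Ioi (0 : ℝ))) :=
    (hψcont.memLp_of_hasCompactSupport hψ0supp).restrict _
  have hVψsupp : HasCompactSupport (fun x => V x * ψ 0 x) :=
    HasCompactSupport.intro isCompact_Icc fun x hx => by
      rw [hψz 0 x fun h => hx (Ioo_subset_Icc_self h), mul_zero]
  have hVψL2 : MemLp (fun x => V x * ψ 0 x) 2 (volume.restrict (Ioi (0 : ℝ))) :=
    (hVψ.memLp_of_hasCompactSupport hVψsupp).restrict _
  have hψ4m : AEStronglyMeasurable (ψ 4) volume := by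
    refine (stronglyMeasurable_deriv (ψ 3)).aestronglyMeasurable.congr ?_
    filter_upwards [hψd3] with x hx using hx.deriv
  -- the pointwise estimate
  have hcomm : ∀ x, ‖ψ 4 x - ξ 0 x * u 4 x‖ ≤
      J.indicator (fun _ => 15 * (M * (1 + (Δ ^ 4)⁻¹)) * G) x := by
    intro x
    by_cases hx : x ∈ J
    · rw [indicator_of_mem hx]
      rcases lt_or_ge (|x - x₀|) Δ with h | h
      · have hGn : 0 ≤ G := by
          have h1 := hG 0 (by omega) (x₀ + Δ) ⟨by linarith, by linarith⟩
            (by rw [add_sub_cancel_left, abs_of_pos hΔ])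
          exact (norm_nonneg _).trans h1
        have : ψ 4 x - ξ 0 x * u 4 x = 0 := by
          have h1 := hξ0 0 x h
          have h2 := hξ0 1 x h
          have h3 := hξ0 2 x h
          have h4 := hξ0 3 x h
          simp only [zero_add, Nat.reduceAdd] at h1 h2 h3 h4
          simp [hψ, leibniz, h1, h2, h3, h4]
        rw [this, norm_zero]
        positivity
      · exact norm_leibniz_commutator_le hAΔ (fun i hi => hξM i hi x)
          fun i hi => hG i hi x hx h
    · rw [indicator_of_notMem hx]
      have hx' : 3 / 2 * Δ < |x - x₀| := by
        rw [← hmemJ, not_lt] at hx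
        linarith
      rw [hψout 4 x hx', hξout 0 x hx']
      simp
  have hpoint : ∀ᵐ x, ‖(ψ 4 x + V x * ψ 0 x) - l * ψ 0 x‖ ≤ E * ‖ψ 0 x‖
      + J.indicator (fun _ => 15 * (M * (1 + (Δ ^ 4)⁻¹)) * G) x := by
    filter_upwards [hres] with x hx
    have e1 : (ψ 4 x + V x * ψ 0 x) - l * ψ 0 x
        = ξ 0 x * (u 4 x - (l - V x) * u 0 x) + (ψ 4 x - ξ 0 x * u 4 x) := by
      simp only [hψ, leibniz]; ring
    rw [e1]
    refine (norm_add_le _ _).trans (add_le_add ?_ (hcomm x))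
    by_cases hxJ : x ∈ J
    · have : ψ 0 x = ξ 0 x * u 0 x := rfl
      rw [this, norm_mul, norm_mul]
      calc ‖ξ 0 x‖ * ‖u 4 x - (l - V x) * u 0 x‖ ≤ ‖ξ 0 x‖ * (E * ‖u 0 x‖) := by
            gcongr; exact hx hxJ
        _ = _ := by ring
    · have hx' : 3 / 2 * Δ < |x - x₀| := by
        rw [← hmemJ, not_lt] at hxJ
        linarith
      rw [hξout 0 x hx', zero_mul, norm_zero]
      positivity
  have hGn : 0 ≤ G := by
    have h1 := hG 0 (by omega) (x₀ + Δ) ⟨by linarith, by linarith⟩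
      (by rw [add_sub_cancel_left, abs_of_pos hΔ])
    exact (norm_nonneg _).trans h1
  have hJle : x₀ - 2 * Δ ≤ x₀ + 2 * Δ := by linarith
  -- Square integrability of the fourth derivative is not assumed. The residual is dominated
  -- pointwise by an `L²` function; adding `l ψ` and then subtracting `V ψ` recovers `ψ 4`.
  have hdiffL2 : MemLp (fun x => (ψ 4 x + V x * ψ 0 x) - l * ψ 0 x) 2
      (volume.restrict (Ioi (0 : ℝ))) := by
    have hdom : MemLp (fun x => E * ‖ψ 0 x‖
        + J.indicator (fun _ => 15 * (M * (1 + (Δ ^ 4)⁻¹)) * G) x) 2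
        (volume.restrict (Ioi (0 : ℝ))) := by
      refine (hψL2.norm.const_mul E).add (MemLp.restrict _ ?_)
      exact memLp_indicator_const 2 measurableSet_Ioo _ (Or.inr (by simp))
    refine hdom.mono' ?_ (ae_restrict_of_ae hpoint)
    exact ((hψ4m.add hVψ.aestronglyMeasurable).sub
      (continuous_const.mul hψcont).aestronglyMeasurable).restrict
  have hwL2 : MemLp (fun x => ψ 4 x + V x * ψ 0 x) 2 (volume.restrict (Ioi (0 : ℝ))) := by
    have := hdiffL2.add (hψL2.const_mul l)
    refine this.ae_eq (Eventually.of_forall fun x => ?_)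
    simp
  have hψ4L2 : MemLp (ψ 4) 2 (volume.restrict (Ioi (0 : ℝ))) := by
    have := hwL2.sub hVψL2
    refine this.ae_eq (Eventually.of_forall fun x => ?_)
    simp
  have hψ4i : IntervalIntegrable (ψ 4) volume p q := by
    rw [intervalIntegrable_iff_integrableOn_Icc_of_le hpq]
    have h1 : MemLp (ψ 4) 2 (volume.restrict (Icc p q)) :=
      hψ4L2.mono_measure (Measure.restrict_mono (fun x hx => hp0.trans_le hx.1) le_rfl)
    exact h1.integrable (by norm_num)
  -- As `r ≤ Δ`, the cutoff equals one on `[x₀, x₀ + r]`.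
  have hlower : e * r ^ (1 / 2 : ℝ) ≤ l2Norm (ψ 0) := by
    refine le_l2Norm_of_le_on_Icc (x₀ := x₀) (by linarith) hr.le he.le hψL2 fun x hx => ?_
    have : ψ 0 x = ξ 0 x * u 0 x := rfl
    rw [this, hξ1 x (by rw [abs_of_nonneg (by linarith [hx.1])]; linarith [hx.2]), one_mul]
    exact hlow x hx
  have her : 0 < e * r ^ (1 / 2 : ℝ) := by positivity
  have hpos : 0 < l2Norm (ψ 0) := her.trans_le hlower
  refine ⟨ψ 0, fun x => ψ 4 x + V x * ψ 0 x, ?_, ?_, hpos, ⟨hψL2, hwL2, ?_⟩, ?_⟩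
  · intro x hx
    by_contra h
    refine hx (hψz 0 x fun h' => h (hIccJ (Ioo_subset_Icc_self h')))
  · have : tsupport (ψ 0) ⊆ Icc p q := closure_minimal
      (fun x hx => by_contra fun h => hx (hψz 0 x fun h' => h (Ioo_subset_Icc_self h')))
      isClosed_Icc
    exact fun x hx => hp0.trans_le (this hx).1
  · intro φ hφ
    have h4 := setIntegral_mul_iteratedDeriv_four hp0 hpq hψz hψd hψac hψd3 hψ4i hφ
    have hφL2 : ∀ n : ℕ, MemLp (iteratedDeriv n φ) 2 (volume.restrict (Ioi (0 : ℝ))) := fun n => by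
      have hc : HasCompactSupport (iteratedDeriv n φ) := by
        induction n with
        | zero => simpa using hφ.2.1
        | succ n ih => rw [iteratedDeriv_succ]; exact ih.deriv
      exact ((contDiff_infty_iteratedDeriv hφ.1 n).continuous.memLp_of_hasCompactSupport
        hc).restrict _
    have hφ0 : MemLp φ 2 (volume.restrict (Ioi (0 : ℝ))) := by simpa using hφL2 0
    have i1 : Integrable (fun x => ψ 0 x * iteratedDeriv 4 φ x)
      (volume.restrict (Ioi (0 : ℝ))) := hψL2.integrable_mul (hφL2 4)
    have i2 : Integrable (fun x => V x * ψ 0 x * φ x) (volume.restrict (Ioi (0 : ℝ))) :=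
      hVψL2.integrable_mul hφ0
    have i3 : Integrable (fun x => ψ 4 x * φ x) (volume.restrict (Ioi (0 : ℝ))) :=
      hψ4L2.integrable_mul hφ0
    rw [integral_add i1 i2, h4, ← integral_add i3 i2]
    refine integral_congr_ae (Eventually.of_forall fun x => ?_)
    simp only; ring
  · have hup := l2Norm_le_of_ae_le hE (by positivity) hJle hψL2 hpoint
    rw [show x₀ + 2 * Δ - (x₀ - 2 * Δ) = 4 * Δ by ring] at hup
    rw [div_le_iff₀ hpos, add_mul]
    refine hup.trans (add_le_add le_rfl ?_)
    calc 15 * (M * (1 + (Δ ^ 4)⁻¹)) * G * (4 * Δ) ^ (1 / 2 : ℝ)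
        = 15 * M * ((1 + (Δ ^ 4)⁻¹) * G * (4 * Δ) ^ (1 / 2 : ℝ) / (e * r ^ (1 / 2 : ℝ)))
          * (e * r ^ (1 / 2 : ℝ)) := by field_simp
      _ ≤ _ := by gcongr

/-! ### The fourth root -/

theorem SymbolRing.norm_root_pow_four (V : ℝ → ℂ) (l : ℂ) (x : ℝ) :
    ‖root V l x‖ ^ 4 = ‖l - V x‖ := by
  rw [← norm_pow, root_pow_four]

/-- The imaginary part of the principal fourth root is controlled from below. -/
theorem Complex.im_le_of_pow_four {z : ℂ} (hz : 0 < z.re) :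
    (0 ≤ z.im → z.im ≤ 4 * ‖z ^ (1 / 4 : ℂ)‖ ^ 3 * (z ^ (1 / 4 : ℂ)).im) ∧
    (z.im ≤ 0 → 4 * ‖z ^ (1 / 4 : ℂ)‖ ^ 3 * (z ^ (1 / 4 : ℂ)).im ≤ z.im) := by
  set m := z ^ (1 / 4 : ℂ) with hm
  have hm4 : m ^ 4 = z := by rw [hm, ← Complex.cpow_nat_mul]; simp
  have harg := Complex.abs_arg_lt_pi_div_two_iff.2 (Or.inl hz)
  rw [abs_lt] at harg
  have e14 : (1 / 4 : ℂ) = ((1 / 4 : ℝ) : ℂ) := by push_cast; rfl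
  have hz0 : 0 < ‖z‖ := norm_pos_iff.2 fun h => by simp [h] at hz
  have hre : m.re = ‖z‖ ^ (1 / 4 : ℝ) * Real.cos (Complex.arg z * (1 / 4 : ℝ)) := by
    rw [hm, e14, Complex.cpow_ofReal_re]
  have him : m.im = ‖z‖ ^ (1 / 4 : ℝ) * Real.sin (Complex.arg z * (1 / 4 : ℝ)) := by
    rw [hm, e14, Complex.cpow_ofReal_im]
  have hs : 0 < ‖z‖ ^ (1 / 4 : ℝ) := Real.rpow_pos_of_pos hz0 _
  have hpi := Real.pi_pos
  have hp : 0 < m.re := by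
    rw [hre]
    exact mul_pos hs (Real.cos_pos_of_mem_Ioo ⟨by linarith, by linarith⟩)
  -- The argument of `m` is below `π/8` in absolute value, so `m²` still lies in the right
  -- half-plane.
  have hpq : 0 < m.re ^ 2 - m.im ^ 2 := by
    have h2 : m.re ^ 2 - m.im ^ 2
        = (‖z‖ ^ (1 / 4 : ℝ)) ^ 2 * Real.cos (2 * (Complex.arg z * (1 / 4 : ℝ))) := by
      rw [Real.cos_two_mul', hre, him]; ring
    rw [h2]
    exact mul_pos (pow_pos hs 2) (Real.cos_pos_of_mem_Ioo ⟨by linarith, by linarith⟩)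
  -- The last factor is positive and at most `‖m‖³`, so `Im m` has the sign of `Im z` and modulus at
  -- least `|Im z| / (4 ‖m‖³)`.
  have hzim : z.im = 4 * m.im * (m.re * (m.re ^ 2 - m.im ^ 2)) := by
    conv_lhs => rw [← hm4]
    have : m ^ 4 = (m * m) * (m * m) := by ring
    rw [this]
    simp only [Complex.mul_im, Complex.mul_re]
    ring
  have hn : ‖m‖ ^ 2 = m.re ^ 2 + m.im ^ 2 := by
    rw [← Complex.normSq_eq_norm_sq, Complex.normSq_apply]; ring
  have hre_le : m.re ≤ ‖m‖ := Complex.re_le_norm m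
  have ht : 0 < m.re * (m.re ^ 2 - m.im ^ 2) := mul_pos hp hpq
  have htle : m.re * (m.re ^ 2 - m.im ^ 2) ≤ ‖m‖ ^ 3 := by
    calc m.re * (m.re ^ 2 - m.im ^ 2) ≤ ‖m‖ * ‖m‖ ^ 2 := by
          apply mul_le_mul hre_le _ hpq.le (norm_nonneg _)
          rw [hn]; nlinarith [sq_nonneg m.im]
      _ = ‖m‖ ^ 3 := by ring
  constructor
  · intro h
    have hq : 0 ≤ m.im := by
      by_contra hq
      have : z.im < 0 := by rw [hzim]; nlinarith [mul_pos (neg_pos.2 (not_le.1 hq)) ht]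
      linarith
    rw [hzim]
    nlinarith [mul_le_mul_of_nonneg_left htle hq]
  · intro h
    have hq : m.im ≤ 0 := by
      by_contra hq
      have : 0 < z.im := by rw [hzim]; nlinarith [mul_pos (not_le.1 hq) ht]
      linarith
    rw [hzim]
    nlinarith [mul_le_mul_of_nonneg_left htle (neg_nonneg.2 hq)]

/-! ### Local bounds near the turning point -/

/-- The behaviour of the potential on `(x₀ - 2η/T, x₀ + 2η/T)` used in the WKB construction at
`l = α + iβ`. -/
structure LocalBounds (N : ℕ) (V : ℝ → ℂ) (α β x₀ T η K ρ A : ℝ) : Prop where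
  one_le : 1 ≤ K
  eta_pos : 0 < η
  T_pos : 0 < T
  alpha_pos : 0 < |α|
  one_le_beta : 1 ≤ β
  slope_pos : 0 < A
  rho_nonneg : 0 ≤ ρ
  left_pos : 0 < x₀ - 2 * (η / T)
  hasDerivAt : ∀ i < N + 2, ∀ x ∈ Ioo (x₀ - 2 * (η / T)) (x₀ + 2 * (η / T)),
    HasDerivAt (iteratedDeriv i V) (iteratedDeriv (i + 1) V x) x
  ae_hasDerivAt : ∀ᵐ x : ℝ, x ∈ Ioo (x₀ - 2 * (η / T)) (x₀ + 2 * (η / T)) →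
    HasDerivAt (iteratedDeriv (N + 2) V) (iteratedDeriv (N + 3) V x) x
  ac : ∀ a b : ℝ, 0 < a → a ≤ b → AbsolutelyContinuousOnInterval (iteratedDeriv (N + 2) V) a b
  bound : ∀ i ∈ Finset.Icc 1 (N + 2), ∀ x ∈ Ioo (x₀ - 2 * (η / T)) (x₀ + 2 * (η / T)),
    ‖iteratedDeriv i V x‖ ≤ K * (T ^ i * ‖V x‖)
  ae_bound : ∀ᵐ x : ℝ, x ∈ Ioo (x₀ - 2 * (η / T)) (x₀ + 2 * (η / T)) →
    ‖iteratedDeriv (N + 3) V x‖ ≤ K * (T ^ (N + 3) * ‖V x‖)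
  re_lower : ∀ x ∈ Ioo (x₀ - 2 * (η / T)) (x₀ + 2 * (η / T)), |α| ≤ K * (α - (V x).re)
  re_upper : ∀ x ∈ Ioo (x₀ - 2 * (η / T)) (x₀ + 2 * (η / T)), α - (V x).re ≤ K * |α|
  size : ∀ x ∈ Ioo (x₀ - 2 * (η / T)) (x₀ + 2 * (η / T)), ‖V x‖ ≤ K * (ρ + β)
  rho_le : ρ ≤ K * |α|
  slope_right : ∀ x ∈ Ioo (x₀ - 2 * (η / T)) (x₀ + 2 * (η / T)), x₀ ≤ x →
    A * (x - x₀) ≤ K * ((V x).im - β)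
  slope_left : ∀ x ∈ Ioo (x₀ - 2 * (η / T)) (x₀ + 2 * (η / T)), x ≤ x₀ →
    A * (x₀ - x) ≤ K * (β - (V x).im)
  small : T * (1 + β / |α|) ≤ K * |α| ^ (1 / 4 : ℝ)

/-! ### Uniform estimates for the root and the normalized derivatives -/

namespace LocalBounds
open SymbolRing MvPolynomial

variable {N : ℕ} {V : ℝ → ℂ} {α β x₀ T η K ρ A x : ℝ}

theorem K_pos (h : LocalBounds N V α β x₀ T η K ρ A) : 0 < K := one_pos.trans_le h.one_le

theorem width_pos (h : LocalBounds N V α β x₀ T η K ρ A) : 0 < η / T := div_pos h.eta_pos h.T_pos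

theorem re_pos (h : LocalBounds N V α β x₀ T η K ρ A)
    (hx : x ∈ Ioo (x₀ - 2 * (η / T)) (x₀ + 2 * (η / T))) : 0 < ((⟨α, β⟩ : ℂ) - V x).re := by
  have h1 := h.re_lower x hx
  have h2 := h.alpha_pos
  have h3 := h.K_pos
  simp only [Complex.sub_re]
  by_contra hn
  nlinarith [mul_nonneg h3.le (neg_nonneg.2 (not_lt.1 hn))]

theorem slitPlane (h : LocalBounds N V α β x₀ T η K ρ A)
    (hx : x ∈ Ioo (x₀ - 2 * (η / T)) (x₀ + 2 * (η / T))) :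
    (⟨α, β⟩ : ℂ) - V x ∈ Complex.slitPlane := Or.inl (h.re_pos hx)

theorem norm_pos (h : LocalBounds N V α β x₀ T η K ρ A)
    (hx : x ∈ Ioo (x₀ - 2 * (η / T)) (x₀ + 2 * (η / T))) : 0 < ‖(⟨α, β⟩ : ℂ) - V x‖ :=
  norm_pos_iff.2 (Complex.slitPlane_ne_zero (h.slitPlane hx))

theorem root_pos (h : LocalBounds N V α β x₀ T η K ρ A)
    (hx : x ∈ Ioo (x₀ - 2 * (η / T)) (x₀ + 2 * (η / T))) : 0 < ‖root V ⟨α, β⟩ x‖ :=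
  norm_pos_iff.2 (root_ne_zero (Complex.slitPlane_ne_zero (h.slitPlane hx)))

theorem alpha_le (h : LocalBounds N V α β x₀ T η K ρ A)
    (hx : x ∈ Ioo (x₀ - 2 * (η / T)) (x₀ + 2 * (η / T))) :
    |α| ≤ K * ‖(⟨α, β⟩ : ℂ) - V x‖ := by
  refine (h.re_lower x hx).trans (mul_le_mul_of_nonneg_left ?_ h.K_pos.le)
  have := Complex.re_le_norm ((⟨α, β⟩ : ℂ) - V x)
  simpa using this

theorem norm_le (h : LocalBounds N V α β x₀ T η K ρ A)
    (hx : x ∈ Ioo (x₀ - 2 * (η / T)) (x₀ + 2 * (η / T))) :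
    ‖(⟨α, β⟩ : ℂ) - V x‖ ≤ 2 * K ^ 2 * (|α| + β) := by
  have h1 := Complex.norm_le_abs_re_add_abs_im ((⟨α, β⟩ : ℂ) - V x)
  have h2 := h.re_upper x hx
  have h3 := h.re_pos hx
  simp only [Complex.sub_re, Complex.sub_im] at h1 h3
  rw [abs_of_pos h3] at h1
  have h4 : |β - (V x).im| ≤ β + K * (ρ + β) := by
    refine (abs_sub _ _).trans (add_le_add (abs_of_pos ?_).le ?_)
    · linarith [h.one_le_beta]
    · exact (Complex.abs_im_le_norm _).trans (h.size x hx)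
  have h5 := h.rho_le
  have hK := h.one_le
  have hα := h.alpha_pos
  have hβ := h.one_le_beta
  have h6 : K * ρ ≤ K * (K * |α|) := mul_le_mul_of_nonneg_left h5 h.K_pos.le
  have h7 : K ≤ K ^ 2 := by nlinarith
  nlinarith [mul_le_mul_of_nonneg_right h7 hα.le,
    mul_le_mul_of_nonneg_right h7 (zero_le_one.trans hβ)]

/-- The relative size of the potential. -/
theorem ratio_le (h : LocalBounds N V α β x₀ T η K ρ A)
    (hx : x ∈ Ioo (x₀ - 2 * (η / T)) (x₀ + 2 * (η / T))) :
    ‖V x‖ / ‖(⟨α, β⟩ : ℂ) - V x‖ ≤ K ^ 3 * (1 + β / |α|) := by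
  have hα := h.alpha_pos
  have hK := h.one_le
  have hβ := h.one_le_beta
  rw [div_le_iff₀ (h.norm_pos hx)]
  have h2 := h.alpha_le hx
  have h1 : ‖V x‖ ≤ K ^ 2 * (|α| + β) := by
    refine (h.size x hx).trans ?_
    have h5 := h.rho_le
    nlinarith [mul_le_mul_of_nonneg_left h5 h.K_pos.le,
      mul_le_mul_of_nonneg_right (show K ≤ K ^ 2 by nlinarith) (zero_le_one.trans hβ)]
  calc ‖V x‖ ≤ K ^ 2 * (|α| + β) := h1
    _ = K ^ 2 * ((1 + β / |α|) * |α|) := by field_simp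
    _ ≤ K ^ 2 * ((1 + β / |α|) * (K * ‖(⟨α, β⟩ : ℂ) - V x‖)) := by gcongr
    _ = _ := by ring

theorem T_mul_le (h : LocalBounds N V α β x₀ T η K ρ A)
    (hx : x ∈ Ioo (x₀ - 2 * (η / T)) (x₀ + 2 * (η / T))) :
    T * (1 + β / |α|) ≤ K ^ 2 * ‖root V ⟨α, β⟩ x‖ := by
  have hα := h.alpha_pos
  have hm := h.root_pos hx
  have hK := h.one_le
  have h1 : |α| ^ (1 / 4 : ℝ) ≤ K * ‖root V ⟨α, β⟩ x‖ := by
    have h2 : |α| ≤ (K * ‖root V ⟨α, β⟩ x‖) ^ 4 := by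
      rw [mul_pow, norm_root_pow_four]
      refine (h.alpha_le hx).trans ?_
      gcongr
      exact le_self_pow₀ hK (by norm_num)
    calc |α| ^ (1 / 4 : ℝ) ≤ ((K * ‖root V ⟨α, β⟩ x‖) ^ 4) ^ (1 / 4 : ℝ) :=
          Real.rpow_le_rpow hα.le h2 (by norm_num)
      _ = K * ‖root V ⟨α, β⟩ x‖ := by
          rw [← Real.rpow_natCast, ← Real.rpow_mul (mul_nonneg h.K_pos.le hm.le)]; norm_num
  calc T * (1 + β / |α|) ≤ K * |α| ^ (1 / 4 : ℝ) := h.small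
    _ ≤ K * (K * ‖root V ⟨α, β⟩ x‖) := by have := h.K_pos.le; gcongr
    _ = _ := by ring

/-- This is where `small` enters: `T (1 + β/|α|)` is at most a constant times `|α|^{1/4}`, hence
times `|μ|`. A unit of weight therefore costs a bounded factor, and symbols are bounded uniformly in
`λ`. -/
theorem theta_mul_le (h : LocalBounds N V α β x₀ T η K ρ A)
    (hx : x ∈ Ioo (x₀ - 2 * (η / T)) (x₀ + 2 * (η / T))) :
    T / ‖root V ⟨α, β⟩ x‖ * (1 + ‖V x‖ / ‖(⟨α, β⟩ : ℂ) - V x‖) ≤ 2 * K ^ 5 := by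
  have hm := h.root_pos hx
  have hK := h.one_le
  have hB : 1 ≤ 1 + β / |α| := by
    have := div_nonneg (zero_le_one.trans h.one_le_beta) h.alpha_pos.le
    linarith
  have hT := h.T_pos
  have h1 : 1 + ‖V x‖ / ‖(⟨α, β⟩ : ℂ) - V x‖ ≤ 2 * K ^ 3 * (1 + β / |α|) := by
    have h2 := h.ratio_le hx
    have h3 : 1 ≤ K ^ 3 := one_le_pow₀ hK
    nlinarith [mul_le_mul h3 hB zero_le_one (by positivity)]
  rw [div_mul_eq_mul_div, div_le_iff₀ hm]
  calc T * (1 + ‖V x‖ / ‖(⟨α, β⟩ : ℂ) - V x‖) ≤ T * (2 * K ^ 3 * (1 + β / |α|)) := by gcongr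
    _ = 2 * K ^ 3 * (T * (1 + β / |α|)) := by ring
    _ ≤ 2 * K ^ 3 * (K ^ 2 * ‖root V ⟨α, β⟩ x‖) :=
        mul_le_mul_of_nonneg_left (h.T_mul_le hx) (by have := h.K_pos; positivity)
    _ = _ := by ring

theorem norm_coord_eq {M i : ℕ} (hi : i < M) :
    ‖coord M V ⟨α, β⟩ i x‖ = ‖iteratedDeriv (i + 1) V x‖ /
      (‖(⟨α, β⟩ : ℂ) - V x‖ * ‖root V ⟨α, β⟩ x‖ ^ (i + 1)) := by
  rw [coord, if_pos hi, norm_div, norm_mul, norm_pow]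

theorem norm_coord_le_of_bound (h : LocalBounds N V α β x₀ T η K ρ A)
    (hx : x ∈ Ioo (x₀ - 2 * (η / T)) (x₀ + 2 * (η / T))) {M i : ℕ} (hi : i < M)
    (hb : ‖iteratedDeriv (i + 1) V x‖ ≤ K * (T ^ (i + 1) * ‖V x‖)) :
    ‖coord M V ⟨α, β⟩ i x‖ ≤ K * ((T / ‖root V ⟨α, β⟩ x‖) ^ (i + 1)
      * (‖V x‖ / ‖(⟨α, β⟩ : ℂ) - V x‖)) := by
  have hm := h.root_pos hx
  have hz := h.norm_pos hx
  rw [norm_coord_eq hi, div_le_iff₀ (by positivity)]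
  refine hb.trans (le_of_eq ?_)
  rw [div_pow]
  field_simp

theorem norm_coord_le (h : LocalBounds N V α β x₀ T η K ρ A)
    (hx : x ∈ Ioo (x₀ - 2 * (η / T)) (x₀ + 2 * (η / T))) {i : ℕ} (hi : i < N + 2) :
    ‖coord (N + 3) V ⟨α, β⟩ i x‖ ≤ K * ((T / ‖root V ⟨α, β⟩ x‖) ^ (i + 1)
      * (‖V x‖ / ‖(⟨α, β⟩ : ℂ) - V x‖)) :=
  h.norm_coord_le_of_bound hx (by omega)
    (h.bound (i + 1) (Finset.mem_Icc.2 ⟨by omega, by omega⟩) x hx)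

/-- Truncation in `coord` makes the bound trivial beyond index `N + 2`. The remainder has weights up
to `topWeight N`, so its general estimate asks for a bound at every smaller index. -/
theorem ae_norm_coord_le (h : LocalBounds N V α β x₀ T η K ρ A) :
    ∀ᵐ x : ℝ, x ∈ Ioo (x₀ - 2 * (η / T)) (x₀ + 2 * (η / T)) → ∀ i,
      ‖coord (N + 3) V ⟨α, β⟩ i x‖ ≤ K * ((T / ‖root V ⟨α, β⟩ x‖) ^ (i + 1)
        * (‖V x‖ / ‖(⟨α, β⟩ : ℂ) - V x‖)) := by
  filter_upwards [h.ae_bound] with x hb hx i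
  rcases lt_trichotomy i (N + 2) with hi | rfl | hi
  · exact h.norm_coord_le hx hi
  · exact h.norm_coord_le_of_bound hx (by omega) (hb hx)
  · rw [coord, if_neg (by omega), norm_zero]
    have := h.T_pos
    have := h.K_pos
    positivity

end LocalBounds

namespace SymbolRing
open MvPolynomial

theorem weightBound_le_pow {θ b : ℝ} (hθ : 0 ≤ θ) (hb : 0 ≤ b) (d : ℕ) :
    weightBound θ b d ≤ (θ * (1 + b)) ^ d := by
  cases d with
  | zero => simp [weightBound]
  | succ d =>
    rw [weightBound, mul_pow, pow_succ (1 + b), mul_comm b]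
    gcongr
    linarith

theorem weightBound_succ_eq (θ b : ℝ) (d : ℕ) :
    weightBound θ b (d + 1) = θ * b * (θ * (1 + b)) ^ d := by
  rw [weightBound, mul_pow]; ring

end SymbolRing

/-! ### Size of the symbols, of the lower order phase and of the remainder -/

namespace LocalBounds
open SymbolRing MvPolynomial

theorem exists_norm_eval_le {N m n : ℕ} (K : ℝ) (hK : 0 ≤ K) {p : SymbolRing}
    (hp : p ∈ weightRange m n) (hn : n ≤ N + 2) :
    ∃ C, 1 ≤ C ∧ ∀ {V : ℝ → ℂ} {α β x₀ T η ρ A x : ℝ}, LocalBounds N V α β x₀ T η K ρ A →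
      x ∈ Ioo (x₀ - 2 * (η / T)) (x₀ + 2 * (η / T)) →
      ‖eval (fun i => coord (N + 3) V ⟨α, β⟩ i x) p‖ ≤ C := by
  obtain ⟨C, hC, hCb⟩ := SymbolRing.exists_norm_eval_le hp hK
  refine ⟨1 + C * ∑ d ∈ Finset.Icc m n, (2 * K ^ 5) ^ d, ?_, ?_⟩
  · have : 0 ≤ C * ∑ d ∈ Finset.Icc m n, (2 * K ^ 5) ^ d := by positivity
    linarith
  intro V α β x₀ T η ρ A x h hx
  have hT := h.T_pos
  have hθ : 0 ≤ T / ‖root V ⟨α, β⟩ x‖ := by positivity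
  have hb : 0 ≤ ‖V x‖ / ‖(⟨α, β⟩ : ℂ) - V x‖ := by positivity
  have h1 := hCb _ _ _ hθ hb fun i hi => h.norm_coord_le hx (i := i) (by omega)
  refine h1.trans ?_
  have h2 : ∑ d ∈ Finset.Icc m n, weightBound (T / ‖root V ⟨α, β⟩ x‖)
      (‖V x‖ / ‖(⟨α, β⟩ : ℂ) - V x‖) d ≤ ∑ d ∈ Finset.Icc m n, (2 * K ^ 5) ^ d := by
    refine Finset.sum_le_sum fun d _ => (weightBound_le_pow hθ hb d).trans ?_
    exact pow_le_pow_left₀ (by positivity) (h.theta_mul_le hx) d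
  have h3 := mul_le_mul_of_nonneg_left h2 hC
  linarith

/-- The lower order part of the phase. -/
theorem exists_norm_root_mul_eval_le {N : ℕ} (K : ℝ) (hK : 0 ≤ K) {p : SymbolRing}
    (hp : p ∈ weightRange 1 N) :
    ∃ C, 0 ≤ C ∧ ∀ {V : ℝ → ℂ} {α β x₀ T η ρ A x : ℝ}, LocalBounds N V α β x₀ T η K ρ A →
      x ∈ Ioo (x₀ - 2 * (η / T)) (x₀ + 2 * (η / T)) →
      ‖root V ⟨α, β⟩ x * eval (fun i => coord (N + 3) V ⟨α, β⟩ i x) p‖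
        ≤ C * (T * (1 + β / |α|)) := by
  obtain ⟨C, hC, hCb⟩ := SymbolRing.exists_norm_eval_le hp hK
  refine ⟨C * (K ^ 3 * ∑ d ∈ Finset.Icc 1 N, (2 * K ^ 5) ^ (d - 1)), by positivity, ?_⟩
  intro V α β x₀ T η ρ A x h hx
  have hT := h.T_pos
  have hm := h.root_pos hx
  set θ := T / ‖root V ⟨α, β⟩ x‖ with hθdef
  set b := ‖V x‖ / ‖(⟨α, β⟩ : ℂ) - V x‖ with hbdef
  have hθ : 0 ≤ θ := by positivity
  have hb : 0 ≤ b := by positivity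
  have h1 := hCb _ _ _ hθ hb fun i hi => h.norm_coord_le hx (i := i) (by omega)
  have h2 : ∑ d ∈ Finset.Icc 1 N, weightBound θ b d
      ≤ θ * b * ∑ d ∈ Finset.Icc 1 N, (2 * K ^ 5) ^ (d - 1) := by
    rw [Finset.mul_sum]
    refine Finset.sum_le_sum fun d hd => ?_
    obtain ⟨d, rfl⟩ : ∃ e, d = e + 1 := ⟨d - 1, by have := (Finset.mem_Icc.1 hd).1; omega⟩
    rw [weightBound_succ_eq, Nat.add_sub_cancel]
    exact mul_le_mul_of_nonneg_left (pow_le_pow_left₀ (by positivity) (h.theta_mul_le hx) d)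
      (by positivity)
  have hS : 0 ≤ ∑ d ∈ Finset.Icc 1 N, (2 * K ^ 5) ^ (d - 1) := by positivity
  -- Weight at least one gives a factor `θ b`, and `μ` cancels the denominator of `θ`. The remaining
  -- bound is linear in `T`, so integrating over a width of order `η / T` costs only a multiple of
  -- `1 + β/|α|`.
  have hmθ : ‖root V ⟨α, β⟩ x‖ * θ = T := by rw [hθdef]; field_simp
  rw [norm_mul]
  calc ‖root V ⟨α, β⟩ x‖ * ‖eval (fun i => coord (N + 3) V ⟨α, β⟩ i x) p‖
      ≤ ‖root V ⟨α, β⟩ x‖ * (C * (θ * b * ∑ d ∈ Finset.Icc 1 N, (2 * K ^ 5) ^ (d - 1))) := by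
        gcongr
        exact h1.trans (by gcongr)
    _ = C * (b * ∑ d ∈ Finset.Icc 1 N, (2 * K ^ 5) ^ (d - 1)) * (‖root V ⟨α, β⟩ x‖ * θ) := by
        ring
    _ = C * (b * ∑ d ∈ Finset.Icc 1 N, (2 * K ^ 5) ^ (d - 1)) * T := by rw [hmθ]
    _ ≤ C * (K ^ 3 * (1 + β / |α|) * ∑ d ∈ Finset.Icc 1 N, (2 * K ^ 5) ^ (d - 1)) * T := by
        gcongr
        exact h.ratio_le hx
    _ = _ := by ring

/-- The double sum of powers bounding the remainder. -/
noncomputable def powerSum (N : ℕ) (T ρ α β : ℝ) : ℝ :=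
  ∑ d ∈ Finset.Icc (N + 1) (topWeight N), ∑ j ∈ Finset.Icc 1 d,
    T ^ d * (ρ ^ j + β ^ j) / |α| ^ (((d : ℝ) - 4) / 4 + (j : ℝ))

/-- With `Z = |z| = |μ|⁴` the left side is exactly `Tᵈ |V|ʲ / Z^e` with `e = (d - 4)/4 + j`. Then
`|α| ≤ K Z` and `|V| ≤ K (ρ + β)` produce a term of the error sum. -/
theorem norm_mul_theta_pow_le {N : ℕ} {V : ℝ → ℂ} {α β x₀ T η K ρ A x : ℝ}
    (h : LocalBounds N V α β x₀ T η K ρ A)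
    (hx : x ∈ Ioo (x₀ - 2 * (η / T)) (x₀ + 2 * (η / T))) {d j : ℕ} (hd : 1 ≤ d) (hj : 1 ≤ j)
    (hjd : j ≤ d) :
    ‖(⟨α, β⟩ : ℂ) - V x‖ * ((T / ‖root V ⟨α, β⟩ x‖) ^ d *
      (‖V x‖ / ‖(⟨α, β⟩ : ℂ) - V x‖) ^ j) ≤ (2 * K) ^ d * K ^ (2 * d) *
      (T ^ d * (ρ ^ j + β ^ j) / |α| ^ (((d : ℝ) - 4) / 4 + (j : ℝ))) := by
  have hz := h.norm_pos hx
  have hm := h.root_pos hx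
  have hK := h.one_le
  have hK0 := h.K_pos
  have hα := h.alpha_pos
  have hT := h.T_pos
  have hβ : 0 ≤ β := zero_le_one.trans h.one_le_beta
  have hρ := h.rho_nonneg
  set Z := ‖(⟨α, β⟩ : ℂ) - V x‖ with hZ
  set m := ‖root V ⟨α, β⟩ x‖ with hmdef
  have hm4 : m ^ 4 = Z := norm_root_pow_four V ⟨α, β⟩ x
  set e : ℝ := ((d : ℝ) - 4) / 4 + (j : ℝ) with he
  have hd' : (1 : ℝ) ≤ d := by exact_mod_cast hd
  have hj' : (1 : ℝ) ≤ j := by exact_mod_cast hj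
  have hjd' : (j : ℝ) ≤ d := by exact_mod_cast hjd
  -- A nonnegative exponent allows `|α| ≤ K Z` to be raised to it; this is where `j ≥ 1` compensates
  -- for the factor `z`. The bound `2 d` below only makes the constant depend on `d` alone.
  have he0 : 0 ≤ e := by rw [he]; linarith
  have he2 : e ≤ ((2 * d : ℕ) : ℝ) := by rw [he]; push_cast; linarith
  have hmZ : m = Z ^ (1 / 4 : ℝ) := by
    rw [← hm4, ← Real.rpow_natCast, ← Real.rpow_mul hm.le]; norm_num
  have hmd : m ^ d * Z ^ j = Z * Z ^ e := by
    rw [hmZ, ← Real.rpow_natCast, ← Real.rpow_natCast Z j, ← Real.rpow_mul hz.le,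
      ← Real.rpow_add hz]
    nth_rewrite 2 [← Real.rpow_one Z]
    rw [← Real.rpow_add hz]
    congr 1
    rw [he]; ring
  have e1 : Z * ((T / m) ^ d * (‖V x‖ / Z) ^ j) = T ^ d * ‖V x‖ ^ j / Z ^ e := by
    have hZe : 0 < Z ^ e := Real.rpow_pos_of_pos hz _
    rw [div_pow, div_pow, div_mul_div_comm, hmd]
    field_simp
  rw [e1]
  have hae : |α| ^ e ≤ K ^ (2 * d) * Z ^ e := by
    calc |α| ^ e ≤ (K * Z) ^ e := Real.rpow_le_rpow hα.le (h.alpha_le hx) he0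
      _ = K ^ e * Z ^ e := Real.mul_rpow hK0.le hz.le
      _ ≤ K ^ ((2 * d : ℕ) : ℝ) * Z ^ e := by
          gcongr
      _ = _ := by rw [Real.rpow_natCast]
  have hV : ‖V x‖ ^ j ≤ (2 * K) ^ d * (ρ ^ j + β ^ j) := by
    have h1 : (ρ + β) ^ j ≤ 2 ^ d * (ρ ^ j + β ^ j) := by
      calc (ρ + β) ^ j ≤ 2 ^ (j - 1) * (ρ ^ j + β ^ j) := add_pow_le hρ hβ j
        _ ≤ 2 ^ d * (ρ ^ j + β ^ j) := by
          gcongr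
          · norm_num
          · omega
    calc ‖V x‖ ^ j ≤ (K * (ρ + β)) ^ j := by gcongr; exact h.size x hx
      _ = K ^ j * (ρ + β) ^ j := mul_pow _ _ _
      _ ≤ K ^ d * (2 ^ d * (ρ ^ j + β ^ j)) := by
          gcongr
      _ = _ := by rw [mul_pow]; ring
  have hZe : 0 < Z ^ e := Real.rpow_pos_of_pos hz _
  have hαe : 0 < |α| ^ e := Real.rpow_pos_of_pos hα _
  rw [div_le_iff₀ hZe]
  calc T ^ d * ‖V x‖ ^ j ≤ T ^ d * ((2 * K) ^ d * (ρ ^ j + β ^ j)) := by gcongr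
    _ = (2 * K) ^ d * (T ^ d * (ρ ^ j + β ^ j) / |α| ^ e) * |α| ^ e := by field_simp
    _ ≤ (2 * K) ^ d * (T ^ d * (ρ ^ j + β ^ j) / |α| ^ e) * (K ^ (2 * d) * Z ^ e) := by gcongr
    _ = _ := by ring

/-- Convexity gives `b (1 + b)^(d-1) ≲ b + b^d`, so the extreme terms `j = 1` and `j = d` of the sum
already suffice. -/
theorem norm_mul_weightBound_le {N : ℕ} {V : ℝ → ℂ} {α β x₀ T η K ρ A x : ℝ}
    (h : LocalBounds N V α β x₀ T η K ρ A)
    (hx : x ∈ Ioo (x₀ - 2 * (η / T)) (x₀ + 2 * (η / T))) {d : ℕ} (hd : 1 ≤ d) :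
    ‖(⟨α, β⟩ : ℂ) - V x‖ * weightBound (T / ‖root V ⟨α, β⟩ x‖)
      (‖V x‖ / ‖(⟨α, β⟩ : ℂ) - V x‖) d ≤ 2 * 2 ^ d * ((2 * K) ^ d * K ^ (2 * d)) *
      ∑ j ∈ Finset.Icc 1 d, T ^ d * (ρ ^ j + β ^ j) / |α| ^ (((d : ℝ) - 4) / 4 + (j : ℝ)) := by
  have h1 := h.norm_mul_theta_pow_le hx hd le_rfl hd
  have h2 := h.norm_mul_theta_pow_le hx hd hd le_rfl
  have hK0 := h.K_pos
  have hα := h.alpha_pos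
  have hT := h.T_pos
  have hβ : 0 ≤ β := zero_le_one.trans h.one_le_beta
  have hρ := h.rho_nonneg
  have hz := h.norm_pos hx
  have hm := h.root_pos hx
  set Z := ‖(⟨α, β⟩ : ℂ) - V x‖ with hZ
  set θ := T / ‖root V ⟨α, β⟩ x‖ with hθ
  set b := ‖V x‖ / Z with hb
  have hθ0 : 0 ≤ θ := by positivity
  have hb0 : 0 ≤ b := by positivity
  set t : ℕ → ℝ := fun j => T ^ d * (ρ ^ j + β ^ j) / |α| ^ (((d : ℝ) - 4) / 4 + (j : ℝ)) with ht
  have ht0 : ∀ j, 0 ≤ t j := fun j => by positivity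
  have hle : ∀ j ∈ Finset.Icc 1 d, t j ≤ ∑ j ∈ Finset.Icc 1 d, t j := fun j hj =>
    Finset.single_le_sum (fun i _ => ht0 i) hj
  have h3 := hle 1 (Finset.mem_Icc.2 ⟨le_rfl, hd⟩)
  have h4 := hle d (Finset.mem_Icc.2 ⟨hd, le_rfl⟩)
  have hw : weightBound θ b d ≤ 2 ^ d * (θ ^ d * b ^ 1 + θ ^ d * b ^ d) := by
    obtain ⟨n, rfl⟩ : ∃ n, d = n + 1 := ⟨d - 1, by omega⟩
    have key : b * (1 + b) ^ n ≤ 2 ^ (n + 1) * (b + b ^ (n + 1)) :=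
      calc b * (1 + b) ^ n ≤ b * (2 ^ (n - 1) * (1 ^ n + b ^ n)) := by
            gcongr
            exact add_pow_le zero_le_one hb0 n
        _ ≤ b * (2 ^ (n + 1) * (1 ^ n + b ^ n)) := by
            gcongr
            · norm_num
            · omega
        _ = _ := by rw [one_pow]; ring
    calc weightBound θ b (n + 1) = θ ^ (n + 1) * (b * (1 + b) ^ n) := rfl
      _ ≤ θ ^ (n + 1) * (2 ^ (n + 1) * (b + b ^ (n + 1))) := by gcongr
      _ = _ := by ring
  have hc : 0 ≤ (2 * K) ^ d * K ^ (2 * d) := by positivity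
  calc Z * weightBound θ b d ≤ Z * (2 ^ d * (θ ^ d * b ^ 1 + θ ^ d * b ^ d)) := by gcongr
    _ = 2 ^ d * (Z * (θ ^ d * b ^ 1) + Z * (θ ^ d * b ^ d)) := by ring
    _ ≤ 2 ^ d * ((2 * K) ^ d * K ^ (2 * d) * t 1 + (2 * K) ^ d * K ^ (2 * d) * t d) := by
        gcongr
    _ ≤ 2 ^ d * ((2 * K) ^ d * K ^ (2 * d) * (∑ j ∈ Finset.Icc 1 d, t j)
          + (2 * K) ^ d * K ^ (2 * d) * ∑ j ∈ Finset.Icc 1 d, t j) := by gcongr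
    _ = _ := by ring

theorem exists_ae_remainder_le {N : ℕ} (K : ℝ) (hK : 1 ≤ K) {p : SymbolRing}
    (hp : p ∈ weightRange (N + 1) (topWeight N)) :
    ∃ C, 0 ≤ C ∧ ∀ {V : ℝ → ℂ} {α β x₀ T η ρ A : ℝ}, LocalBounds N V α β x₀ T η K ρ A →
      ∀ᵐ x : ℝ, x ∈ Ioo (x₀ - 2 * (η / T)) (x₀ + 2 * (η / T)) →
      ‖((⟨α, β⟩ : ℂ) - V x) * eval (fun i => coord (N + 3) V ⟨α, β⟩ i x) p‖
        ≤ C * powerSum N T ρ α β := by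
  obtain ⟨C, hC, hCb⟩ := SymbolRing.exists_norm_eval_le hp (zero_le_one.trans hK)
  set D : ℕ → ℝ := fun d => 2 * 2 ^ d * ((2 * K) ^ d * K ^ (2 * d)) with hD
  have hD0 : ∀ d, 0 ≤ D d := fun d => by positivity
  refine ⟨C * ∑ d ∈ Finset.Icc (N + 1) (topWeight N), D d,
    mul_nonneg hC (Finset.sum_nonneg fun d _ => hD0 d), ?_⟩
  intro V α β x₀ T η ρ A h
  filter_upwards [h.ae_norm_coord_le] with x hcoord hx
  have hT := h.T_pos
  have hm := h.root_pos hx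
  have hz := h.norm_pos hx
  have hα := h.alpha_pos
  have hβ : 0 ≤ β := zero_le_one.trans h.one_le_beta
  have hρ := h.rho_nonneg
  have h1 := hCb _ _ _ (by positivity) (by positivity) fun i _ => hcoord hx i
  rw [norm_mul]
  calc ‖(⟨α, β⟩ : ℂ) - V x‖ * ‖eval (fun i => coord (N + 3) V ⟨α, β⟩ i x) p‖
      ≤ ‖(⟨α, β⟩ : ℂ) - V x‖ * (C * ∑ d ∈ Finset.Icc (N + 1) (topWeight N),
          weightBound (T / ‖root V ⟨α, β⟩ x‖) (‖V x‖ / ‖(⟨α, β⟩ : ℂ) - V x‖) d) := by gcongr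
    _ = C * ∑ d ∈ Finset.Icc (N + 1) (topWeight N), ‖(⟨α, β⟩ : ℂ) - V x‖ *
          weightBound (T / ‖root V ⟨α, β⟩ x‖) (‖V x‖ / ‖(⟨α, β⟩ : ℂ) - V x‖) d := by
        rw [← Finset.mul_sum]; ring
    _ ≤ C * ∑ d ∈ Finset.Icc (N + 1) (topWeight N), D d * ∑ j ∈ Finset.Icc 1 d,
          T ^ d * (ρ ^ j + β ^ j) / |α| ^ (((d : ℝ) - 4) / 4 + (j : ℝ)) := by
        refine mul_le_mul_of_nonneg_left (Finset.sum_le_sum fun d hd => ?_) hC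
        exact h.norm_mul_weightBound_le hx (by have := (Finset.mem_Icc.1 hd).1; omega)
    _ ≤ C * ((∑ d ∈ Finset.Icc (N + 1) (topWeight N), D d) * powerSum N T ρ α β) := by
        refine mul_le_mul_of_nonneg_left ?_ hC
        rw [Finset.sum_mul]
        refine Finset.sum_le_sum fun d hd => mul_le_mul_of_nonneg_left ?_ (hD0 d)
        exact Finset.single_le_sum (f := fun d : ℕ => ∑ j ∈ Finset.Icc 1 d,
          T ^ d * (ρ ^ j + β ^ j) / |α| ^ (((d : ℝ) - 4) / 4 + (j : ℝ)))
          (fun d _ => Finset.sum_nonneg fun j _ => by positivity) hd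
    _ = _ := by ring

end LocalBounds

/-! ### The WKB solution near the turning point -/

/-- The derivatives of `exp S` in terms of the derivatives `s` of `S`. -/
noncomputable def expJet (S : ℝ → ℂ) (s : ℕ → ℝ → ℂ) : ℕ → ℝ → ℂ
  | 0 => fun x => Complex.exp (S x)
  | 1 => fun x => s 0 x * Complex.exp (S x)
  | 2 => fun x => (s 1 x + s 0 x ^ 2) * Complex.exp (S x)
  | 3 => fun x => (s 2 x + 3 * (s 0 x * s 1 x) + s 0 x ^ 3) * Complex.exp (S x)
  | _ => fun x => (s 3 x + 4 * (s 0 x * s 2 x) + 3 * s 1 x ^ 2 + 6 * (s 0 x ^ 2 * s 1 x)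
      + s 0 x ^ 4) * Complex.exp (S x)

theorem hasDerivAt_expJet {S : ℝ → ℂ} {s : ℕ → ℝ → ℂ} {x : ℝ} (hS : HasDerivAt S (s 0 x) x)
    {j : ℕ} (hj : j ≤ 3) (hs : ∀ i < j, HasDerivAt (s i) (s (i + 1) x) x) :
    HasDerivAt (expJet S s j) (expJet S s (j + 1) x) x := by
  match j with
  | 0 => exact hS.cexp.congr_deriv (by simp only [expJet]; ring)
  | 1 =>
    refine ((hs 0 (by omega)).mul hS.cexp).congr_deriv ?_
    simp only [expJet, Nat.reduceAdd]; ring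
  | 2 =>
    refine (((hs 1 (by omega)).add ((hs 0 (by omega)).pow 2)).mul hS.cexp).congr_deriv ?_
    simp only [expJet, Nat.reduceAdd, Pi.add_apply, Pi.pow_apply]; push_cast; ring
  | 3 =>
    refine ((((hs 2 (by omega)).add (((hs 0 (by omega)).mul (hs 1 (by omega))).const_mul 3)).add
      ((hs 0 (by omega)).pow 3)).mul hS.cexp).congr_deriv ?_
    simp only [expJet, Nat.reduceAdd, Pi.add_apply, Pi.pow_apply, Pi.mul_apply]; push_cast; ring
  | n + 4 => omega

theorem norm_expJet_le {S : ℝ → ℂ} {s : ℕ → ℝ → ℂ} {x C m : ℝ} (hC : 1 ≤ C) (hm : 0 ≤ m)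
    (hs : ∀ i < 3, ‖s i x‖ ≤ C * m ^ (i + 1)) {j : ℕ} (hj : j ≤ 3) :
    ‖expJet S s j x‖ ≤ 5 * C ^ 3 * (1 + m ^ 4) * ‖Complex.exp (S x)‖ := by
  have h0 := hs 0 (by omega)
  have h1 := hs 1 (by omega)
  have h2 := hs 2 (by omega)
  simp only [zero_add, pow_one, Nat.reduceAdd] at h0 h1 h2
  have hC2 : C ≤ C ^ 3 := le_self_pow₀ hC (by norm_num)
  have hC3 : C ^ 2 ≤ C ^ 3 := pow_le_pow_right₀ hC (by norm_num)
  have hC1 : 1 ≤ C ^ 3 := one_le_pow₀ hC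
  have hmj : ∀ i ≤ 4, m ^ i ≤ 1 + m ^ 4 := by
    intro i hi
    rcases le_total m 1 with h | h
    · have := pow_le_one₀ hm h (n := i)
      have : 0 ≤ m ^ 4 := by positivity
      linarith
    · have := pow_le_pow_right₀ h hi
      linarith
  have hC0 : 0 ≤ C := by linarith
  have hexp := norm_nonneg (Complex.exp (S x))
  match j with
  | 0 =>
    simp only [expJet]
    refine le_mul_of_one_le_left hexp ?_
    have : 0 ≤ m ^ 4 := by positivity
    nlinarith
  | 1 =>
    simp only [expJet, norm_mul]
    gcongr
    calc ‖s 0 x‖ ≤ C * m := h0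
      _ ≤ C ^ 3 * (1 + m ^ 4) := by
          have := hmj 1 (by norm_num)
          rw [pow_one] at this
          gcongr
      _ ≤ _ := by
          have : 0 ≤ C ^ 3 * (1 + m ^ 4) := by positivity
          linarith
  | 2 =>
    simp only [expJet, norm_mul]
    gcongr
    calc ‖s 1 x + s 0 x ^ 2‖ ≤ ‖s 1 x‖ + ‖s 0 x‖ ^ 2 := by
          rw [← norm_pow]; exact norm_add_le _ _
      _ ≤ C * m ^ 2 + (C * m) ^ 2 := by gcongr
      _ = (C + C ^ 2) * m ^ 2 := by ring
      _ ≤ (C ^ 3 + C ^ 3) * (1 + m ^ 4) := by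
          have := hmj 2 (by norm_num)
          gcongr
      _ ≤ _ := by
          have : 0 ≤ C ^ 3 * (1 + m ^ 4) := by positivity
          linarith
  | 3 =>
    simp only [expJet, norm_mul]
    gcongr
    calc ‖s 2 x + 3 * (s 0 x * s 1 x) + s 0 x ^ 3‖
        ≤ ‖s 2 x‖ + 3 * (‖s 0 x‖ * ‖s 1 x‖) + ‖s 0 x‖ ^ 3 := by
          have h3 : ‖3 * (s 0 x * s 1 x)‖ = 3 * (‖s 0 x‖ * ‖s 1 x‖) := by
            rw [norm_mul, norm_mul]; norm_num
          rw [← norm_pow, ← h3]; exact norm_add₃_le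
      _ ≤ C * m ^ 3 + 3 * ((C * m) * (C * m ^ 2)) + (C * m) ^ 3 := by gcongr
      _ = (C + 3 * C ^ 2 + C ^ 3) * m ^ 3 := by ring
      _ ≤ (C ^ 3 + 3 * C ^ 3 + C ^ 3) * (1 + m ^ 4) := by
          have := hmj 3 (by norm_num)
          gcongr
      _ = _ := by ring
  | n + 4 => omega

theorem exists_primitive_on_Ioo {s : ℝ → ℂ} {a b x₀ : ℝ} (hs : ContinuousOn s (Ioo a b))
    (hx₀ : x₀ ∈ Ioo a b) :
    ∃ S : ℝ → ℂ, S x₀ = 0 ∧ ∀ x ∈ Ioo a b, HasDerivAt S (s x) x := by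
  refine ⟨fun x => ∫ t in x₀..x, s t, by simp, fun x hx => ?_⟩
  refine intervalIntegral.integral_hasDerivAt_right ?_
    (hs.stronglyMeasurableAtFilter isOpen_Ioo x hx) (hs.continuousAt (isOpen_Ioo.mem_nhds hx))
  exact (hs.mono (ordConnected_Ioo.uIcc_subset hx₀ hx)).intervalIntegrable

/-- On each side of `x₀` the mean value theorem is applied to `g + P (x - x₀)² / 2 ∓ Q |x - x₀|`,
with signs making it monotone. It turns a linear bound on `Re S'` into Gaussian decay of `exp S`. -/
theorem le_of_hasDerivAt_le_linear {g g' : ℝ → ℝ} {a b x₀ P Q : ℝ} (hx₀ : x₀ ∈ Ioo a b)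
    (h0 : g x₀ = 0) (hg : ∀ x ∈ Ioo a b, HasDerivAt g (g' x) x)
    (hr : ∀ x ∈ Ioo a b, x₀ ≤ x → g' x ≤ -(P * (x - x₀)) + Q)
    (hl : ∀ x ∈ Ioo a b, x ≤ x₀ → P * (x₀ - x) - Q ≤ g' x) {x : ℝ} (hx : x ∈ Ioo a b) :
    g x ≤ -(P / 2 * (x - x₀) ^ 2) + Q * |x - x₀| := by
  rcases lt_trichotomy x x₀ with h | rfl | h
  · have hsub : Icc x x₀ ⊆ Ioo a b := fun y hy => ⟨hx.1.trans_le hy.1, hy.2.trans_lt hx₀.2⟩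
    have hd : ∀ y ∈ Icc x x₀, HasDerivAt (fun y => g y + P / 2 * (y - x₀) ^ 2 + Q * (y - x₀))
        (g' y + P * (y - x₀) + Q) y := by
      intro y hy
      have h1 := ((hasDerivAt_id y).sub_const x₀)
      refine (((hg y (hsub hy)).add ((h1.pow 2).const_mul (P / 2))).add
        (h1.const_mul Q)).congr_deriv ?_
      simp; ring
    obtain ⟨y, hy, hy'⟩ := exists_hasDerivAt_eq_slope _ _ h
      (fun y hy => (hd y hy).continuousAt.continuousWithinAt)
      (fun y hy => hd y (Ioo_subset_Icc_self hy))
    have h2 := hl y (hsub (Ioo_subset_Icc_self hy)) hy.2.le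
    have h3 : 0 < x₀ - x := by linarith
    rw [eq_div_iff h3.ne'] at hy'
    have h4 : 0 ≤ (g' y + P * (y - x₀) + Q) * (x₀ - x) := mul_nonneg (by linarith) h3.le
    rw [hy', h0] at h4
    rw [abs_of_neg (by linarith)]
    simp only [sub_self] at h4
    linarith
  · simp [h0]
  · have hsub : Icc x₀ x ⊆ Ioo a b := fun y hy => ⟨hx₀.1.trans_le hy.1, hy.2.trans_lt hx.2⟩
    have hd : ∀ y ∈ Icc x₀ x, HasDerivAt (fun y => g y + P / 2 * (y - x₀) ^ 2 - Q * (y - x₀))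
        (g' y + P * (y - x₀) - Q) y := by
      intro y hy
      have h1 := ((hasDerivAt_id y).sub_const x₀)
      refine (((hg y (hsub hy)).add ((h1.pow 2).const_mul (P / 2))).sub
        (h1.const_mul Q)).congr_deriv ?_
      simp; ring
    obtain ⟨y, hy, hy'⟩ := exists_hasDerivAt_eq_slope _ _ h
      (fun y hy => (hd y hy).continuousAt.continuousWithinAt)
      (fun y hy => hd y (Ioo_subset_Icc_self hy))
    have h2 := hr y (hsub (Ioo_subset_Icc_self hy)) hy.1.le
    have h3 : 0 < x - x₀ := by linarith
    rw [eq_div_iff h3.ne'] at hy'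
    have h4 : (g' y + P * (y - x₀) - Q) * (x - x₀) ≤ 0 :=
      mul_nonpos_of_nonpos_of_nonneg (by linarith) h3.le
    rw [hy', h0] at h4
    rw [abs_of_pos (by linarith)]
    simp only [sub_self] at h4
    linarith

/-! ### Regularity of the phase derivatives and decay from the imaginary part of the root -/

namespace LocalBounds
open SymbolRing MvPolynomial

variable {N : ℕ} {V : ℝ → ℂ} {α β x₀ T η K ρ A x : ℝ}

theorem hasDerivAt_root_pow_mul_eval (h : LocalBounds N V α β x₀ T η K ρ A)
    (hx : x ∈ Ioo (x₀ - 2 * (η / T)) (x₀ + 2 * (η / T))) {a b : ℕ} (k : ℕ) {p : SymbolRing}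
    (hp : p ∈ weightRange a b) (hb : b ≤ N + 1) :
    HasDerivAt (fun y => root V ⟨α, β⟩ y ^ k * eval (fun i => coord (N + 3) V ⟨α, β⟩ i y) p)
      (root V ⟨α, β⟩ x ^ (k + 1)
        * eval (fun i => coord (N + 3) V ⟨α, β⟩ i x) (derivTwist k p)) x :=
  SymbolRing.hasDerivAt_root_pow_mul_eval (m := N + 1) (by omega) (by omega) (h.slitPlane hx)
    (fun i hi => h.hasDerivAt i (by omega) x hx) hp hb

theorem ae_hasDerivAt_root_pow_mul_eval (h : LocalBounds N V α β x₀ T η K ρ A) {a b : ℕ} (k : ℕ)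
    {p : SymbolRing} (hp : p ∈ weightRange a b) (hb : b ≤ N + 2) :
    ∀ᵐ x, x ∈ Ioo (x₀ - 2 * (η / T)) (x₀ + 2 * (η / T)) →
    HasDerivAt (fun y => root V ⟨α, β⟩ y ^ k * eval (fun i => coord (N + 3) V ⟨α, β⟩ i y) p)
      (root V ⟨α, β⟩ x ^ (k + 1)
        * eval (fun i => coord (N + 3) V ⟨α, β⟩ i x) (derivTwist k p)) x := by
  filter_upwards [h.ae_hasDerivAt] with x hae hx
  refine SymbolRing.hasDerivAt_root_pow_mul_eval (m := N + 2) (by omega) (by omega)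
    (h.slitPlane hx) (fun i hi => ?_) hp hb
  rcases hi.lt_or_eq with hi | rfl
  · exact h.hasDerivAt i hi x hx
  · exact hae hx

theorem hasDerivAt_zero (h : LocalBounds N V α β x₀ T η K ρ A)
    (hx : x ∈ Ioo (x₀ - 2 * (η / T)) (x₀ + 2 * (η / T))) :
    HasDerivAt V (iteratedDeriv 1 V x) x := by
  simpa using h.hasDerivAt 0 (by omega) x hx

theorem ac_pow {f : ℝ → ℂ} {a b : ℝ} (hf : AbsolutelyContinuousOnInterval f a b) (n : ℕ) :
    AbsolutelyContinuousOnInterval (fun x => f x ^ n) a b := by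
  induction n with
  | zero => simpa using absolutelyContinuousOnInterval_const 1 a b
  | succ n ih => exact (ih.smul hf).congr fun x _ => by simp [pow_succ]

/-- Since `z = μ⁴`, the `i`-th variable is `V⁽ⁱ⁺¹⁾ (μ⁻¹)ⁱ⁺⁵`, a product of absolutely continuous
functions as long as `i + 1 ≤ N + 2`. -/
theorem ac_root_pow_mul_eval (h : LocalBounds N V α β x₀ T η K ρ A) {p q : ℝ} (hp0 : 0 < p)
    (hpq : p ≤ q) (hJ : Icc p q ⊆ Ioo (x₀ - 2 * (η / T)) (x₀ + 2 * (η / T))) {a b : ℕ} (k : ℕ)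
    {P : SymbolRing} (hP : P ∈ weightRange a b) (hb : b ≤ N + 2) :
    AbsolutelyContinuousOnInterval
      (fun y => root V ⟨α, β⟩ y ^ k * eval (fun i => coord (N + 3) V ⟨α, β⟩ i y) P) p q := by
  have hroot : ∀ x ∈ Icc p q, HasDerivAt (root V ⟨α, β⟩)
      (-(1 / 4) * root V ⟨α, β⟩ x ^ 2 * coord (N + 3) V ⟨α, β⟩ 0 x) x := fun x hx =>
    hasDerivAt_root (by omega) (h.slitPlane (hJ hx)) (h.hasDerivAt_zero (hJ hx))
  have hcoord : ContinuousOn (coord (N + 3) V ⟨α, β⟩ 0) (Icc p q) := fun x hx =>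
    (hasDerivAt_coord (by omega) (h.slitPlane (hJ hx)) (h.hasDerivAt_zero (hJ hx))
      (h.hasDerivAt 1 (by omega) x (hJ hx))).continuousAt.continuousWithinAt
  have hrc : ContinuousOn (root V ⟨α, β⟩) (Icc p q) := fun x hx =>
    (hroot x hx).continuousAt.continuousWithinAt
  have hr0 : ∀ x ∈ Icc p q, root V ⟨α, β⟩ x ≠ 0 := fun x hx =>
    norm_pos_iff.1 (h.root_pos (hJ hx))
  have hrac : AbsolutelyContinuousOnInterval (root V ⟨α, β⟩) p q :=
    absolutelyContinuousOnInterval_of_hasDerivAt hpq hroot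
      ((continuousOn_const.mul (hrc.pow 2)).mul hcoord)
  have hriac : AbsolutelyContinuousOnInterval (fun x => (root V ⟨α, β⟩ x)⁻¹) p q := by
    refine absolutelyContinuousOnInterval_of_hasDerivAt
      (f' := fun x => 1 / 4 * coord (N + 3) V ⟨α, β⟩ 0 x) hpq (fun x hx => ?_)
      (continuousOn_const.mul hcoord)
    refine ((hroot x hx).inv (hr0 x hx)).congr_deriv ?_
    have := hr0 x hx
    field_simp
  have hVac : ∀ i ≤ N + 2, AbsolutelyContinuousOnInterval (iteratedDeriv i V) p q := by
    intro i hi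
    rcases hi.lt_or_eq with hi | rfl
    · refine absolutelyContinuousOnInterval_of_hasDerivAt hpq
        (fun x hx => h.hasDerivAt i hi x (hJ hx)) ?_
      rcases (show i + 1 ≤ N + 2 from hi).lt_or_eq with hi' | hi'
      · exact fun x hx => (h.hasDerivAt (i + 1) hi' x (hJ hx)).continuousAt.continuousWithinAt
      · rw [hi']
        simpa [uIcc_of_le hpq] using (h.ac p q hp0 hpq).continuousOn
    · exact h.ac p q hp0 hpq
  refine (ac_pow hrac k).smul (absolutelyContinuousOnInterval_eval (M := N + 2) ?_ hP hb)
  intro i hi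
  refine ((hVac (i + 1) (by omega)).smul (ac_pow hriac (i + 5))).congr ?_
  intro x _
  simp only [coord, if_pos (show i < N + 3 by omega), Pi.smul_apply', smul_eq_mul]
  rw [← root_pow_four, ← pow_add, div_eq_mul_inv, inv_pow, show 4 + (i + 1) = i + 5 by omega]

theorem root_cube_le (h : LocalBounds N V α β x₀ T η K ρ A)
    (hx : x ∈ Ioo (x₀ - 2 * (η / T)) (x₀ + 2 * (η / T))) :
    ‖root V ⟨α, β⟩ x‖ ^ 3 ≤ 2 * K ^ 2 * (|α| ^ (3 / 4 : ℝ) + β ^ (3 / 4 : ℝ)) := by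
  have hm := h.root_pos hx
  have hα := h.alpha_pos
  have hβ : 0 ≤ β := zero_le_one.trans h.one_le_beta
  have hK2 : 1 ≤ 2 * K ^ 2 := by nlinarith [one_le_pow₀ h.one_le (n := 2)]
  have h4 : ‖root V ⟨α, β⟩ x‖ ^ 4 ≤ 2 * K ^ 2 * (|α| + β) := by
    rw [norm_root_pow_four]; exact h.norm_le hx
  calc ‖root V ⟨α, β⟩ x‖ ^ 3 = (‖root V ⟨α, β⟩ x‖ ^ 4) ^ (3 / 4 : ℝ) := by
        rw [← Real.rpow_natCast, ← Real.rpow_natCast, ← Real.rpow_mul hm.le]; norm_num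
    _ ≤ (2 * K ^ 2 * (|α| + β)) ^ (3 / 4 : ℝ) := Real.rpow_le_rpow (by positivity) h4 (by norm_num)
    _ = (2 * K ^ 2) ^ (3 / 4 : ℝ) * (|α| + β) ^ (3 / 4 : ℝ) :=
        Real.mul_rpow (by positivity) (by positivity)
    _ ≤ 2 * K ^ 2 * (|α| ^ (3 / 4 : ℝ) + β ^ (3 / 4 : ℝ)) := by
        gcongr
        · calc (2 * K ^ 2) ^ (3 / 4 : ℝ) ≤ (2 * K ^ 2) ^ (1 : ℝ) :=
              Real.rpow_le_rpow_of_exponent_le hK2 (by norm_num)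
            _ = _ := Real.rpow_one _
        · exact Real.rpow_add_le_add_rpow hα.le hβ (by norm_num) (by norm_num)

/-- To the right of the turning point `Im z = β - Im V` is at most `-A (x - x₀) / K`. Dividing by `4
|μ|³ ≤ 8 K² (|α|^{3/4} + β^{3/4})` gives the slope of `Im μ`. The left side is symmetric. -/
theorem im_root_le (h : LocalBounds N V α β x₀ T η K ρ A)
    (hx : x ∈ Ioo (x₀ - 2 * (η / T)) (x₀ + 2 * (η / T))) (hxx : x₀ ≤ x) :
    (root V ⟨α, β⟩ x).im ≤
      -(A / (8 * K ^ 3 * (|α| ^ (3 / 4 : ℝ) + β ^ (3 / 4 : ℝ))) * (x - x₀)) := by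
  have hα := h.alpha_pos
  have hβ : 0 ≤ β := zero_le_one.trans h.one_le_beta
  have hK := h.K_pos
  have hD : 0 < |α| ^ (3 / 4 : ℝ) + β ^ (3 / 4 : ℝ) :=
    add_pos_of_pos_of_nonneg (Real.rpow_pos_of_pos hα _) (Real.rpow_nonneg hβ _)
  have hm := h.root_pos hx
  have hsl := h.slope_right x hx hxx
  have hA : 0 ≤ A * (x - x₀) := mul_nonneg h.slope_pos.le (by linarith)
  have hzim : ((⟨α, β⟩ : ℂ) - V x).im = β - (V x).im := by simp
  have hz : ((⟨α, β⟩ : ℂ) - V x).im ≤ 0 := by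
    rw [hzim]
    by_contra hn
    nlinarith [mul_pos hK (not_le.1 hn)]
  have h1 := (Complex.im_le_of_pow_four (h.re_pos hx)).2 hz
  change 4 * ‖root V ⟨α, β⟩ x‖ ^ 3 * (root V ⟨α, β⟩ x).im ≤ _ at h1
  have hcube := h.root_cube_le hx
  have him : (root V ⟨α, β⟩ x).im ≤ 0 := by
    by_contra hn
    have := mul_pos (show 0 < 4 * ‖root V ⟨α, β⟩ x‖ ^ 3 by positivity) (not_le.1 hn)
    linarith
  rw [div_mul_eq_mul_div, le_neg, div_le_iff₀ (by positivity)]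
  have h2 := mul_le_mul_of_nonneg_left hcube (neg_nonneg.2 him)
  have h3 := mul_le_mul_of_nonneg_left h1 hK.le
  have h4 := mul_le_mul_of_nonneg_left h2 hK.le
  rw [hzim] at h3
  nlinarith

theorem le_im_root (h : LocalBounds N V α β x₀ T η K ρ A)
    (hx : x ∈ Ioo (x₀ - 2 * (η / T)) (x₀ + 2 * (η / T))) (hxx : x ≤ x₀) :
    A / (8 * K ^ 3 * (|α| ^ (3 / 4 : ℝ) + β ^ (3 / 4 : ℝ))) * (x₀ - x)
      ≤ (root V ⟨α, β⟩ x).im := by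
  have hα := h.alpha_pos
  have hβ : 0 ≤ β := zero_le_one.trans h.one_le_beta
  have hK := h.K_pos
  have hD : 0 < |α| ^ (3 / 4 : ℝ) + β ^ (3 / 4 : ℝ) :=
    add_pos_of_pos_of_nonneg (Real.rpow_pos_of_pos hα _) (Real.rpow_nonneg hβ _)
  have hm := h.root_pos hx
  have hsl := h.slope_left x hx hxx
  have hA : 0 ≤ A * (x₀ - x) := mul_nonneg h.slope_pos.le (by linarith)
  have hzim : ((⟨α, β⟩ : ℂ) - V x).im = β - (V x).im := by simp
  have hz : 0 ≤ ((⟨α, β⟩ : ℂ) - V x).im := by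
    rw [hzim]
    by_contra hn
    nlinarith [mul_pos hK (neg_pos.2 (not_le.1 hn))]
  have h1 := (Complex.im_le_of_pow_four (h.re_pos hx)).1 hz
  change _ ≤ 4 * ‖root V ⟨α, β⟩ x‖ ^ 3 * (root V ⟨α, β⟩ x).im at h1
  have hcube := h.root_cube_le hx
  have him : 0 ≤ (root V ⟨α, β⟩ x).im := by
    by_contra hn
    have := mul_pos (show 0 < 4 * ‖root V ⟨α, β⟩ x‖ ^ 3 by positivity) (neg_pos.2 (not_le.1 hn))
    linarith
  rw [div_mul_eq_mul_div, div_le_iff₀ (by positivity)]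
  have h2 := mul_le_mul_of_nonneg_left hcube him
  have h3 := mul_le_mul_of_nonneg_left h1 hK.le
  have h4 := mul_le_mul_of_nonneg_left h2 hK.le
  rw [hzim] at h3
  nlinarith

end LocalBounds

/-- Collects the factors of the cutoff error into one power of `q`: four powers from `Δ⁻⁴`, one from
the jet bound `a`, one from the length of the interval and one from the length of the interval
carrying the lower bound. -/
theorem quasimode_constant_le {η T q Ex C L M a : ℝ} (hη : 0 < η) (hT : 0 < T) (hM : 0 ≤ M)
    (hC : 0 ≤ C) (hEx : 0 ≤ Ex) (hTq : T ≤ q) (hTq' : T⁻¹ ≤ q) (hq : 1 ≤ q) (ha0 : 0 ≤ a) (ha : a ≤ q) :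
    M * ((1 + ((η / T) ^ 4)⁻¹) * (C * a * Ex) * (4 * (η / T)) ^ (1 / 2 : ℝ)
      / (Real.exp (-L) * (min η 1 / q) ^ (1 / 2 : ℝ)))
    ≤ M * (1 + (η ^ 4)⁻¹) * C * (1 + 4 * η) * (Real.exp L / min η 1) * (q ^ 7 * Ex) := by
  have hq0 : 0 < q := by linarith
  have hmin : 0 < min η 1 := lt_min hη one_pos
  have h1 : 1 + ((η / T) ^ 4)⁻¹ ≤ (1 + (η ^ 4)⁻¹) * q ^ 4 := by
    rw [div_pow, inv_div, div_eq_mul_inv]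
    have h2 : 1 ≤ q ^ 4 := one_le_pow₀ hq
    have h3 : T ^ 4 ≤ q ^ 4 := by gcongr
    have h4 : 0 ≤ (η ^ 4)⁻¹ := by positivity
    nlinarith [mul_le_mul_of_nonneg_right h3 h4]
  have h2 : (4 * (η / T)) ^ (1 / 2 : ℝ) ≤ (1 + 4 * η) * q := by
    have h3 : 0 ≤ 4 * (η / T) := by positivity
    calc (4 * (η / T)) ^ (1 / 2 : ℝ) ≤ (1 + 4 * (η / T)) ^ (1 / 2 : ℝ) := by
          gcongr; linarith
      _ ≤ (1 + 4 * (η / T)) ^ (1 : ℝ) :=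
          Real.rpow_le_rpow_of_exponent_le (by linarith) (by norm_num)
      _ = 1 + 4 * η * T⁻¹ := by rw [Real.rpow_one]; ring
      _ ≤ q + 4 * η * q := by gcongr
      _ = _ := by ring
  have h3 : min η 1 / q ≤ (min η 1 / q) ^ (1 / 2 : ℝ) := by
    have hle : min η 1 / q ≤ 1 := (div_le_one hq0).2 ((min_le_right _ _).trans hq)
    calc min η 1 / q = (min η 1 / q) ^ (1 : ℝ) := (Real.rpow_one _).symm
      _ ≤ _ := Real.rpow_le_rpow_of_exponent_ge (by positivity) hle (by norm_num)
  have h4 : 0 < min η 1 / q := by positivity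
  calc M * ((1 + ((η / T) ^ 4)⁻¹) * (C * a * Ex) * (4 * (η / T)) ^ (1 / 2 : ℝ)
      / (Real.exp (-L) * (min η 1 / q) ^ (1 / 2 : ℝ)))
      ≤ M * (((1 + (η ^ 4)⁻¹) * q ^ 4) * (C * q * Ex) * ((1 + 4 * η) * q)
        / (Real.exp (-L) * (min η 1 / q))) := by
        gcongr
    _ = _ := by
        rw [Real.exp_neg]
        field_simp

/-! ### The quasimode at a fixed spectral parameter -/

namespace LocalBounds
open SymbolRing MvPolynomial

-- The function `exp S` with `S' = μ σ` is cut off around `x₀`. The WKB remainder gives the first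
-- error term. The second compares the size of the jet at distance at least `η / T` with a lower
-- bound for `exp S` just to the right of `x₀`.
set_option maxHeartbeats 1000000 in
theorem exists_quasimode (N : ℕ) (η K : ℝ) (hη : 0 < η) (hK : 1 ≤ K) :
    ∃ c > 0, ∃ C > 0, ∀ {V : ℝ → ℂ} {α β x₀ T ρ A : ℝ}, LocalBounds N V α β x₀ T η K ρ A →
      ∃ Ψ w : ℝ → ℂ, Function.support Ψ ⊆ Ioo (x₀ - 2 * (η / T)) (x₀ + 2 * (η / T)) ∧
        tsupport Ψ ⊆ Ioi 0 ∧ 0 < l2Norm Ψ ∧ IsMaximalBiharmonic V Ψ w ∧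
        l2Norm (fun x => w x - (⟨α, β⟩ : ℂ) * Ψ x) / l2Norm Ψ ≤
          C * powerSum N T ρ α β + C * ((1 + |α| + β + T + T⁻¹) ^ 7 *
            Real.exp (-c * (A * (T ^ 2)⁻¹ / (|α| ^ (3 / 4 : ℝ) + β ^ (3 / 4 : ℝ)))
              + C * (1 + β / |α|))) := by
  obtain ⟨σ, hσ1, hσ2⟩ := exists_wkb_symbol N
  have hK0 : 0 < K := one_pos.trans_le hK
  have hσ0 : σ ∈ weightRange 0 N := by
    have := Submodule.add_mem _ (weightRange_mono (Nat.zero_le 1) le_rfl hσ1)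
      ((IsWeight.const (-Complex.I)).mem (le_refl 0) (Nat.zero_le N))
    simpa using this
  have hσd1 := derivTwist_mem 1 hσ0
  have hσd2 := derivTwist_mem 2 hσd1
  obtain ⟨B0, hB0, hB0'⟩ := exists_norm_eval_le (N := N) K hK0.le hσ0 (by omega)
  obtain ⟨B1, hB1, hB1'⟩ := exists_norm_eval_le (N := N) K hK0.le hσd1 (by omega)
  obtain ⟨B2, hB2, hB2'⟩ := exists_norm_eval_le (N := N) K hK0.le hσd2 (by omega)
  obtain ⟨C1, hC1, hC1'⟩ := exists_norm_root_mul_eval_le K hK0.le hσ1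
  obtain ⟨C2, hC2, hC2'⟩ := exists_ae_remainder_le K hK hσ2
  obtain ⟨M, hM, hcut⟩ := exists_cutoff_quasimode
  set C0 := B0 + B1 + B2 with hC0
  have hC0one : 1 ≤ C0 := by linarith
  have hC0pos : 0 < C0 := by linarith
  set L := 2 * C0 * K ^ 2 with hL
  set C3 := M * (1 + (η ^ 4)⁻¹) * (10 * C0 ^ 3 * K ^ 2) * (1 + 4 * η)
    * (Real.exp L / min η 1) with hC3
  have hmin : 0 < min η 1 := lt_min hη one_pos
  have hC3pos : 0 < C3 := by positivity
  -- The Gaussian exponent `P (x - x₀)² / 2` at `|x - x₀| = η / T`, with `P = A / (8 K³ D)`, equals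
  -- this constant times `A T⁻² / D`. The summand `2 η C1` is `Q` integrated over the half-width `2
  -- η / T`.
  refine ⟨η ^ 2 / (16 * K ^ 3), by positivity, C2 + C3 + 2 * η * C1, by positivity, ?_⟩
  intro V α β x₀ T ρ A h
  have hT := h.T_pos
  have hα := h.alpha_pos
  have hβ : 0 ≤ β := zero_le_one.trans h.one_le_beta
  have hρ := h.rho_nonneg
  have hΔ := h.width_pos
  set l : ℂ := ⟨α, β⟩ with hl
  set J := Ioo (x₀ - 2 * (η / T)) (x₀ + 2 * (η / T)) with hJ
  set D := |α| ^ (3 / 4 : ℝ) + β ^ (3 / 4 : ℝ) with hD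
  have hDpos : 0 < D :=
    add_pos_of_pos_of_nonneg (Real.rpow_pos_of_pos hα _) (Real.rpow_nonneg hβ _)
  have hx₀J : x₀ ∈ J := ⟨by linarith, by linarith⟩
  -- the derivatives of the phase
  set s : ℕ → ℝ → ℂ := fun n x => match n with
    | 0 => root V l x ^ 1 * eval (fun i => coord (N + 3) V l i x) σ
    | 1 => root V l x ^ 2 * eval (fun i => coord (N + 3) V l i x) (derivTwist 1 σ)
    | 2 => root V l x ^ 3 * eval (fun i => coord (N + 3) V l i x)
        (derivTwist 2 (derivTwist 1 σ))
    | _ => root V l x ^ 4 * eval (fun i => coord (N + 3) V l i x)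
        (derivTwist 3 (derivTwist 2 (derivTwist 1 σ))) with hs
  have hsd0 : ∀ x ∈ J, HasDerivAt (s 0) (s 1 x) x := fun x hx => by
    have := h.hasDerivAt_root_pow_mul_eval hx 1 hσ0 (by omega)
    rw [Nat.cast_one] at this
    exact this
  have hsd1 : ∀ x ∈ J, HasDerivAt (s 1) (s 2 x) x := fun x hx => by
    have := h.hasDerivAt_root_pow_mul_eval hx 2 hσd1 (by omega)
    rw [Nat.cast_ofNat] at this
    exact this
  -- Two derivatives of a symbol of weight up to `N` use up `V⁽ᴺ⁺²⁾`, so the third holds only almost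
  -- everywhere.
  have hsd2 : ∀ᵐ x, x ∈ J → HasDerivAt (s 2) (s 3 x) x := by
    have := h.ae_hasDerivAt_root_pow_mul_eval 3 hσd2 (by omega)
    simp only [Nat.cast_ofNat] at this
    exact this
  have hscont : ContinuousOn (s 0) J := fun x hx =>
    (hsd0 x hx).continuousAt.continuousWithinAt
  obtain ⟨S, hS0, hSd⟩ := exists_primitive_on_Ioo hscont hx₀J
  have hsbound : ∀ x ∈ J, ∀ i < 3, ‖s i x‖ ≤ C0 * ‖root V l x‖ ^ (i + 1) := by
    intro x hx i hi
    have hr := (norm_nonneg (root V l x))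
    have key : ∀ (n : ℕ) (z : ℂ) (B : ℝ), ‖z‖ ≤ B → B ≤ C0 →
        ‖root V l x ^ n * z‖ ≤ C0 * ‖root V l x‖ ^ n := by
      intro n z B hz hB
      rw [norm_mul, norm_pow, mul_comm]
      gcongr
      exact hz.trans hB
    interval_cases i
    · exact key 1 _ B0 (hB0' h hx) (by linarith)
    · exact key 2 _ B1 (hB1' h hx) (by linarith)
    · exact key 3 _ B2 (hB2' h hx) (by linarith)
  set q := 1 + |α| + β + T + T⁻¹ with hq
  have hTi : 0 < T⁻¹ := inv_pos.2 hT
  have hq1 : 1 ≤ q := by linarith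
  have hTq : T ≤ q := by linarith
  have hTq' : T⁻¹ ≤ q := by linarith
  have hroot4 : ∀ x ∈ J, 1 + ‖root V l x‖ ^ 4 ≤ 2 * K ^ 2 * (1 + |α| + β) := by
    intro x hx
    rw [norm_root_pow_four]
    have h1 := h.norm_le hx
    have h2 : 1 ≤ K ^ 2 := one_le_pow₀ hK
    linarith
  -- decay of the solution
  set P := A / (8 * K ^ 3 * D) with hP
  set Q := C1 * (T * (1 + β / |α|)) with hQ
  -- The leading symbol `-i` contributes `Re (-i μ) = Im μ`; everything else has positive weight.
  have hlow : ∀ x ∈ J, |(s 0 x).re - (root V l x).im| ≤ Q := by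
    intro x hx
    have e1 : s 0 x = root V l x * (-Complex.I)
        + root V l x * eval (fun i => coord (N + 3) V l i x) (σ - C (-Complex.I)) := by
      simp only [hs, map_sub, eval_C]; ring
    have e2 : (s 0 x).re - (root V l x).im = (root V l x
        * eval (fun i => coord (N + 3) V l i x) (σ - C (-Complex.I))).re := by
      rw [e1, Complex.add_re]; simp
    rw [e2]
    exact (Complex.abs_re_le_norm _).trans (hC1' h hx)
  have hre : ∀ x ∈ J, (S x).re ≤ -(P / 2 * (x - x₀) ^ 2) + Q * |x - x₀| := by
    intro x hx
    refine le_of_hasDerivAt_le_linear (g := fun x => (S x).re) (g' := fun x => (s 0 x).re) hx₀J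
      (by simp [hS0]) (fun x hx => ?_) (fun x hx hxx => ?_) (fun x hx hxx => ?_) hx
    · exact Complex.reCLM.hasFDerivAt.comp_hasDerivAt x (hSd x hx)
    · have h1 := (abs_le.1 (hlow x hx)).2
      have h2 := h.im_root_le hx hxx
      linarith
    · have h1 := (abs_le.1 (hlow x hx)).1
      have h2 := h.le_im_root hx hxx
      linarith
  have hQ0 : 0 ≤ Q := by positivity
  have hP0 : 0 ≤ P := by have := h.slope_pos; positivity
  set Ex := Real.exp (-(η ^ 2 / (16 * K ^ 3)) * (A * (T ^ 2)⁻¹ / D)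
    + 2 * η * C1 * (1 + β / |α|)) with hEx
  have hexp : ∀ x ∈ J, η / T ≤ |x - x₀| → ‖Complex.exp (S x)‖ ≤ Ex := by
    intro x hx hxx
    rw [Complex.norm_exp, hEx, Real.exp_le_exp]
    refine (hre x hx).trans ?_
    have h1 : |x - x₀| ≤ 2 * (η / T) := by
      rw [abs_le]; constructor <;> linarith [hx.1, hx.2]
    have h2 : (η / T) ^ 2 ≤ (x - x₀) ^ 2 := by
      rw [← sq_abs (x - x₀)]
      exact pow_le_pow_left₀ hΔ.le hxx 2
    have h3 : P / 2 * (η / T) ^ 2 = η ^ 2 / (16 * K ^ 3) * (A * (T ^ 2)⁻¹ / D) := by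
      rw [hP]; field_simp; ring
    have h4 : Q * (2 * (η / T)) = 2 * η * C1 * (1 + β / |α|) := by
      rw [hQ]; field_simp
    have h5 := mul_le_mul_of_nonneg_left h2 (show 0 ≤ P / 2 by positivity)
    have h6 := mul_le_mul_of_nonneg_left h1 hQ0
    linarith
  -- lower bound near the turning point
  have hrpos : 0 < min η 1 / q := by positivity
  have hrle : min η 1 / q ≤ η / T :=
    div_le_div₀ hη.le (min_le_left _ _) hT hTq
  have hlower : ∀ x ∈ Icc x₀ (x₀ + min η 1 / q), Real.exp (-L) ≤ ‖Complex.exp (S x)‖ := by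
    intro x hx
    have hsub : Icc x₀ x ⊆ J := fun y hy => ⟨by linarith [hy.1], by linarith [hy.2, hx.2]⟩
    -- Here `|S'| ≤ L q` while the interval has length at most `1 / q`, so `|S| ≤ L` on it. The
    -- lower bound is thus independent of `λ`, and the short interval costs only a power of `q`.
    have hb : ∀ y ∈ Icc x₀ x, ‖s 0 y‖ ≤ L * q := by
      intro y hy
      have h1 := hsbound y (hsub hy) 0 (by norm_num)
      have h2 := hroot4 y (hsub hy)
      have h3 : ‖root V l y‖ ≤ 1 + ‖root V l y‖ ^ 4 := by
        rcases le_total ‖root V l y‖ 1 with h' | h'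
        · have : 0 ≤ ‖root V l y‖ ^ 4 := by positivity
          linarith
        · have := le_self_pow₀ h' (n := 4) (by norm_num)
          linarith
      rw [zero_add, pow_one] at h1
      calc ‖s 0 y‖ ≤ C0 * ‖root V l y‖ := h1
        _ ≤ C0 * (2 * K ^ 2 * (1 + |α| + β)) := by
            gcongr
            exact h3.trans h2
        _ ≤ C0 * (2 * K ^ 2 * q) := by
            gcongr
            linarith
        _ = _ := by rw [hL]; ring
    have h1 := Convex.norm_image_sub_le_of_norm_hasDerivWithin_le (s := Icc x₀ x)
      (fun y hy => (hSd y (hsub hy)).hasDerivWithinAt) hb (convex_Icc x₀ x)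
      (left_mem_Icc.2 hx.1) (right_mem_Icc.2 hx.1)
    rw [hS0, sub_zero, Real.norm_of_nonneg (by linarith [hx.1])] at h1
    have h2 : ‖S x‖ ≤ L := by
      have hL0 : 0 ≤ L := by positivity
      calc ‖S x‖ ≤ L * q * (x - x₀) := h1
        _ ≤ L * q * (min η 1 / q) := by
            gcongr
            linarith [hx.2]
        _ = L * min η 1 := by field_simp
        _ ≤ L * 1 := by gcongr; exact min_le_right _ _
        _ = L := mul_one L
    rw [Complex.norm_exp, Real.exp_le_exp]
    have := (abs_le.1 ((Complex.abs_re_le_norm (S x)).trans h2)).1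
    linarith
  set u := expJet S s with hu
  have hud : ∀ i < 3, ∀ x ∈ J, HasDerivAt (u i) (u (i + 1) x) x := by
    intro i hi x hx
    refine hasDerivAt_expJet (hSd x hx) (by omega) fun j hj => ?_
    have : j = 0 ∨ j = 1 := by omega
    rcases this with rfl | rfl
    · exact hsd0 x hx
    · exact hsd1 x hx
  have hud3 : ∀ᵐ x, x ∈ J → HasDerivAt (u 3) (u 4 x) x := by
    filter_upwards [hsd2] with x h2 hx
    refine hasDerivAt_expJet (hSd x hx) (by omega) fun j hj => ?_
    interval_cases j
    · exact hsd0 x hx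
    · exact hsd1 x hx
    · exact h2 hx
  have hp0 : 0 < x₀ - 7 / 4 * (η / T) := by linarith [h.left_pos]
  have hpq : x₀ - 7 / 4 * (η / T) ≤ x₀ + 7 / 4 * (η / T) := by linarith
  have hIJ : Icc (x₀ - 7 / 4 * (η / T)) (x₀ + 7 / 4 * (η / T)) ⊆ J := fun x hx =>
    ⟨by linarith [hx.1], by linarith [hx.2]⟩
  have hac : AbsolutelyContinuousOnInterval (u 3) (x₀ - 7 / 4 * (η / T))
      (x₀ + 7 / 4 * (η / T)) := by
    have a0 := h.ac_root_pow_mul_eval hp0 hpq hIJ 1 hσ0 (by omega)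
    have a1 := h.ac_root_pow_mul_eval hp0 hpq hIJ 2 hσd1 (by omega)
    have a2 := h.ac_root_pow_mul_eval hp0 hpq hIJ 3 hσd2 (by omega)
    have aS : AbsolutelyContinuousOnInterval (fun x => Complex.exp (S x))
        (x₀ - 7 / 4 * (η / T)) (x₀ + 7 / 4 * (η / T)) :=
      absolutelyContinuousOnInterval_of_hasDerivAt hpq (fun x hx => (hSd x (hIJ hx)).cexp)
        (fun x hx => ((hSd x (hIJ hx)).cexp.continuousAt.mul
          (hsd0 x (hIJ hx)).continuousAt).continuousWithinAt)
    exact (((a2.add ((a0.smul a1).const_smul (3 : ℂ))).add (ac_pow a0 3)).smul aS).congr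
      fun x _ => rfl
  have hVc : ContinuousOn V J := fun x hx =>
    (h.hasDerivAt_zero hx).continuousAt.continuousWithinAt
  have hPS : 0 ≤ powerSum N T ρ α β :=
    Finset.sum_nonneg fun d _ => Finset.sum_nonneg fun j _ => by positivity
  have hres : ∀ᵐ x, x ∈ J →
      ‖u 4 x - (l - V x) * u 0 x‖ ≤ C2 * powerSum N T ρ α β * ‖u 0 x‖ := by
    filter_upwards [hC2' h] with x h2 hx
    -- With `z = μ⁴`, the expansion of `(exp S)''''` in `S', …, S''''` is `μ⁴` times the evaluated
    -- `eikonal`.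
    have e1 : u 4 x - (l - V x) * u 0 x
        = ((l - V x) * eval (fun i => coord (N + 3) V l i x) (eikonal σ - 1)) * u 0 x := by
      rw [← root_pow_four V l x]
      simp only [hu, expJet, hs, eikonal, map_sub, map_add, map_mul, map_pow, map_one, map_ofNat]
      ring
    rw [e1, norm_mul]
    gcongr
    exact h2 hx
  have hG : ∀ i ≤ 3, ∀ x ∈ J, η / T ≤ |x - x₀| →
      ‖u i x‖ ≤ 10 * C0 ^ 3 * K ^ 2 * (1 + |α| + β) * Ex := by
    intro i hi x hx hxx
    refine (norm_expJet_le hC0one (norm_nonneg (root V l x)) (hsbound x hx) hi).trans ?_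
    calc 5 * C0 ^ 3 * (1 + ‖root V l x‖ ^ 4) * ‖Complex.exp (S x)‖
        ≤ 5 * C0 ^ 3 * (2 * K ^ 2 * (1 + |α| + β)) * Ex := by
          gcongr
          · exact hroot4 x hx
          · exact hexp x hx hxx
      _ = _ := by ring
  obtain ⟨Ψ, w, h1, h2, h3, h4, h5⟩ := hcut V l x₀ (η / T) (C2 * powerSum N T ρ α β)
    (10 * C0 ^ 3 * K ^ 2 * (1 + |α| + β) * Ex) (Real.exp (-L)) (min η 1 / q) u hΔ h.left_pos
    (mul_nonneg hC2 hPS) (Real.exp_pos _) hrpos hrle hVc hud hac hud3 hres hG hlower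
  refine ⟨Ψ, w, h1, h2, h3, h4, h5.trans ?_⟩
  have h6 := quasimode_constant_le (L := L) (C := 10 * C0 ^ 3 * K ^ 2) (Ex := Ex)
    (a := 1 + |α| + β) hη hT hM.le (by positivity) (Real.exp_pos _).le hTq hTq' hq1
    (by positivity) (by linarith)
  refine add_le_add ?_ (h6.trans ?_)
  · refine mul_le_mul_of_nonneg_right ?_ hPS
    have : 0 ≤ 2 * η * C1 := by positivity
    linarith
  · refine mul_le_mul ?_ ?_ (by positivity) (by positivity)
    · have : 0 ≤ 2 * η * C1 := by positivity
      linarith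
    · refine mul_le_mul_of_nonneg_left ?_ (by positivity)
      rw [hEx, Real.exp_le_exp]
      have hB : 0 ≤ 1 + β / |α| := by positivity
      have : 2 * η * C1 * (1 + β / |α|) ≤ (C2 + C3 + 2 * η * C1) * (1 + β / |α|) := by
        refine mul_le_mul_of_nonneg_right ?_ hB
        linarith
      linarith

end LocalBounds

/-! ### Absorbing polynomial factors and lower order phases -/

/-- For `T ≥ 1` the bound `T^{4+ε} ≤ C₁ β` trades `T^{-f}` for `β^{-f/(4+ε)}`, up to a constant. For
`T ≤ 1` the negative power of `T` helps directly. The quantity `β (1 + T⁻¹)` is, up to a factor two,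
the size that matters in either regime. -/
theorem exists_rpow_mul_rpow_lower {ε C₁ e f δ : ℝ} (hε : 0 < ε) (hC₁ : 1 ≤ C₁) (hδ : 0 < δ)
    (hf : δ ≤ f) (he : δ ≤ e - f / (4 + ε)) :
    ∃ c > 0, ∀ β T : ℝ, 1 ≤ β → 0 < T → T ^ (4 + ε) ≤ C₁ * β →
      c * (β * (1 + T⁻¹)) ^ δ ≤ β ^ e * T ^ (-f) := by
  set g := f / (4 + ε) with hg
  have hf0 : 0 < f := hδ.trans_le hf
  have hg0 : 0 < g := by positivity
  have hC0 : 0 < C₁ := by linarith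
  refine ⟨C₁ ^ (-g) * 2⁻¹ ^ δ, by positivity, fun β T hβ hT hTβ => ?_⟩
  have hβ0 : 0 < β := by linarith
  have hTi : 0 < T⁻¹ := inv_pos.2 hT
  have hfac : C₁ ^ (-g) * 2⁻¹ ^ δ * (β * (1 + T⁻¹)) ^ δ
      = C₁ ^ (-g) * (2⁻¹ * (β * (1 + T⁻¹))) ^ δ := by
    rw [Real.mul_rpow (x := (2⁻¹ : ℝ)) (by norm_num) (by positivity)]; ring
  rw [hfac]
  rcases le_total 1 T with h | h
  · have h1 : 2⁻¹ * (β * (1 + T⁻¹)) ≤ β := by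
      have : T⁻¹ ≤ 1 := inv_le_one_of_one_le₀ h
      nlinarith
    have h2 : T ^ f ≤ (C₁ * β) ^ g := by
      calc T ^ f = (T ^ (4 + ε)) ^ g := by
            rw [← Real.rpow_mul hT.le, hg]; congr 1; field_simp
        _ ≤ _ := Real.rpow_le_rpow (by positivity) hTβ hg0.le
    have h3 : (C₁ * β) ^ (-g) ≤ T ^ (-f) := by
      rw [Real.rpow_neg (by positivity), Real.rpow_neg hT.le]
      exact inv_anti₀ (by positivity) h2
    calc C₁ ^ (-g) * (2⁻¹ * (β * (1 + T⁻¹))) ^ δ ≤ C₁ ^ (-g) * β ^ (e - g) := by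
          gcongr
          calc (2⁻¹ * (β * (1 + T⁻¹))) ^ δ ≤ β ^ δ :=
                Real.rpow_le_rpow (by positivity) h1 hδ.le
            _ ≤ β ^ (e - g) := Real.rpow_le_rpow_of_exponent_le hβ he
      _ = β ^ e * (C₁ * β) ^ (-g) := by
          rw [Real.mul_rpow hC0.le hβ0.le, sub_eq_add_neg, Real.rpow_add hβ0]; ring
      _ ≤ _ := by gcongr
  · have hTi1 : 1 ≤ T⁻¹ := (one_le_inv₀ hT).2 h
    have h1 : 2⁻¹ * (β * (1 + T⁻¹)) ≤ β * T⁻¹ := by nlinarith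
    have h2 : C₁ ^ (-g) ≤ 1 := by
      rw [Real.rpow_neg hC0.le]
      exact inv_le_one_of_one_le₀ (Real.one_le_rpow hC₁ hg0.le)
    have hee : δ ≤ e := by linarith
    calc C₁ ^ (-g) * (2⁻¹ * (β * (1 + T⁻¹))) ^ δ ≤ 1 * (β * T⁻¹) ^ δ := by
          gcongr
      _ = β ^ δ * T⁻¹ ^ δ := by rw [one_mul, Real.mul_rpow hβ0.le hTi.le]
      _ ≤ β ^ e * T⁻¹ ^ f := by
          gcongr
      _ = _ := by rw [Real.inv_rpow hT.le, Real.rpow_neg hT.le]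

theorem exists_pow_mul_exp_le {k δ : ℝ} (hk : 0 < k) (hδ : 0 < δ) (m : ℕ) :
    ∃ C > 0, ∀ Q : ℝ, 1 ≤ Q → Q ^ m * Real.exp (-(k * Q ^ δ)) ≤ C := by
  obtain ⟨n, hn⟩ := exists_nat_ge ((m : ℝ) / δ)
  refine ⟨n.factorial / k ^ n, by positivity, fun Q hQ => ?_⟩
  have hQ0 : 0 < Q := by linarith
  have h1 : Q ^ m ≤ (Q ^ δ) ^ n := by
    rw [← Real.rpow_natCast, ← Real.rpow_natCast, ← Real.rpow_mul hQ0.le]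
    refine Real.rpow_le_rpow_of_exponent_le hQ ?_
    rw [div_le_iff₀ hδ] at hn
    linarith
  have h2 := Real.pow_div_factorial_le_exp (k * Q ^ δ) (by positivity) n
  rw [Real.exp_neg]
  have h3 : 0 < Real.exp (k * Q ^ δ) := Real.exp_pos _
  rw [← div_eq_mul_inv, div_le_div_iff₀ h3 (by positivity)]
  rw [div_le_iff₀ (by positivity), mul_pow] at h2
  calc Q ^ m * k ^ n ≤ (Q ^ δ) ^ n * k ^ n := by gcongr
    _ ≤ _ := by linarith

/-- The decay exponent dominates `Q ^ δ (1 + β / a)`. -/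
theorem exists_exponent_lower {ε t₁ t₂ K C₁ C₂ : ℝ} (hε : 0 < ε)
    (ht₁ : t₁ ∈ Icc 0 (ε / (20 * (3 + ε)))) (ht₂ : t₂ ∈ Icc 0 (ε / (20 * (3 + ε))))
    (ht : t₁ - 1 / (4 + ε) * t₂ < ε / (20 * (4 + ε))) (hK : 0 < K) (hC₁ : 1 ≤ C₁)
    (hC₂ : 0 < C₂) :
    ∃ c > (0 : ℝ), ∃ δ > (0 : ℝ), ∀ β a T A : ℝ, 1 ≤ β → 0 < T → 0 < a → T ^ (4 + ε) ≤ C₁ * β →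
      β ^ (1 - t₁) * T ^ (1 + t₂) ≤ C₂ * A → K⁻¹ * (β * T) ^ ((4 : ℝ) / 5) ≤ a →
      a ≤ K * (β / T) ^ ((4 + ε) / (3 + ε)) →
      c * ((β * (1 + T⁻¹)) ^ δ * (1 + β / a)) ≤
        A * (T ^ 2)⁻¹ / (a ^ (3 / 4 : ℝ) + β ^ (3 / 4 : ℝ)) := by
  obtain ⟨ht₁0, ht₁⟩ := ht₁
  obtain ⟨ht₂0, ht₂⟩ := ht₂
  -- Chosen so that `(3/4) (4 + ε)/(3 + ε) = 1 - δ₀`: the upper bound on `a` reads `a^{3/4} ≲ (β /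
  -- T)^{1 - δ₀}`, and `t₁, t₂ ≤ δ₀ / 5`.
  set δ₀ := ε / (4 * (3 + ε)) with hδ₀
  have hδ₀pos : 0 < δ₀ := by positivity
  have hδ₀' : ε / (20 * (3 + ε)) = δ₀ / 5 := by rw [hδ₀]; field_simp; norm_num
  rw [hδ₀'] at ht₁ ht₂
  have hδ₀le : δ₀ ≤ 1 / 4 := by
    rw [hδ₀, div_le_div_iff₀ (by positivity) (by norm_num)]; linarith
  set δ₁ := ε / (20 * (4 + ε)) - (t₁ - 1 / (4 + ε) * t₂) with hδ₁
  have hδ₁pos : 0 < δ₁ := by linarith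
  set δ := min (δ₀ / 2) (min δ₁ (3 / 20)) with hδ
  have hδpos : 0 < δ := lt_min (by positivity) (lt_min hδ₁pos (by norm_num))
  have hδ1 : δ ≤ δ₀ / 2 := min_le_left _ _
  have hδ2 : δ ≤ δ₁ := (min_le_right _ _).trans (min_le_left _ _)
  have hδ3 : δ ≤ 3 / 20 := (min_le_right _ _).trans (min_le_right _ _)
  -- These exponents belong to the regime `β ≤ a`, where `β^{1-t₁} T^{-(1-t₂)}` is divided by `(β /
  -- T)^{1-δ₀}` and `1 + β/a ≤ 2`. Both exponent conditions hold with `δ₀ / 2` to spare for `t₁` and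
  -- `t₂`.
  obtain ⟨c₁, hc₁, h₁⟩ := exists_rpow_mul_rpow_lower (e := δ₀ - t₁) (f := δ₀ - t₂) hε hC₁ hδpos
    (by linarith) (by
      have : (δ₀ - t₂) / (4 + ε) ≤ δ₀ / 4 :=
        div_le_div₀ hδ₀pos.le (by linarith) (by norm_num) (by linarith)
      linarith)
  -- The regime `a ≤ β`: dividing by `β^{3/4}` and by `1 + β/a ≲ β^{1/5} T^{-4/5}` leaves
  -- `β^{1/20-t₁} T^{-(1/5-t₂)}`. After trading `T` for `β` the exponent is exactly `δ₁`, positive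
  -- by the strict inequality between `t₁` and `t₂`.
  obtain ⟨c₂, hc₂, h₂⟩ := exists_rpow_mul_rpow_lower (e := 1 / 20 - t₁) (f := 1 / 5 - t₂) hε hC₁
    hδpos (by linarith) (by
      have : 1 / 20 - t₁ - (1 / 5 - t₂) / (4 + ε) = δ₁ := by
        rw [hδ₁]; field_simp; ring
      linarith)
  have hK34 : 0 < K ^ (3 / 4 : ℝ) := by positivity
  refine ⟨min (c₁ / (4 * C₂ * K ^ (3 / 4 : ℝ))) (c₂ / (4 * C₂ * K)), by positivity, δ, hδpos, ?_⟩
  intro β a T A hβ hT ha hTβ hA hal hau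
  have hβ0 : 0 < β := by linarith
  set Q := β * (1 + T⁻¹) with hQ
  have hTi : 0 < T⁻¹ := inv_pos.2 hT
  have hQ0 : 0 < Q := by positivity
  have hQδ : 0 < Q ^ δ := Real.rpow_pos_of_pos hQ0 δ
  have hA' : β ^ (1 - t₁) * T ^ (-(1 - t₂)) / C₂ ≤ A * (T ^ 2)⁻¹ := by
    rw [div_le_iff₀ hC₂]
    have e1 : T ^ (-(1 - t₂)) = T ^ (1 + t₂) * (T ^ 2)⁻¹ := by
      rw [← Real.rpow_natCast, ← Real.rpow_neg hT.le, ← Real.rpow_add hT]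
      congr 1; push_cast; ring
    rw [e1, ← mul_assoc]
    calc β ^ (1 - t₁) * T ^ (1 + t₂) * (T ^ 2)⁻¹ ≤ C₂ * A * (T ^ 2)⁻¹ := by gcongr
      _ = _ := by ring
  have hA0 : 0 ≤ A * (T ^ 2)⁻¹ := le_trans (by positivity) hA'
  have hD : 0 < a ^ (3 / 4 : ℝ) + β ^ (3 / 4 : ℝ) := by positivity
  rcases le_total β a with hab | hab
  · -- the case `β ≤ a`
    have hD' : a ^ (3 / 4 : ℝ) + β ^ (3 / 4 : ℝ) ≤
        2 * K ^ (3 / 4 : ℝ) * (β ^ (1 - δ₀) * T ^ (-(1 - δ₀))) := by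
      have h3 : β ^ (3 / 4 : ℝ) ≤ a ^ (3 / 4 : ℝ) :=
        Real.rpow_le_rpow hβ0.le hab (by norm_num)
      have h4 : a ^ (3 / 4 : ℝ) ≤ K ^ (3 / 4 : ℝ) * (β ^ (1 - δ₀) * T ^ (-(1 - δ₀))) := by
        calc a ^ (3 / 4 : ℝ) ≤ (K * (β / T) ^ ((4 + ε) / (3 + ε))) ^ (3 / 4 : ℝ) :=
              Real.rpow_le_rpow ha.le hau (by norm_num)
          _ = K ^ (3 / 4 : ℝ) * (β / T) ^ (1 - δ₀) := by
              rw [Real.mul_rpow hK.le (by positivity), ← Real.rpow_mul (by positivity)]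
              congr 2
              rw [hδ₀]; field_simp; ring
          _ = _ := by
              rw [Real.div_rpow hβ0.le hT.le, Real.rpow_neg hT.le,
                div_eq_mul_inv (β ^ (1 - δ₀))]
      linarith
    have hB : 1 + β / a ≤ 2 := by
      have := (div_le_one ha).2 hab
      linarith
    have h5 := h₁ β T hβ hT hTβ
    rw [le_div_iff₀ hD]
    calc min (c₁ / (4 * C₂ * K ^ (3 / 4 : ℝ))) (c₂ / (4 * C₂ * K)) * (Q ^ δ * (1 + β / a))
          * (a ^ (3 / 4 : ℝ) + β ^ (3 / 4 : ℝ))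
        ≤ c₁ / (4 * C₂ * K ^ (3 / 4 : ℝ)) * (Q ^ δ * 2)
          * (2 * K ^ (3 / 4 : ℝ) * (β ^ (1 - δ₀) * T ^ (-(1 - δ₀)))) := by
          gcongr
          exact min_le_left _ _
      _ = c₁ * Q ^ δ * (β ^ (1 - δ₀) * T ^ (-(1 - δ₀))) / C₂ := by field_simp; norm_num
      _ ≤ β ^ (δ₀ - t₁) * T ^ (-(δ₀ - t₂)) * (β ^ (1 - δ₀) * T ^ (-(1 - δ₀))) / C₂ := by gcongr
      _ = β ^ (1 - t₁) * T ^ (-(1 - t₂)) / C₂ := by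
          congr 1
          rw [mul_mul_mul_comm, ← Real.rpow_add hβ0, ← Real.rpow_add hT]
          congr 2 <;> ring
      _ ≤ _ := hA'
  · -- the case `a ≤ β`
    have hD' : a ^ (3 / 4 : ℝ) + β ^ (3 / 4 : ℝ) ≤ 2 * β ^ (3 / 4 : ℝ) := by
      have h3 : a ^ (3 / 4 : ℝ) ≤ β ^ (3 / 4 : ℝ) :=
        Real.rpow_le_rpow ha.le hab (by norm_num)
      linarith
    have hB : 1 + β / a ≤ 2 * K * (β ^ (1 / 5 : ℝ) * T ^ (-(4 / 5) : ℝ)) := by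
      have h3 : 1 ≤ β / a := (one_le_div ha).2 hab
      have h4 : β / a ≤ K * (β ^ (1 / 5 : ℝ) * T ^ (-(4 / 5) : ℝ)) := by
        rw [div_le_iff₀ ha]
        have e1 : β = K * (β ^ (1 / 5 : ℝ) * T ^ (-(4 / 5) : ℝ))
            * (K⁻¹ * (β * T) ^ ((4 : ℝ) / 5)) := by
          rw [Real.mul_rpow hβ0.le hT.le]
          have e2 : T ^ (-(4 / 5) : ℝ) * T ^ ((4 : ℝ) / 5) = 1 := by
            rw [← Real.rpow_add hT]; norm_num
          have e3 : β ^ (1 / 5 : ℝ) * β ^ ((4 : ℝ) / 5) = β := by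
            rw [← Real.rpow_add hβ0]; norm_num
          calc β = (β ^ (1 / 5 : ℝ) * β ^ ((4 : ℝ) / 5))
                * (T ^ (-(4 / 5) : ℝ) * T ^ ((4 : ℝ) / 5)) * (K * K⁻¹) := by
                rw [e2, e3, mul_inv_cancel₀ hK.ne']; ring
            _ = _ := by ring
        calc β = _ := e1
          _ ≤ _ := by gcongr
      linarith
    have h5 := h₂ β T hβ hT hTβ
    rw [le_div_iff₀ hD]
    calc min (c₁ / (4 * C₂ * K ^ (3 / 4 : ℝ))) (c₂ / (4 * C₂ * K)) * (Q ^ δ * (1 + β / a))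
          * (a ^ (3 / 4 : ℝ) + β ^ (3 / 4 : ℝ))
        ≤ c₂ / (4 * C₂ * K) * (Q ^ δ * (2 * K * (β ^ (1 / 5 : ℝ) * T ^ (-(4 / 5) : ℝ))))
          * (2 * β ^ (3 / 4 : ℝ)) := by
          gcongr
          exact min_le_right _ _
      _ = c₂ * Q ^ δ * (β ^ (1 / 5 : ℝ) * T ^ (-(4 / 5) : ℝ) * β ^ (3 / 4 : ℝ)) / C₂ := by
          field_simp; norm_num
      _ ≤ β ^ (1 / 20 - t₁) * T ^ (-(1 / 5 - t₂))
          * (β ^ (1 / 5 : ℝ) * T ^ (-(4 / 5) : ℝ) * β ^ (3 / 4 : ℝ)) / C₂ := by gcongr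
      _ = β ^ (1 - t₁) * T ^ (-(1 - t₂)) / C₂ := by
          congr 1
          rw [show β ^ (1 / 20 - t₁) * T ^ (-(1 / 5 - t₂))
              * (β ^ (1 / 5 : ℝ) * T ^ (-(4 / 5) : ℝ) * β ^ (3 / 4 : ℝ))
            = β ^ (1 / 20 - t₁) * β ^ (1 / 5 : ℝ) * β ^ (3 / 4 : ℝ)
              * (T ^ (-(1 / 5 - t₂)) * T ^ (-(4 / 5) : ℝ)) by ring,
            ← Real.rpow_add hβ0, ← Real.rpow_add hβ0, ← Real.rpow_add hT]
          congr 2 <;> ring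
      _ ≤ _ := hA'

-- The decay exponent `c X` is split: one quarter absorbs `C (1 + β/a)` once `β` is large, one
-- quarter beats the polynomial factor because `X ≥ k Q^δ`, and one half is kept.
set_option maxHeartbeats 1000000 in
theorem exists_absorb {ε t₁ t₂ K C₁ C₂ c C : ℝ} (hε : 0 < ε)
    (ht₁ : t₁ ∈ Icc 0 (ε / (20 * (3 + ε)))) (ht₂ : t₂ ∈ Icc 0 (ε / (20 * (3 + ε))))
    (ht : t₁ - 1 / (4 + ε) * t₂ < ε / (20 * (4 + ε))) (hK : 0 < K) (hC₁ : 1 ≤ C₁)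
    (hC₂ : 0 < C₂) (hc : 0 < c) (hC : 0 < C) :
    ∃ C' > 0, ∃ β₀ ≥ 1, ∀ β a T A : ℝ, β₀ ≤ β → 0 < T → 0 < a → T ^ (4 + ε) ≤ C₁ * β →
      β ^ (1 - t₁) * T ^ (1 + t₂) ≤ C₂ * A → K⁻¹ * (β * T) ^ ((4 : ℝ) / 5) ≤ a →
      a ≤ K * (β / T) ^ ((4 + ε) / (3 + ε)) →
      (1 + a + β + T + T⁻¹) ^ 7 * Real.exp (-c * (A * (T ^ 2)⁻¹ /
        (a ^ (3 / 4 : ℝ) + β ^ (3 / 4 : ℝ))) + C * (1 + β / a)) ≤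
      C' * Real.exp (-(c / 2) * (A * (T ^ 2)⁻¹ / (a ^ (3 / 4 : ℝ) + β ^ (3 / 4 : ℝ)))) := by
  obtain ⟨k, hk, δ, hδ, hX⟩ := exists_exponent_lower hε ht₁ ht₂ ht hK hC₁ hC₂
  obtain ⟨C₃, hC₃, hexp⟩ := exists_pow_mul_exp_le (k := c / 4 * k) (by positivity) hδ 14
  -- Each summand of `1 + a + β + T + T⁻¹` is at most a multiple of `Q²`, with multiples `1, K, 1,
  -- C₁, 1`. The square suffices for `a` because `(4 + ε)/(3 + ε) ≤ 2`, and the seventh power then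
  -- becomes `Q¹⁴`.
  set m := 3 + K + C₁ with hm
  refine ⟨m ^ 7 * C₃, by positivity, max 1 ((4 * C / (c * k)) ^ δ⁻¹), le_max_left _ _, ?_⟩
  intro β a T A hβ₀ hT ha hTβ hA hal hau
  have hβ : 1 ≤ β := (le_max_left _ _).trans hβ₀
  have hβ0 : 0 < β := by linarith
  have hX' := hX β a T A hβ hT ha hTβ hA hal hau
  set X := A * (T ^ 2)⁻¹ / (a ^ (3 / 4 : ℝ) + β ^ (3 / 4 : ℝ)) with hXdef
  set Q := β * (1 + T⁻¹) with hQ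
  have hTi : 0 < T⁻¹ := inv_pos.2 hT
  have hβQ : β ≤ Q := by rw [hQ]; nlinarith
  have hQ1 : 1 ≤ Q := hβ.trans hβQ
  have hB : 1 ≤ 1 + β / a := by have : 0 ≤ β / a := by positivity
                                linarith
  have hQδ : 4 * C / (c * k) ≤ Q ^ δ := by
    have h1 : (4 * C / (c * k)) ^ δ⁻¹ ≤ Q := ((le_max_right _ _).trans hβ₀).trans hβQ
    calc 4 * C / (c * k) = ((4 * C / (c * k)) ^ δ⁻¹) ^ δ := by
          rw [← Real.rpow_mul (by positivity), inv_mul_cancel₀ hδ.ne', Real.rpow_one]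
      _ ≤ Q ^ δ := Real.rpow_le_rpow (by positivity) h1 hδ.le
  have hCB : C * (1 + β / a) ≤ c / 4 * X := by
    calc C * (1 + β / a) = c / 4 * (k * ((4 * C / (c * k)) * (1 + β / a))) := by
          field_simp
      _ ≤ c / 4 * (k * (Q ^ δ * (1 + β / a))) := by gcongr
      _ ≤ c / 4 * X := by gcongr
  have hXQ : k * Q ^ δ ≤ X := by
    refine le_trans ?_ hX'
    have : 0 ≤ Q ^ δ := by positivity
    nlinarith [mul_nonneg hk.le this]
  have hq : 1 + a + β + T + T⁻¹ ≤ m * Q ^ 2 := by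
    have hQ2 : Q ≤ Q ^ 2 := by nlinarith
    have h1 : a ≤ K * Q ^ 2 := by
      refine hau.trans (mul_le_mul_of_nonneg_left ?_ hK.le)
      have h2 : β / T ≤ Q := by rw [hQ, div_eq_mul_inv]; nlinarith
      calc (β / T) ^ ((4 + ε) / (3 + ε)) ≤ Q ^ ((4 + ε) / (3 + ε)) :=
            Real.rpow_le_rpow (by positivity) h2 (by positivity)
        _ ≤ Q ^ (2 : ℝ) := by
            refine Real.rpow_le_rpow_of_exponent_le hQ1 ?_
            rw [div_le_iff₀ (by positivity)]; linarith
        _ = Q ^ 2 := by norm_cast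
    have h2 : T ≤ C₁ * Q ^ 2 := by
      rcases le_total T 1 with h | h
      · nlinarith
      · calc T = T ^ (1 : ℝ) := (Real.rpow_one T).symm
          _ ≤ T ^ (4 + ε) := Real.rpow_le_rpow_of_exponent_le h (by linarith)
          _ ≤ C₁ * β := hTβ
          _ ≤ C₁ * Q ^ 2 := mul_le_mul_of_nonneg_left (hβQ.trans hQ2) (by linarith)
    have h3 : T⁻¹ ≤ Q ^ 2 := by
      have : T⁻¹ ≤ Q := by rw [hQ]; nlinarith
      linarith
    calc 1 + a + β + T + T⁻¹ ≤ Q ^ 2 + K * Q ^ 2 + Q ^ 2 + C₁ * Q ^ 2 + Q ^ 2 := by linarith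
      _ = m * Q ^ 2 := by rw [hm]; ring
  have hexpo : -c * X + C * (1 + β / a) ≤ -(c / 2) * X + -(c / 4 * k * Q ^ δ) := by
    have := mul_le_mul_of_nonneg_left hXQ (show 0 ≤ c / 4 by positivity)
    linarith
  calc (1 + a + β + T + T⁻¹) ^ 7 * Real.exp (-c * X + C * (1 + β / a))
      ≤ (m * Q ^ 2) ^ 7 * Real.exp (-(c / 2) * X + -(c / 4 * k * Q ^ δ)) := by
        gcongr
    _ = m ^ 7 * (Q ^ 14 * Real.exp (-(c / 4 * k * Q ^ δ))) * Real.exp (-(c / 2) * X) := by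
        rw [Real.exp_add]; ring
    _ ≤ m ^ 7 * C₃ * Real.exp (-(c / 2) * X) := by
        gcongr
        exact hexp Q hQ1

/-! ### Uniform bounds near infinity -/

/-- A positive function with bounded logarithmic derivative varies at most exponentially. -/
theorem le_exp_mul_of_abs_deriv_le {f f' : ℝ → ℝ} {a b L : ℝ}
    (hf : ∀ x ∈ Ioo a b, HasDerivAt f (f' x) x) (hpos : ∀ x ∈ Ioo a b, 0 < f x)
    (hb : ∀ x ∈ Ioo a b, |f' x| ≤ L * f x) {x y : ℝ} (hx : x ∈ Ioo a b) (hy : y ∈ Ioo a b) :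
    f x ≤ Real.exp (L * |x - y|) * f y := by
  have h := (convex_Ioo a b).norm_image_sub_le_of_norm_hasDerivWithin_le
    (f := fun t => Real.log (f t)) (f' := fun t => f' t / f t) (C := L)
    (fun t ht => ((hf t ht).log (hpos t ht).ne').hasDerivWithinAt)
    (fun t ht => by
      rw [Real.norm_eq_abs, abs_div, abs_of_pos (hpos t ht), div_le_iff₀ (hpos t ht)]
      exact hb t ht) hy hx
  rw [Real.norm_eq_abs, Real.norm_eq_abs] at h
  have h1 := (le_abs_self _).trans h
  rw [← Real.exp_log (hpos x hx), ← Real.exp_log (hpos y hy), ← Real.exp_add]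
  exact Real.exp_le_exp.2 (by simpa using by linarith)

/-- A pointwise inequality between continuous functions follows from the almost everywhere one. -/
theorem le_of_ae_le_of_continuousOn {f g : ℝ → ℝ} {U : Set ℝ} (hU : IsOpen U)
    (hf : ContinuousOn f U) (hg : ContinuousOn g U) (h : ∀ᵐ x : ℝ, x ∈ U → f x ≤ g x) :
    ∀ x ∈ U, f x ≤ g x := by
  have he : (fun x => max (f x) (g x)) =ᵐ[volume.restrict U] g := by
    rw [EventuallyEq, ae_restrict_iff' hU.measurableSet]
    filter_upwards [h] with x hx hxU
    exact max_eq_right (hx hxU)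
  intro x hx
  exact max_eq_right_iff.1 (Measure.eqOn_open_of_ae_eq he hU (hf.sup hg) hg hx)

/-- The quantitative content of `PotentialAssumption` on `(R, ∞)`, with a single constant. -/
structure PotentialBounds (N : ℕ) (V : ℝ → ℂ) (τ : ℝ → ℝ) (ν ε t₁ t₂ η B R : ℝ) : Prop where
  one_le : 1 ≤ B
  one_le_start : 1 ≤ R
  nu_ge : -1 ≤ ν
  tau_pos : ∀ x > R, 0 < τ x
  hasDerivAt : ∀ i < N + 2, ∀ x > 0, HasDerivAt (iteratedDeriv i V) (iteratedDeriv (i + 1) V x) x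
  ae_hasDerivAt : ∀ᵐ x : ℝ, 0 < x →
    HasDerivAt (iteratedDeriv (N + 2) V) (iteratedDeriv (N + 3) V x) x
  ac : ∀ a b : ℝ, 0 < a → a ≤ b → AbsolutelyContinuousOnInterval (iteratedDeriv (N + 2) V) a b
  bound : ∀ i ∈ Finset.Icc 1 (N + 2), ∀ x > R,
    ‖iteratedDeriv i V x‖ ≤ B * (τ x ^ i * ‖V x‖)
  ae_bound : ∀ᵐ x : ℝ, R < x → ‖iteratedDeriv (N + 3) V x‖ ≤ B * (τ x ^ (N + 3) * ‖V x‖)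
  tau_differentiable : ∀ x > R, DifferentiableAt ℝ τ x
  tau_deriv : ∀ x > R, |deriv τ x| ≤ B * (x ^ ν * τ x)
  tau_le : ∀ x > R, τ x ^ (4 + ε) ≤ B * (V x).im
  one_le_im : ∀ x > R, 1 ≤ (V x).im
  im_deriv_lower : ∀ x > R,
    (V x).im ^ (1 - t₁) * τ x ^ (1 + t₂) ≤ B * (iteratedDeriv 1 V x).im
  im_deriv_two : ∀ x > R,
    |(iteratedDeriv 2 V x).im| ≤ B * ((iteratedDeriv 1 V x).im * τ x)
  eta_le : ∀ x > R, η / τ x ≤ x ^ (-ν) / 4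

/-- Up to order `N + 2` the derivatives are continuous for positive `x`, so the almost everywhere
bounds hold everywhere; only the top order keeps the exceptional set. -/
theorem PotentialAssumption.exists_deriv_bound {N : ℕ} {V : ℝ → ℂ} {τ : ℝ → ℝ} {ν ε t₁ t₂ : ℝ}
    (hV : PotentialAssumption N V τ ν ε t₁ t₂) :
    ∃ B R : ℝ, 0 ≤ B ∧ 1 ≤ R ∧
      (∀ i ∈ Finset.Icc 1 (N + 2), ∀ x > R, ‖iteratedDeriv i V x‖ ≤ B * (τ x ^ i * ‖V x‖)) ∧
      ∀ᵐ x : ℝ, R < x → ‖iteratedDeriv (N + 3) V x‖ ≤ B * (τ x ^ (N + 3) * ‖V x‖) := by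
  obtain ⟨hd, -, hac⟩ := MemSobolevLoc.regularity (M := N + 2) hV.sobolev hV.continuousOn
  choose! C R h using hV.deriv_bound
  have hB : ∀ i ∈ Finset.Icc 1 (N + 3), C i ≤ ∑ n ∈ Finset.Icc 1 (N + 3), |C n| := fun i hi =>
    (le_abs_self _).trans
      (Finset.single_le_sum (f := fun n => |C n|) (fun n _ => abs_nonneg _) hi)
  have hR : ∀ i ∈ Finset.Icc 1 (N + 3), R i ≤ 1 + ∑ n ∈ Finset.Icc 1 (N + 3), |R n| := fun i hi =>
    (le_abs_self _).trans ((Finset.single_le_sum (f := fun n => |R n|)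
      (fun n _ => abs_nonneg _) hi).trans (by linarith))
  set B := ∑ n ∈ Finset.Icc 1 (N + 3), |C n|
  have hR1 : (1 : ℝ) ≤ 1 + ∑ n ∈ Finset.Icc 1 (N + 3), |R n| := by
    have : 0 ≤ ∑ n ∈ Finset.Icc 1 (N + 3), |R n| := Finset.sum_nonneg fun n _ => abs_nonneg _
    linarith
  set R' := 1 + ∑ n ∈ Finset.Icc 1 (N + 3), |R n|
  have hae : ∀ i ∈ Finset.Icc 1 (N + 3), ∀ᵐ x : ℝ, R' < x →
      ‖iteratedDeriv i V x‖ ≤ B * (τ x ^ i * ‖V x‖) := fun i hi => by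
    filter_upwards [h i hi] with x hx hxR
    have ht := hV.tau_pos x (by linarith)
    exact (hx ((hR i hi).trans hxR.le)).trans
      (mul_le_mul_of_nonneg_right (hB i hi) (by positivity))
  refine ⟨B, R', Finset.sum_nonneg fun n _ => abs_nonneg _, hR1, fun i hi => ?_,
    hae _ (Finset.mem_Icc.2 ⟨by omega, le_rfl⟩)⟩
  rw [Finset.mem_Icc] at hi
  have hsub : Ioi R' ⊆ Ici (0 : ℝ) := fun x hx => by
    rw [mem_Ioi] at hx; rw [mem_Ici]; linarith
  have hcont : ContinuousOn (iteratedDeriv i V) (Ioi R') := by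
    intro x hx
    have hx0 : 0 < x := by rw [mem_Ioi] at hx; linarith
    rcases lt_or_eq_of_le hi.2 with hlt | rfl
    · exact (hd i hlt x hx0).continuousAt.continuousWithinAt
    · have := (hac (x / 2) (2 * x) (by positivity) (by linarith)).continuousOn
      rw [uIcc_of_le (by linarith)] at this
      exact (this.continuousAt (Icc_mem_nhds (by linarith) (by linarith))).continuousWithinAt
  refine le_of_ae_le_of_continuousOn isOpen_Ioi hcont.norm ?_
    (hae i (Finset.mem_Icc.2 ⟨hi.1, by omega⟩))
  exact continuousOn_const.mul (((hV.tau_continuousOn.mono hsub).pow i).mul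
    (hV.continuousOn.mono hsub).norm)

theorem PotentialAssumption.exists_potentialBounds {N : ℕ} {V : ℝ → ℂ} {τ : ℝ → ℝ}
    {ν ε t₁ t₂ η : ℝ} (hV : PotentialAssumption N V τ ν ε t₁ t₂)
    (hητ : ∀ᶠ x : ℝ in atTop, η / τ x ≤ x ^ (-ν) / 4) :
    ∃ B R : ℝ, PotentialBounds N V τ ν ε t₁ t₂ η B R := by
  obtain ⟨hd, had, hac⟩ := MemSobolevLoc.regularity (M := N + 2) hV.sobolev hV.continuousOn
  obtain ⟨B₁, R₁, hB₁, hR₁, hb, hab⟩ := hV.exists_deriv_bound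
  obtain ⟨B₂, hB₂, h₂⟩ := hV.tau_deriv.exists_pos
  obtain ⟨B₃, hB₃, h₃⟩ := hV.re_im_bound.exists_pos
  obtain ⟨B₄, hB₄, h₄⟩ := hV.im_deriv_lower
  obtain ⟨B₅, hB₅, h₅⟩ := hV.im_deriv_two
  have hε := hV.eps_pos
  obtain ⟨R₂, hR₂⟩ := eventually_atTop.1 (hV.tau_differentiable.and (h₂.bound.and (h₃.bound.and
    (h₄.and (h₅.and (hητ.and (hV.im_tendsto.eventually_ge_atTop 1)))))))
  have htp : ∀ x > max R₁ R₂, 0 < τ x := fun x hx =>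
    hV.tau_pos x (by have := (le_max_left R₁ R₂).trans_lt hx; linarith)
  have hE : ∀ x > max R₁ R₂, _ := fun x hx => hR₂ x ((le_max_right R₁ R₂).trans hx.le)
  have hlow : ∀ x > max R₁ R₂, 0 < (iteratedDeriv 1 V x).im := fun x hx => by
    obtain ⟨-, -, -, h4, -, -, h7⟩ := hE x hx
    have hx0 := htp x hx
    have h7' : 0 < (V x).im := by linarith
    have : 0 < (V x).im ^ (1 - t₁) * τ x ^ (1 + t₂) := by positivity
    exact (mul_pos_iff_of_pos_left hB₄).1 (this.trans_le h4)
  refine ⟨1 + B₁ + B₂ + B₃ + B₄ + B₅, max R₁ R₂, ?_, hR₁.trans (le_max_left _ _), hV.nu_ge, htp,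
    hd, had, hac, ?_, ?_, fun x hx => (hE x hx).1, ?_, ?_, fun x hx => (hE x hx).2.2.2.2.2.2,
    ?_, ?_, fun x hx => (hE x hx).2.2.2.2.2.1⟩
  · linarith
  · intro i hi x hx
    have := htp x hx
    exact (hb i hi x ((le_max_left _ _).trans_lt hx)).trans
      (mul_le_mul_of_nonneg_right (by linarith) (by positivity))
  · filter_upwards [hab] with x hx hxR
    have := htp x hxR
    exact (hx ((le_max_left _ _).trans_lt hxR)).trans
      (mul_le_mul_of_nonneg_right (by linarith) (by positivity))
  · intro x hx
    have ht := htp x hx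
    have hx0 : 0 < x := by have := (le_max_left R₁ R₂).trans_lt hx; linarith
    have h := (hE x hx).2.1
    have hp : 0 ≤ x ^ ν * τ x := by positivity
    rw [Real.norm_eq_abs, Real.norm_eq_abs, abs_of_nonneg hp] at h
    exact h.trans (mul_le_mul_of_nonneg_right (by linarith) hp)
  · intro x hx
    have ht := htp x hx
    obtain ⟨-, -, h, -, -, -, h7⟩ := hE x hx
    have him : 0 < (V x).im := by linarith
    rw [Real.norm_eq_abs, Real.norm_eq_abs, abs_of_nonneg (by positivity : 0 ≤ |(V x).im| ^ 4),
      abs_of_pos him] at h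
    have h' := (le_abs_self _).trans h
    have hre : 0 ≤ τ x ^ 4 * |(V x).re| ^ (3 + ε) := by positivity
    -- The first part of the growth condition is a fourth power on both sides, so it amounts to
    -- `τ^{4+ε} ≲ Im V`.
    have hpow : (τ x ^ (4 + ε)) ^ 4 = τ x ^ 4 * τ x ^ (12 + 4 * ε) := by
      rw [← Real.rpow_natCast (τ x) 4, ← Real.rpow_add ht, ← Real.rpow_natCast, ← Real.rpow_mul ht.le]
      congr 1; push_cast; ring
    refine le_of_pow_le_pow_left₀ (n := 4) (by norm_num) (by positivity) ?_
    calc (τ x ^ (4 + ε)) ^ 4 ≤ B₃ * (V x).im ^ 4 := by rw [hpow]; linarith [mul_add (τ x ^ 4) (τ x ^ (12 + 4 * ε)) (|(V x).re| ^ (3 + ε))]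
      _ ≤ (1 + B₁ + B₂ + B₃ + B₄ + B₅) ^ 4 * (V x).im ^ 4 := by
          gcongr
          calc B₃ ≤ 1 + B₁ + B₂ + B₃ + B₄ + B₅ := by linarith
            _ ≤ _ := le_self_pow₀ (by linarith) (by norm_num)
      _ = _ := by ring
  · intro x hx
    have := hlow x hx
    exact (hE x hx).2.2.2.1.trans (mul_le_mul_of_nonneg_right (by linarith) this.le)
  · intro x hx
    have := hlow x hx
    have ht := htp x hx
    exact (hE x hx).2.2.2.2.1.trans (mul_le_mul_of_nonneg_right (by linarith) (by positivity))

/-! ### Local bounds at a large turning point -/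

/-- Both summands follow from `(β T)^{4/5} ≤ K a`: first `T⁵ ≤ C₁ β T`, so `T` is at most a multiple
of `(β T)^{1/5}`, and second `T β ≤ (K a)^{5/4}`. -/
theorem mul_one_add_div_le_rpow {ε K C₁ β T a : ℝ} (hε : 0 < ε) (hK : 0 < K) (hC₁ : 1 ≤ C₁)
    (hβ : 1 ≤ β) (hT : 0 < T) (ha : 0 < a) (hTβ : T ^ (4 + ε) ≤ C₁ * β)
    (hal : K⁻¹ * (β * T) ^ ((4 : ℝ) / 5) ≤ a) :
    T * (1 + β / a) ≤
      (C₁ ^ (1 / 5 : ℝ) * K ^ (1 / 4 : ℝ) + K ^ (5 / 4 : ℝ)) * a ^ (1 / 4 : ℝ) := by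
  have hβ0 : 0 < β := by linarith
  have hC0 : 0 < C₁ := by linarith
  have hβT : (β * T) ^ ((4 : ℝ) / 5) ≤ K * a := by
    rwa [inv_mul_le_iff₀ hK] at hal
  have h1 : (β * T) ^ (1 / 5 : ℝ) ≤ K ^ (1 / 4 : ℝ) * a ^ (1 / 4 : ℝ) := by
    calc (β * T) ^ (1 / 5 : ℝ) = ((β * T) ^ ((4 : ℝ) / 5)) ^ (1 / 4 : ℝ) := by
          rw [← Real.rpow_mul (by positivity)]; norm_num
      _ ≤ (K * a) ^ (1 / 4 : ℝ) := Real.rpow_le_rpow (by positivity) hβT (by norm_num)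
      _ = _ := Real.mul_rpow hK.le ha.le
  have hT4 : T ^ (4 : ℝ) ≤ C₁ * β := by
    rcases le_total T 1 with h | h
    · exact (Real.rpow_le_one hT.le h (by norm_num)).trans (one_le_mul_of_one_le_of_one_le hC₁ hβ)
    · exact (Real.rpow_le_rpow_of_exponent_le h (by linarith)).trans hTβ
  have h2 : T ≤ C₁ ^ (1 / 5 : ℝ) * (β * T) ^ (1 / 5 : ℝ) := by
    calc T = (T ^ (4 : ℝ) * T) ^ (1 / 5 : ℝ) := by
          nth_rewrite 3 [← Real.rpow_one T]
          rw [← Real.rpow_add hT, ← Real.rpow_mul hT.le]; norm_num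
      _ ≤ (C₁ * (β * T)) ^ (1 / 5 : ℝ) := by
          refine Real.rpow_le_rpow (by positivity) ?_ (by norm_num)
          rw [← mul_assoc]; gcongr
      _ = _ := Real.mul_rpow hC0.le (by positivity)
  have h3 : T * (β / a) ≤ K ^ (5 / 4 : ℝ) * a ^ (1 / 4 : ℝ) := by
    rw [← mul_div_assoc, div_le_iff₀ ha, mul_assoc]
    have h4 : a ^ (1 / 4 : ℝ) * a = a ^ (5 / 4 : ℝ) := by
      rw [← Real.rpow_add_one ha.ne']; norm_num
    rw [h4, ← Real.mul_rpow hK.le ha.le]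
    calc T * β = ((β * T) ^ ((4 : ℝ) / 5)) ^ (5 / 4 : ℝ) := by
          rw [← Real.rpow_mul (by positivity)]; norm_num [mul_comm]
      _ ≤ _ := Real.rpow_le_rpow (by positivity) hβT (by norm_num)
  calc T * (1 + β / a) = T + T * (β / a) := by ring
    _ ≤ C₁ ^ (1 / 5 : ℝ) * (K ^ (1 / 4 : ℝ) * a ^ (1 / 4 : ℝ))
        + K ^ (5 / 4 : ℝ) * a ^ (1 / 4 : ℝ) :=
      add_le_add (h2.trans (mul_le_mul_of_nonneg_left h1 (by positivity))) h3
    _ = _ := by ring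

/-! ### Slow variation of the coefficients around the turning point -/

namespace PotentialBounds

variable {N : ℕ} {V : ℝ → ℂ} {τ : ℝ → ℝ} {ν ε t₁ t₂ η B R y x : ℝ}

theorem im_deriv_pos (h : PotentialBounds N V τ ν ε t₁ t₂ η B R) (hx : R < x) :
    0 < (iteratedDeriv 1 V x).im := by
  have h1 := h.one_le_im x hx
  have h2 := h.tau_pos x hx
  have h3 : 0 < (V x).im ^ (1 - t₁) * τ x ^ (1 + t₂) := by positivity
  exact (mul_pos_iff_of_pos_left (one_pos.trans_le h.one_le)).1
    (h3.trans_le (h.im_deriv_lower x hx))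

theorem hasDerivAt_im (h : PotentialBounds N V τ ν ε t₁ t₂ η B R) {i : ℕ} (hi : i < N + 2)
    (hx : 0 < x) :
    HasDerivAt (fun t => (iteratedDeriv i V t).im) (iteratedDeriv (i + 1) V x).im x :=
  Complex.imCLM.hasFDerivAt.comp_hasDerivAt x (h.hasDerivAt i hi x hx)

/-- The choice of `η` bounds the half-width by `y^{-ν} / 2`, and `ν ≥ -1` bounds that by `y / 2`. -/
theorem half_lt (h : PotentialBounds N V τ ν ε t₁ t₂ η B R) (hy : 2 * R < y)
    (hx : x ∈ Ioo (y - 2 * (η / τ y)) (y + 2 * (η / τ y))) : y / 2 < x ∧ x < 2 * y := by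
  have hR := h.one_le_start
  have h1 := h.eta_le y (by linarith)
  have h2 : y ^ (-ν) ≤ y := by
    calc y ^ (-ν) ≤ y ^ (1 : ℝ) :=
          Real.rpow_le_rpow_of_exponent_le (by linarith) (by linarith [h.nu_ge])
      _ = y := Real.rpow_one y
  exact ⟨by linarith [hx.1], by linarith [hx.2]⟩

theorem start_lt (h : PotentialBounds N V τ ν ε t₁ t₂ η B R) (hy : 2 * R < y)
    (hx : x ∈ Ioo (y - 2 * (η / τ y)) (y + 2 * (η / τ y))) : R < x := by
  linarith [(h.half_lt hy hx).1]

theorem pos_of_mem (h : PotentialBounds N V τ ν ε t₁ t₂ η B R) (hy : 2 * R < y)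
    (hx : x ∈ Ioo (y - 2 * (η / τ y)) (y + 2 * (η / τ y))) : 0 < x := by
  linarith [h.start_lt hy hx, h.one_le_start]

theorem self_mem (h : PotentialBounds N V τ ν ε t₁ t₂ η B R) (hη : 0 < η) (hy : 2 * R < y) :
    y ∈ Ioo (y - 2 * (η / τ y)) (y + 2 * (η / τ y)) := by
  have : 0 < η / τ y := div_pos hη (h.tau_pos y (by linarith [h.one_le_start]))
  exact ⟨by linarith, by linarith⟩

theorem rpow_le (h : PotentialBounds N V τ ν ε t₁ t₂ η B R) (hy : 2 * R < y)
    (hx : x ∈ Ioo (y - 2 * (η / τ y)) (y + 2 * (η / τ y))) : x ^ ν ≤ 2 ^ |ν| * y ^ ν := by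
  have hx0 := h.pos_of_mem hy hx
  obtain ⟨h1, h2⟩ := h.half_lt hy hx
  have hy0 : 0 < y := by linarith
  rcases le_total 0 ν with hν | hν
  · rw [abs_of_nonneg hν, ← Real.mul_rpow (by norm_num) hy0.le]
    exact Real.rpow_le_rpow hx0.le h2.le hν
  · rw [abs_of_nonpos hν]
    calc x ^ ν ≤ (y / 2) ^ ν := Real.rpow_le_rpow_of_nonpos (by positivity) h1.le hν
      _ = 2 ^ (-ν) * y ^ ν := by
          rw [Real.div_rpow hy0.le (by norm_num), Real.rpow_neg (by norm_num)]; field_simp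

/-- The control function at most multiplies by a constant across the interval. -/
theorem tau_le_mul (h : PotentialBounds N V τ ν ε t₁ t₂ η B R) (hη : 0 < η) (hy : 2 * R < y)
    (hx : x ∈ Ioo (y - 2 * (η / τ y)) (y + 2 * (η / τ y))) :
    τ x ≤ Real.exp (B * 2 ^ |ν|) * τ y := by
  have hB := h.one_le
  have hR := h.one_le_start
  have hy0 : 0 < y := by linarith
  have hτ := h.tau_pos y (by linarith)
  refine (le_exp_mul_of_abs_deriv_le (L := B * (2 ^ |ν| * y ^ ν))
    (fun t ht => (h.tau_differentiable t (h.start_lt hy ht)).hasDerivAt)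
    (fun t ht => h.tau_pos t (h.start_lt hy ht)) (fun t ht => ?_) hx
    (h.self_mem hη hy)).trans ?_
  · have := h.tau_pos t (h.start_lt hy ht)
    calc |deriv τ t| ≤ B * (t ^ ν * τ t) := h.tau_deriv t (h.start_lt hy ht)
      _ ≤ B * (2 ^ |ν| * y ^ ν * τ t) := by gcongr; exact h.rpow_le hy ht
      _ = _ := by ring
  · refine mul_le_mul_of_nonneg_right (Real.exp_le_exp.2 ?_) hτ.le
    -- The logarithmic derivative of `τ` is of order `y^ν` on the interval, which this distance
    -- exactly compensates.
    have h1 : |x - y| ≤ y ^ (-ν) := by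
      have h2 := h.eta_le y (by linarith)
      have h3 : 0 < y ^ (-ν) := by positivity
      rw [abs_le]
      exact ⟨by linarith [hx.1], by linarith [hx.2]⟩
    calc B * (2 ^ |ν| * y ^ ν) * |x - y| ≤ B * (2 ^ |ν| * y ^ ν) * y ^ (-ν) := by gcongr
      _ = B * 2 ^ |ν| * (y ^ ν * y ^ (-ν)) := by ring
      _ = B * 2 ^ |ν| := by rw [← Real.rpow_add hy0]; simp

/-- Apply the logarithmic derivative estimate to `‖V‖²`, which is differentiable and positive. Its
logarithmic derivative is at most a multiple of `τ y`, and the interval has length comparable to `η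
/ τ y`. -/
theorem norm_le_mul (h : PotentialBounds N V τ ν ε t₁ t₂ η B R) (hη : 0 < η) (hy : 2 * R < y)
    (hx : x ∈ Ioo (y - 2 * (η / τ y)) (y + 2 * (η / τ y))) :
    ‖V x‖ ≤ Real.exp (2 * B * Real.exp (B * 2 ^ |ν|) * η) * ‖V y‖ := by
  have hB := h.one_le
  have hτ := h.tau_pos y (by linarith [h.one_le_start])
  set E := Real.exp (B * 2 ^ |ν|) with hE
  have hE0 : 0 < E := Real.exp_pos _
  have key := le_exp_mul_of_abs_deriv_le (f := fun t => ‖V t‖ ^ 2) (L := 2 * B * E * τ y)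
    (fun t ht => by
      have := h.hasDerivAt 0 (by omega) t (h.pos_of_mem hy ht)
      rw [iteratedDeriv_zero] at this
      exact this.norm_sq)
    (fun t ht => by
      have h1 := h.one_le_im t (h.start_lt hy ht)
      have : 0 < ‖V t‖ := by linarith [Complex.abs_im_le_norm (V t), le_abs_self (V t).im]
      positivity)
    (fun t ht => by
      have h1 := h.bound 1 (Finset.mem_Icc.2 ⟨le_rfl, by omega⟩) t (h.start_lt hy ht)
      have h2 := h.tau_le_mul hη hy ht
      rw [pow_one] at h1
      rw [abs_mul, abs_two]
      calc 2 * |inner ℝ (V t) (iteratedDeriv (0 + 1) V t)|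
          ≤ 2 * (‖V t‖ * ‖iteratedDeriv 1 V t‖) := by
            gcongr; exact abs_real_inner_le_norm _ _
        _ ≤ 2 * (‖V t‖ * (B * ((E * τ y) * ‖V t‖))) := by
            gcongr
            exact h1.trans (by gcongr)
        _ = _ := by ring) hx (h.self_mem hη hy)
  have hxy : τ y * |x - y| ≤ 2 * η := by
    have h1 : |x - y| ≤ 2 * (η / τ y) := by
      rw [abs_le]; exact ⟨by linarith [hx.1], by linarith [hx.2]⟩
    calc τ y * |x - y| ≤ τ y * (2 * (η / τ y)) := by gcongr
      _ = 2 * η := by field_simp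
  refine le_of_pow_le_pow_left₀ (n := 2) (by norm_num) (by positivity) ?_
  calc ‖V x‖ ^ 2 ≤ _ := key
    _ ≤ Real.exp (2 * (2 * B * E * η)) * ‖V y‖ ^ 2 := by
        refine mul_le_mul_of_nonneg_right (Real.exp_le_exp.2 ?_) (by positivity)
        calc 2 * B * E * τ y * |x - y| = 2 * B * E * (τ y * |x - y|) := by ring
          _ ≤ 2 * B * E * (2 * η) := by gcongr
          _ = _ := by ring
    _ = _ := by rw [mul_pow, ← Real.exp_nat_mul]; norm_num

/-- The bound on `Im V''` is a logarithmic derivative bound for `Im V'`. Keeping the slope from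
degenerating is what makes the decay Gaussian on the whole interval. -/
theorem im_deriv_le_mul (h : PotentialBounds N V τ ν ε t₁ t₂ η B R) (hη : 0 < η)
    (hy : 2 * R < y) (hx : x ∈ Ioo (y - 2 * (η / τ y)) (y + 2 * (η / τ y))) :
    (iteratedDeriv 1 V y).im ≤
      Real.exp (2 * B * Real.exp (B * 2 ^ |ν|) * η) * (iteratedDeriv 1 V x).im := by
  have hB := h.one_le
  have hτ := h.tau_pos y (by linarith [h.one_le_start])
  set E := Real.exp (B * 2 ^ |ν|) with hE
  have hE0 : 0 < E := Real.exp_pos _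
  have key := le_exp_mul_of_abs_deriv_le (f := fun t => (iteratedDeriv 1 V t).im)
    (L := B * E * τ y) (fun t ht => h.hasDerivAt_im (by omega) (h.pos_of_mem hy ht))
    (fun t ht => h.im_deriv_pos (h.start_lt hy ht))
    (fun t ht => by
      have h1 := h.im_deriv_two t (h.start_lt hy ht)
      have h2 := h.tau_le_mul hη hy ht
      have h3 := h.im_deriv_pos (h.start_lt hy ht)
      calc |(iteratedDeriv (1 + 1) V t).im| ≤ B * ((iteratedDeriv 1 V t).im * τ t) := h1
        _ ≤ B * ((iteratedDeriv 1 V t).im * (E * τ y)) := by gcongr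
        _ = _ := by ring) (h.self_mem hη hy) hx
  refine key.trans (mul_le_mul_of_nonneg_right (Real.exp_le_exp.2 ?_)
    (h.im_deriv_pos (h.start_lt hy hx)).le)
  have h1 : |y - x| ≤ 2 * (η / τ y) := by
    rw [abs_le]; exact ⟨by linarith [hx.2], by linarith [hx.1]⟩
  calc B * E * τ y * |y - x| ≤ B * E * τ y * (2 * (η / τ y)) := by gcongr
    _ = _ := by field_simp

theorem slope_le (h : PotentialBounds N V τ ν ε t₁ t₂ η B R) (hη : 0 < η) (hy : 2 * R < y)
    {s t : ℝ} (hs : s ∈ Ioo (y - 2 * (η / τ y)) (y + 2 * (η / τ y)))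
    (ht : t ∈ Ioo (y - 2 * (η / τ y)) (y + 2 * (η / τ y))) (hst : s ≤ t) :
    (iteratedDeriv 1 V y).im * (t - s) ≤
      Real.exp (2 * B * Real.exp (B * 2 ^ |ν|) * η) * ((V t).im - (V s).im) := by
  set E := Real.exp (2 * B * Real.exp (B * 2 ^ |ν|) * η) with hE
  have hE0 : 0 < E := Real.exp_pos _
  have hd : ∀ u ∈ Ioo (y - 2 * (η / τ y)) (y + 2 * (η / τ y)),
      HasDerivAt (fun u => (V u).im) (iteratedDeriv 1 V u).im u := fun u hu => by
    have := h.hasDerivAt_im (i := 0) (by omega) (h.pos_of_mem hy hu)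
    simpa only [iteratedDeriv_zero] using this
  have key := (convex_Ioo (y - 2 * (η / τ y)) (y + 2 * (η / τ y))).mul_sub_le_image_sub_of_le_deriv
    (f := fun u => (V u).im) (C := E⁻¹ * (iteratedDeriv 1 V y).im)
    (fun u hu => (hd u hu).continuousAt.continuousWithinAt)
    (fun u hu => by
      rw [interior_Ioo] at hu
      exact (hd u hu).differentiableAt.differentiableWithinAt)
    (fun u hu => by
      rw [interior_Ioo] at hu
      rw [(hd u hu).deriv, inv_mul_le_iff₀ hE0]
      exact h.im_deriv_le_mul hη hy hu) s hs t ht hst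
  rwa [mul_assoc, inv_mul_le_iff₀ hE0] at key

/-- One constant serves every admissible `α` and every `y > 2 R`: it collects the variation factors
of `τ`, `|V|` and `Im V'`, the comparison constant `K`, and the constant of the smallness condition.
-/
theorem exists_localBounds (h : PotentialBounds N V τ ν ε t₁ t₂ η B R) (hε : 0 < ε) (hη : 0 < η)
    {K : ℝ} (hK : 0 < K) :
    ∃ K' ≥ 1, ∀ α : ℝ, ∀ y > 2 * R,
      (∀ x ∈ Ioo (y - 2 * (η / τ y)) (y + 2 * (η / τ y)), K⁻¹ * |α| ≤ α - (V x).re) →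
      (∀ x ∈ Ioo (y - 2 * (η / τ y)) (y + 2 * (η / τ y)), α - (V x).re ≤ K * |α|) →
      K⁻¹ * ((V y).im * τ y) ^ ((4 : ℝ) / 5) ≤ |α| →
      LocalBounds N V α (V y).im y (τ y) η K' |(V y).re| (iteratedDeriv 1 V y).im := by
  have hB := h.one_le
  have hR := h.one_le_start
  set E₁ := Real.exp (B * 2 ^ |ν|) with hE₁
  set E₂ := Real.exp (2 * B * E₁ * η) with hE₂
  set S := B ^ (1 / 5 : ℝ) * K ^ (1 / 4 : ℝ) + K ^ (5 / 4 : ℝ) with hS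
  have hE₁1 : 1 ≤ E₁ := Real.one_le_exp (by positivity)
  have hE₂1 : 1 ≤ E₂ := Real.one_le_exp (by positivity)
  have hS0 : 0 < S := by positivity
  have hBE : 0 < B * E₁ ^ (N + 3) := by positivity
  set K' := B * E₁ ^ (N + 3) + E₂ + (K + 1) + S with hK'
  have hle₁ : B * E₁ ^ (N + 3) ≤ K' := by linarith
  have hle₂ : E₂ ≤ K' := by linarith
  have hle₃ : K + 1 ≤ K' := by linarith
  have hle₄ : S ≤ K' := by linarith
  have hbd : ∀ y > 2 * R, ∀ i ≤ N + 3, ∀ x ∈ Ioo (y - 2 * (η / τ y)) (y + 2 * (η / τ y)),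
      B * (τ x ^ i * ‖V x‖) ≤ K' * (τ y ^ i * ‖V x‖) := fun y hy i hi x hx => by
    have h1 := h.tau_le_mul hη hy hx
    have h2 := (h.tau_pos x (h.start_lt hy hx)).le
    have h3 := h.tau_pos y (by linarith)
    calc B * (τ x ^ i * ‖V x‖) ≤ B * ((E₁ * τ y) ^ i * ‖V x‖) := by gcongr
      _ = B * E₁ ^ i * (τ y ^ i * ‖V x‖) := by rw [mul_pow]; ring
      _ ≤ B * E₁ ^ (N + 3) * (τ y ^ i * ‖V x‖) := by gcongr
      _ ≤ _ := by gcongr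
  refine ⟨K', by linarith, fun α y hy hlow hup hα => ?_⟩
  have hτ := h.tau_pos y (by linarith)
  have hself := h.self_mem hη hy
  have him := h.one_le_im y (by linarith)
  have hα0 : 0 < |α| := by
    refine lt_of_lt_of_le ?_ hα
    have : 0 < (V y).im := by linarith
    positivity
  have hA := h.im_deriv_pos (x := y) (by linarith)
  refine
    { one_le := by linarith
      eta_pos := hη
      T_pos := hτ
      alpha_pos := hα0
      one_le_beta := him
      slope_pos := hA
      rho_nonneg := abs_nonneg _
      left_pos := ?_
      hasDerivAt := fun i hi x hx => h.hasDerivAt i hi x (h.pos_of_mem hy hx)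
      ae_hasDerivAt := h.ae_hasDerivAt.mono fun x hx hxJ => hx (h.pos_of_mem hy hxJ)
      ac := h.ac
      bound := fun i hi x hx => (h.bound i hi x (h.start_lt hy hx)).trans
        (hbd y hy i (by rw [Finset.mem_Icc] at hi; omega) x hx)
      ae_bound := h.ae_bound.mono fun x hx hxJ => (hx (h.start_lt hy hxJ)).trans
        (hbd y hy _ le_rfl x hxJ)
      re_lower := fun x hx => ?_
      re_upper := fun x hx => (hup x hx).trans (by gcongr; linarith)
      size := fun x hx => ?_
      rho_le := ?_
      slope_right := fun x hx hxy => ?_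
      slope_left := fun x hx hxy => ?_
      small := ?_ }
  · have h1 := h.eta_le y (by linarith)
    have h2 : y ^ (-ν) ≤ y := by
      calc y ^ (-ν) ≤ y ^ (1 : ℝ) :=
            Real.rpow_le_rpow_of_exponent_le (by linarith) (by linarith [h.nu_ge])
        _ = y := Real.rpow_one y
    linarith
  · have h1 := hlow x hx
    have h2 : 0 ≤ α - (V x).re := le_trans (by positivity) h1
    rw [inv_mul_le_iff₀ hK] at h1
    exact h1.trans (by gcongr; linarith)
  · have h1 := Complex.norm_le_abs_re_add_abs_im (V y)
    rw [abs_of_nonneg (by linarith : 0 ≤ (V y).im)] at h1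
    calc ‖V x‖ ≤ E₂ * ‖V y‖ := h.norm_le_mul hη hy hx
      _ ≤ K' * (|(V y).re| + (V y).im) := by gcongr
  · have h1 := hlow y hself
    have h2 := hup y hself
    have h3 : 0 ≤ K⁻¹ * |α| := by positivity
    have h4 : |(V y).re| ≤ (K + 1) * |α| := by
      rw [abs_le]
      constructor <;> nlinarith [le_abs_self α, neg_abs_le α]
    exact h4.trans (by gcongr)
  · have h1 := h.slope_le hη hy hself hx hxy
    have h2 : 0 ≤ (iteratedDeriv 1 V y).im * (x - y) := mul_nonneg hA.le (by linarith)
    have h3 := nonneg_of_mul_nonneg_right (h2.trans h1) (by positivity)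
    exact h1.trans (by gcongr)
  · have h1 := h.slope_le hη hy hx hself hxy
    have h2 : 0 ≤ (iteratedDeriv 1 V y).im * (y - x) := mul_nonneg hA.le (by linarith)
    have h3 := nonneg_of_mul_nonneg_right (h2.trans h1) (by positivity)
    exact h1.trans (by gcongr)
  · exact (mul_one_add_div_le_rpow hε hK hB him hτ hα0 (h.tau_le y (by linarith)) hα).trans
      (by gcongr)

/-- Once `β` exceeds the maximum of `Im V` on `[0, 2 R]`, every solution lies beyond `2 R`, where
`Im V` is strictly increasing. The supremum in `turningPoint` is then over a singleton. -/
theorem exists_turningPoint (h : PotentialBounds N V τ ν ε t₁ t₂ η B R)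
    (hc : ContinuousOn V (Ici 0)) (hlim : Tendsto (fun x => (V x).im) atTop atTop) :
    ∃ β₁ : ℝ, ∀ β ≥ β₁, 2 * R < turningPoint V β ∧ (V (turningPoint V β)).im = β ∧
      {x : ℝ | 0 < x ∧ (V x).im = β} = {turningPoint V β} := by
  have hR := h.one_le_start
  have hcim : ContinuousOn (fun x => (V x).im) (Ici 0) :=
    Complex.continuous_im.comp_continuousOn hc
  have hd : ∀ u > R, HasDerivAt (fun u => (V u).im) (iteratedDeriv 1 V u).im u := fun u hu => by
    have := h.hasDerivAt_im (i := 0) (by omega) (show 0 < u by linarith)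
    simpa only [iteratedDeriv_zero] using this
  have hmono : StrictMonoOn (fun x => (V x).im) (Ioi R) :=
    strictMonoOn_of_deriv_pos (convex_Ioi R)
      (fun u hu => (hd u hu).continuousAt.continuousWithinAt)
      (fun u hu => by
        rw [interior_Ioi] at hu
        rw [(hd u hu).deriv]
        exact h.im_deriv_pos hu)
  obtain ⟨M, hM⟩ := isCompact_Icc.bddAbove_image
    (hcim.mono (Icc_subset_Ici_self : Icc 0 (2 * R) ⊆ Ici 0))
  refine ⟨M + 1, fun β hβ => ?_⟩
  have hle : ∀ x, 0 ≤ x → x ≤ 2 * R → (V x).im < β := fun x hx hx2 => by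
    have := hM (mem_image_of_mem _ (⟨hx, hx2⟩ : x ∈ Icc 0 (2 * R)))
    linarith
  obtain ⟨b, hb, hbβ⟩ := ((eventually_ge_atTop (2 * R)).and
    (hlim.eventually_ge_atTop β)).exists
  obtain ⟨y, hy, hyβ⟩ := intermediate_value_Icc hb
    (hcim.mono fun x hx => by rw [mem_Icc] at hx; rw [mem_Ici]; linarith)
    (⟨(hle _ (by linarith) le_rfl).le, hbβ⟩ : β ∈ Icc _ _)
  have hgt : ∀ x, 0 < x → (V x).im = β → 2 * R < x := fun x hx hxβ => by
    by_contra hn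
    linarith [hle x hx.le (not_lt.1 hn)]
  have hy0 : 0 < y := by linarith [hy.1]
  have hset : {x : ℝ | 0 < x ∧ (V x).im = β} = {y} := by
    ext x
    rw [mem_ofPred_eq, mem_singleton_iff]
    refine ⟨fun ⟨hx, hxβ⟩ => ?_, fun hx => by rw [hx]; exact ⟨hy0, hyβ⟩⟩
    have h1 := hgt x hx hxβ
    have h2 := hgt y hy0 hyβ
    exact hmono.injOn (by rw [mem_Ioi]; linarith) (by rw [mem_Ioi]; linarith)
      (hxβ.trans hyβ.symm)
  have ht : turningPoint V β = y := by rw [turningPoint, hset, csSup_singleton]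
  rw [ht]
  exact ⟨hgt y hy0 hyβ, hyβ, hset⟩

end PotentialBounds

/-! ### Assembly of the theorem -/

theorem sigma_eq_powerSum (N : ℕ) (V : ℝ → ℂ) (τ : ℝ → ℝ) (α β : ℝ) :
    sigma N V τ α β = LocalBounds.powerSum N (τ (turningPoint V β))
      |(V (turningPoint V β)).re| α β := by
  -- The summation index of the error is weight shifted by `d = k + N + 1`, under which `(d - 4)/4 =
  -- (k + N - 3)/4`.
  have hIcc : Finset.Icc (N + 1) (SymbolRing.topWeight N)
      = (Finset.range (if N = 0 then 3 else 3 * N)).image fun k => k + N + 1 := by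
    ext d
    rw [Finset.mem_Icc, Finset.mem_image, SymbolRing.topWeight]
    constructor
    · rintro ⟨h1, h2⟩
      exact ⟨d - N - 1, Finset.mem_range.2 (by omega), by omega⟩
    · rintro ⟨k, hk, rfl⟩
      rw [Finset.mem_range] at hk
      omega
  rw [sigma, LocalBounds.powerSum, hIcc, Finset.sum_image fun a _ b _ hab => by omega]
  refine Finset.sum_congr rfl fun k _ => Finset.sum_congr rfl fun j _ => ?_
  rw [sigmaTerm]
  congr 2
  push_cast
  ring

theorem theorem2 (N : ℕ) (V : ℝ → ℂ) (τ : ℝ → ℝ) (ν ε₁ t₁ t₂ η : ℝ)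
    (hV : PotentialAssumption N V τ ν ε₁ t₁ t₂)
    (hη : 0 < η) (hητ : ∀ᶠ x : ℝ in atTop, η / τ x ≤ x ^ (-ν) / 4)
    (K : ℝ) (hK : 0 < K) :
    ∃ c > 0, ∃ β₀ > 0, ∃ C > 0, ∃ Ψ : ℂ → ℝ → ℂ,
      (∀ β ≥ β₀, {x : ℝ | 0 < x ∧ (V x).im = β} = {turningPoint V β}) ∧
      ∀ α β : ℝ, β₀ ≤ β → AdmissibleReal V τ ε₁ η K β α →
        Function.support (Ψ ⟨α, β⟩) ⊆ modeInterval V τ η β ∧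
        tsupport (Ψ ⟨α, β⟩) ⊆ Ioi 0 ∧
        0 < l2Norm (Ψ ⟨α, β⟩) ∧
        ∃ w : ℝ → ℂ, IsMaximalBiharmonic V (Ψ ⟨α, β⟩) w ∧
          l2Norm (fun x => w x - (⟨α, β⟩ : ℂ) * Ψ ⟨α, β⟩ x) / l2Norm (Ψ ⟨α, β⟩)
            ≤ C * (kappa V τ c α β + sigma N V τ α β) := by
  have hε := hV.eps_pos
  obtain ⟨B, R, h⟩ := hV.exists_potentialBounds hητ
  obtain ⟨K', hK', hloc⟩ := h.exists_localBounds hε hη hK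
  obtain ⟨c, hc, C, hC, hqm⟩ := LocalBounds.exists_quasimode N η K' hη hK'
  obtain ⟨C', hC', β₂, hβ₂, habs⟩ := exists_absorb hε hV.t1_mem hV.t2_mem hV.t_lt hK h.one_le
    (one_pos.trans_le h.one_le) hc hC
  obtain ⟨β₁, htp⟩ := h.exists_turningPoint hV.continuousOn hV.im_tendsto
  have main : ∀ α β : ℝ, max β₁ β₂ ≤ β → AdmissibleReal V τ ε₁ η K β α → ∃ Ψ : ℝ → ℂ,
      Function.support Ψ ⊆ modeInterval V τ η β ∧ tsupport Ψ ⊆ Ioi 0 ∧ 0 < l2Norm Ψ ∧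
      ∃ w : ℝ → ℂ, IsMaximalBiharmonic V Ψ w ∧
        l2Norm (fun x => w x - (⟨α, β⟩ : ℂ) * Ψ x) / l2Norm Ψ
          ≤ (C + C * C') * (kappa V τ (c / 2) α β + sigma N V τ α β) := by
    intro α β hβ hα
    obtain ⟨hy, hyβ, -⟩ := htp β ((le_max_left _ _).trans hβ)
    have hyR : R < turningPoint V β := by linarith [h.one_le_start]
    have hlb := hloc α _ hy hα.sub_re_lower hα.sub_re_upper (by rw [hyβ]; exact hα.lower)
    rw [hyβ] at hlb
    obtain ⟨Ψ, w, h1, h2, h3, h4, h5⟩ := hqm hlb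
    refine ⟨Ψ, h1, h2, h3, w, h4, h5.trans ?_⟩
    -- The factor `C'` and half of the decay constant are the price for removing the polynomial and
    -- the lower order phase.
    have h6 := habs β |α| _ _ ((le_max_right _ _).trans hβ) hlb.T_pos hlb.alpha_pos
      (by have := h.tau_le _ hyR; rwa [hyβ] at this)
      (by have := h.im_deriv_lower _ hyR; rwa [hyβ] at this) hα.lower hα.upper
    rw [← sigma_eq_powerSum]
    have hs : 0 ≤ sigma N V τ α β := by
      have := hlb.T_pos
      have := hlb.one_le_beta
      refine Finset.sum_nonneg fun k _ => Finset.sum_nonneg fun j _ => ?_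
      rw [sigmaTerm]
      positivity
    have hk : 0 ≤ kappa V τ (c / 2) α β := (Real.exp_pos _).le
    calc _ ≤ C * sigma N V τ α β + C * (C' * kappa V τ (c / 2) α β) :=
          add_le_add le_rfl (mul_le_mul_of_nonneg_left h6 hC.le)
      _ ≤ _ := by
          have := mul_nonneg (mul_pos hC hC').le hs
          have := mul_nonneg hC.le hk
          linarith
  choose! Ψ hΨ using main
  exact ⟨c / 2, by positivity, max β₁ β₂, lt_max_of_lt_right (by linarith), C + C * C',
    by positivity, fun l => Ψ l.re l.im,
    fun β hβ => (htp β ((le_max_left _ _).trans hβ)).2.2, hΨ⟩
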